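/- **Theorem (asymptotic normality of sieve $t$-statistics in NPIV).** Let $\{(Y_i,X_i,W_i)\}_{i\ge 1}$ be i.i.d. with $Y_i=h_0(X_i)+u_i$, $E[u_i\mid W_i]=0$, $Y_i\in\mathbb R$, $X_i\in\mathcal X\subseteq\mathbb R^d$, $W_i\in\mathcal W\subseteq\mathbb R^{d_w}$, $h_0\in L^\infty(X)$, where $L^\infty(X)$ denotes the bounded measurable functions $\mathcal X\to\mathbb R$ with the sup norm $\|\cdot\|_\infty$. Let $\psi^J=(\psi_{J1},\dots,\psi_{JJ})'$ and $b^K=(b_{K1},\dots,b_{KK})'$ be vectors of bounded measurable functions on $\mathcal X$ and $\mathcal W$, with linear spans $\Psi_J\subset L^2(X)$ and $B_K\subset L^2(W)$; let $J=J(n)$ and $K=K(n)$ satisfy $J\le K=O(J)$. Put $G_\psi=E[\psi^J(X_i)\psi^J(X_i)']$, $G_b=E[b^K(W_i)b^K(W_i)']$, $S=E[b^K(W_i)\psi^J(X_i)']$, $\Omega=E[u_i^2b^K(W_i)b^K(W_i)']$; assume that $G_\psi$ and $G_b$ are positive definite and that $S$ has full column rank. Let $\Psi$ and $B$ be the matrices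 with rows $\psi^J(X_i)'$ and $b^K(W_i)'$, $i\le n$, and $A^-$ the Moore–Penrose inverse of $A$. For $y\in\mathbb R^n$ let $\widehat c(y)=[\Psi'B(B'B)^-B'\Psi]^-\Psi'B(B'B)^-B'y$, and define $\widehat h=\psi^{J\prime}\,\widehat c\big((Y_i)_{i\le n}\big)$ and $\widetilde h=\psi^{J\prime}\,\widehat c\big((h_0(X_i))_{i\le n}\big)$. Let $T:L^2(X)\to L^2(W)$, $Th=E[h(X_i)\mid W_i=\cdot\,]$, let $\Pi_K$ be the orthogonal projection of $L^2(W)$ onto $B_K$, $\Psi_{J,1}=\{h\in\Psi_J:\|h\|_{L^2(X)}=1\}$, $\tau_J=1/\inf_{h\in\Psi_{J,1}}\|Th\|_{L^2(W)}$, and $$\zeta=\max\Big\{\sup_x\|G_\psi^{-1/2}\psi^J(x)\|_{\ell^2},\ \sup_w\|G_b^{-1/2}b^K(w)\|_{\ell^2}\Big\}.$$ Let $f:L^\infty(X)\to\mathbb R$ be such that $f(\widehat h)$ is a random variable. Write $\frac{\partial f(h)}{\partial h}[g]=\lim_{\delta\to0^+}\frac{f(h+\delta g)-f(h)}{\delta}$,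 let $\frac{\partial f(h)}{\partial h}[\psi^J]\in\mathbb R^J$ be the vector of derivatives in the directions $\psi_{Jj}$, and put $\|h\|=\|\Pi_KTh\|_{L^2(W)}$, $$v_n^*=\psi^{J\prime}[S'G_b^{-1}S]^{-1}\tfrac{\partial f(h_0)}{\partial h}[\psi^J],\qquad \widehat v_n^*=\psi^{J\prime}[S'G_b^{-1}S]^{-1}\tfrac{\partial f(\widehat h)}{\partial h}[\psi^J],$$ $$\|v_n^*\|_{sd}^2=\tfrac{\partial f(h_0)}{\partial h}[\psi^J]'[S'G_b^{-1}S]^{-1}S'G_b^{-1}\Omega G_b^{-1}S[S'G_b^{-1}S]^{-1}\tfrac{\partial f(h_0)}{\partial h}[\psi^J].$$ Let $\widehat{\|v_n^*\|}_{sd}^2$ be the same expression with $\frac{\partial f(\widehat h)}{\partial h}[\psi^J]$, $\widehat S=B'\Psi/n$, $\widehat G_b=B'B/n$ and $\widehat\Omega=n^{-1}\sum_{i\le n}(Y_i-\widehat h(X_i))^2b^K(W_i)b^K(W_i)'$ in place of $\frac{\partial f(h_0)}{\partial h}[\psi^J]$, $S$, $G_b$ and $\Omega$. Assume $\|v_n^*\|\ne0$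 for all large $n$. (1) Suppose that - $T$ is injective; - $\sup_wE[u_i^2\mid W_i=w]<\infty$, $\ \inf_wE[u_i^2\mid W_i=w]>0$, and $\sup_wE[u_i^2\mathbf 1\{|u_i|>\ell(n)\}\mid W_i=w]=o(1)$ for every positive sequence $\ell(n)\nearrow\infty$; - $\sup_{h\in\Psi_{J,1}}\|(\Pi_KT-T)h\|_{L^2(W)}=o(\tau_J^{-1})$; - either (a) $f$ is linear and $\|v_n^*\|^{-1}(f(\widetilde h)-f(h_0))=o_p(n^{-1/2})$; or (b) $g\mapsto\frac{\partial f(h_0)}{\partial h}[g]$ exists and is a linear functional on $L^\infty(X)$, and $\sqrt n\,\frac{f(\widehat h)-f(h_0)}{\|v_n^*\|}=\sqrt n\,\frac{\frac{\partial f(h_0)}{\partial h}[\widehat h-\widetilde h]}{\|v_n^*\|}+o_p(1)$; - $\tau_J\,\zeta\sqrt{(J\log n)/n}=o(1)$. Then $\sqrt n\,\dfrac{f(\widehat h)-f(h_0)}{\|v_n^*\|_{sd}}\Rightarrow N(0,1)$. (2) If, in addition, $\|\widehat h-h_0\|_\infty=o_p(1)$; for some $\delta>0$, $E[|u_i|^{2+\delta}]<\infty$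 and $\zeta^{(2+\delta)/\delta}\sqrt{(\log n)/n}=o(1)$; and, when $f$ is not linear, the derivatives of $f$ at $\widehat h$ in the directions $\psi_{J1},\dots,\psi_{JJ}$ exist with probability approaching one, are random variables, and satisfy $\|\widehat v_n^*-v_n^*\|/\|v_n^*\|=o_p(1)$; then $$\left|\frac{\widehat{\|v_n^*\|}_{sd}}{\|v_n^*\|_{sd}}-1\right|=o_p(1)\qquad\text{and}\qquad \sqrt n\,\frac{f(\widehat h)-f(h_0)}{\widehat{\|v_n^*\|}_{sd}}\Rightarrow N(0,1).$$ -/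

import Mathlib

open MeasureTheory ProbabilityTheory Filter Topology
open scoped Matrix

noncomputable section

namespace NPIV

/-- `L^∞`: the bounded measurable real functions on `α` (functions, not classes). -/
def Linf (α : Type*) [MeasurableSpace α] : Submodule ℝ (α → ℝ) where
  carrier := {h | Measurable h ∧ ∃ C : ℝ, ∀ x, |h x| ≤ C}
  zero_mem' := ⟨measurable_const, 0, fun x => by simp⟩
  add_mem' := by
    rintro g h ⟨hg, C, hC⟩ ⟨hh, D, hD⟩
    exact ⟨hg.add hh, C + D, fun x => (abs_add_le _ _).trans (add_le_add (hC x) (hD x))⟩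
  smul_mem' := by
    rintro c h ⟨hh, C, hC⟩
    refine ⟨hh.const_smul c, |c| * C, fun x => ?_⟩
    simpa [abs_mul] using mul_le_mul_of_nonneg_left (hC x) (abs_nonneg c)

variable {Ω 𝒳 𝒲 : Type*} [MeasurableSpace Ω] [MeasurableSpace 𝒳] [MeasurableSpace 𝒲]

/-- The sup norm `sup_x |h x|`. -/
def supNorm (h : Linf 𝒳) : ℝ := ⨆ x, |(h : 𝒳 → ℝ) x|

/-- `f` has the one-sided directional derivative `d` at `h` in the direction `g`. -/
def HasDirDeriv (f : Linf 𝒳 → ℝ) (h g : Linf 𝒳) (d : ℝ) : Prop :=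
  Tendsto (fun δ : ℝ => (f (h + δ • g) - f h) / δ) (𝓝[>] 0) (𝓝 d)

/-- The directional derivative `∂f(h)/∂h [g]`. -/
def dirDeriv (f : Linf 𝒳 → ℝ) (h g : Linf 𝒳) : ℝ :=
  limUnder (𝓝[>] (0 : ℝ)) (fun δ : ℝ => (f (h + δ • g) - f h) / δ)

theorem HasDirDeriv.dirDeriv_eq {f : Linf 𝒳 → ℝ} {h g : Linf 𝒳} {d : ℝ}
    (H : HasDirDeriv f h g d) : dirDeriv f h g = d := H.limUnder_eq

/-- The Moore–Penrose generalized inverse `A⁻` of a symmetric real matrix: nonzero eigenvalues are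
inverted, zero eigenvalues are kept. It is applied to symmetric matrices only. -/
def pinv {m : ℕ} (A : Matrix (Fin m) (Fin m) ℝ) : Matrix (Fin m) (Fin m) ℝ :=
  cfc (fun t : ℝ => t⁻¹) A

/-- `A^{-1/2}` for a positive definite matrix `A`. -/
def invSqrt {m : ℕ} (A : Matrix (Fin m) (Fin m) ℝ) : Matrix (Fin m) (Fin m) ℝ :=
  cfc (fun t : ℝ => (Real.sqrt t)⁻¹) A

theorem pinv_mul_self_mul {m : ℕ} {A : Matrix (Fin m) (Fin m) ℝ} (hA : A.IsHermitian) :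
    A * pinv A * A = A := by
  have hA' : IsSelfAdjoint A := hA
  have hc : ∀ g : ℝ → ℝ, ContinuousOn g (spectrum ℝ A) :=
    fun g => (Matrix.finite_real_spectrum (A := A)).continuousOn g
  have h1 : cfc (fun t : ℝ => t * t⁻¹ * t) A = A * pinv A * A := by
    rw [cfc_mul (fun t : ℝ => t * t⁻¹) (fun t : ℝ => t) A (hc _) (hc _),
      cfc_mul (fun t : ℝ => t) (fun t : ℝ => t⁻¹) A (hc _) (hc _), cfc_id' ℝ A]
    rfl
  rw [← h1]
  conv_rhs => rw [← cfc_id' ℝ A]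
  congr 1
  funext t
  exact mul_inv_mul_cancel t

theorem invSqrt_mul_self_mul {m : ℕ} {A : Matrix (Fin m) (Fin m) ℝ} (hA : A.PosDef) :
    invSqrt A * invSqrt A * A = 1 := by
  have hA' : IsSelfAdjoint A := hA.1
  have hc : ∀ g : ℝ → ℝ, ContinuousOn g (spectrum ℝ A) :=
    fun g => (Matrix.finite_real_spectrum (A := A)).continuousOn g
  have h1 : cfc (fun t : ℝ => (Real.sqrt t)⁻¹ * (Real.sqrt t)⁻¹ * t) A
      = invSqrt A * invSqrt A * A := by
    rw [cfc_mul (fun t : ℝ => (Real.sqrt t)⁻¹ * (Real.sqrt t)⁻¹) (fun t : ℝ => t) A (hc _) (hc _),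
      cfc_mul (fun t : ℝ => (Real.sqrt t)⁻¹) (fun t : ℝ => (Real.sqrt t)⁻¹) A (hc _) (hc _),
      cfc_id' ℝ A]
    rfl
  rw [← h1, ← cfc_const_one ℝ A]
  refine cfc_congr fun t ht => ?_
  have ht0 : 0 < t := by
    rw [hA.1.spectrum_real_eq_range_eigenvalues] at ht
    obtain ⟨i, rfl⟩ := ht
    exact hA.eigenvalues_pos i
  have := Real.mul_self_sqrt ht0.le
  have hs : Real.sqrt t ≠ 0 := (Real.sqrt_pos.2 ht0).ne'
  field_simp
  nlinarith

section L2

variable (μ : Measure Ω) [IsProbabilityMeasure μ]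

/-- The space `L²(V)` of (classes of) square integrable functions of the random element `V`,
realised inside `L²(μ)` as the classes that are measurable for the σ-algebra of `V`. -/
abbrev L2of {𝒱 : Type*} [mV : MeasurableSpace 𝒱] (V : Ω → 𝒱) : Submodule ℝ (Lp ℝ 2 μ) :=
  lpMeas ℝ ℝ (mV.comap V) 2 μ

theorem memLp_comp {𝒱 : Type*} [MeasurableSpace 𝒱] {V : Ω → 𝒱} (hV : Measurable V) (h : Linf 𝒱) :
    MemLp (fun ω => (h : 𝒱 → ℝ) (V ω)) 2 μ := by
  obtain ⟨hm, C, hC⟩ := h.2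
  exact MemLp.of_bound (hm.comp hV).aestronglyMeasurable C (Eventually.of_forall fun ω => hC _)

/-- The class of `h(V)` in `L²(V)`. -/
def toL2 {𝒱 : Type*} [mV : MeasurableSpace 𝒱] {V : Ω → 𝒱} (hV : Measurable V) (h : Linf 𝒱) :
    L2of μ V :=
  ⟨(memLp_comp μ hV h).toLp, by
    rw [mem_lpMeas_iff_aestronglyMeasurable]
    exact ⟨fun ω => (h : 𝒱 → ℝ) (V ω),
      (h.2.1.comp (comap_measurable V)).stronglyMeasurable, MemLp.coeFn_toLp _⟩⟩

/-- The conditional expectation operator `T : L²(X) → L²(W)`, `T h = E[h(X) | W]`. -/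
def condExpOp {X : Ω → 𝒳} {W : Ω → 𝒲} (hW : Measurable W) : L2of μ X →L[ℝ] L2of μ W :=
  (condExpL2 ℝ ℝ hW.comap_le).comp (L2of μ X).subtypeL

/-- The linear space spanned by (the classes of) finitely many functions of `V`. -/
def sieveSpace {𝒱 : Type*} [MeasurableSpace 𝒱] {V : Ω → 𝒱} (hV : Measurable V) {m : ℕ}
    (e : Fin m → Linf 𝒱) : Submodule ℝ (L2of μ V) :=
  Submodule.span ℝ (Set.range fun j => toL2 μ hV (e j))

instance {𝒱 : Type*} [MeasurableSpace 𝒱] {V : Ω → 𝒱} (hV : Measurable V) {m : ℕ}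
    (e : Fin m → Linf 𝒱) : FiniteDimensional ℝ (sieveSpace μ hV e) :=
  FiniteDimensional.span_of_finite ℝ (Set.finite_range _)

end L2

/-- The objects of a sieve NPIV problem: observations `(Y i, X i, W i)`, `i = 0, 1, …` (the sample
of size `n` is `i < n`), structural function `h₀`, bases `ψ^J` and `b^K` for every dimension, and
the dimensions `J n`, `K n` used with sample size `n`. -/
structure Model (Ω 𝒳 𝒲 : Type*) [MeasurableSpace Ω] [MeasurableSpace 𝒳] [MeasurableSpace 𝒲] where
  Y : ℕ → Ω → ℝ
  X : ℕ → Ω → 𝒳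
  W : ℕ → Ω → 𝒲
  measurable_Y : ∀ i, Measurable (Y i)
  measurable_X : ∀ i, Measurable (X i)
  measurable_W : ∀ i, Measurable (W i)
  h₀ : Linf 𝒳
  ψ : (J : ℕ) → Fin J → Linf 𝒳
  b : (K : ℕ) → Fin K → Linf 𝒲
  J : ℕ → ℕ
  K : ℕ → ℕ

namespace Model

variable (M : Model Ω 𝒳 𝒲) (μ : Measure Ω)

/-- The vector `ψ^{J(n)}(x)`. -/
def ψvec (n : ℕ) (x : 𝒳) : Fin (M.J n) → ℝ := fun j => (M.ψ (M.J n) j : 𝒳 → ℝ) x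

/-- The vector `b^{K(n)}(w)`. -/
def bvec (n : ℕ) (w : 𝒲) : Fin (M.K n) → ℝ := fun k => (M.b (M.K n) k : 𝒲 → ℝ) w

/-- The element `ψ^{J(n)}(·)' c` of the sieve space. -/
def lin (n : ℕ) (c : Fin (M.J n) → ℝ) : Linf 𝒳 := ∑ j, c j • M.ψ (M.J n) j

/-- The residual `u_i = Y_i - h₀(X_i)`. -/
def u (i : ℕ) (ω : Ω) : ℝ := M.Y i ω - (M.h₀ : 𝒳 → ℝ) (M.X i ω)

/-- The σ-algebra generated by `W_i`. -/
abbrev sigmaW (i : ℕ) : MeasurableSpace Ω := MeasurableSpace.comap (M.W i) inferInstance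

/-- The data are a random sample from `Y = h₀(X) + u`, `E[u | W] = 0`. -/
structure IsRandomSample : Prop where
  indep : iIndepFun (fun i ω => (M.Y i ω, M.X i ω, M.W i ω)) μ
  ident : ∀ i, IdentDistrib (fun ω => (M.Y i ω, M.X i ω, M.W i ω))
    (fun ω => (M.Y 0 ω, M.X 0 ω, M.W 0 ω)) μ μ
  integrable_u : Integrable (M.u 0) μ
  condExp_u : μ[M.u 0 | M.sigmaW 0] =ᵐ[μ] 0

/-! Population matrices. -/

/-- `G_ψ = E[ψ^J(X) ψ^J(X)']`. -/
def Gψ (n : ℕ) : Matrix (Fin (M.J n)) (Fin (M.J n)) ℝ :=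
  Matrix.of fun i j => ∫ ω, M.ψvec n (M.X 0 ω) i * M.ψvec n (M.X 0 ω) j ∂μ

/-- `G_b = E[b^K(W) b^K(W)']`. -/
def Gb (n : ℕ) : Matrix (Fin (M.K n)) (Fin (M.K n)) ℝ :=
  Matrix.of fun k l => ∫ ω, M.bvec n (M.W 0 ω) k * M.bvec n (M.W 0 ω) l ∂μ

/-- `S = E[b^K(W) ψ^J(X)']`. -/
def S (n : ℕ) : Matrix (Fin (M.K n)) (Fin (M.J n)) ℝ :=
  Matrix.of fun k j => ∫ ω, M.bvec n (M.W 0 ω) k * M.ψvec n (M.X 0 ω) j ∂μ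

/-- The score covariance matrix `E[u² b^K(W) b^K(W)']`. -/
def Om (n : ℕ) : Matrix (Fin (M.K n)) (Fin (M.K n)) ℝ :=
  Matrix.of fun k l => ∫ ω, M.u 0 ω ^ 2 * (M.bvec n (M.W 0 ω) k * M.bvec n (M.W 0 ω) l) ∂μ

/-- `J ≤ K = O(J)`, `G_ψ` and `G_b` are positive definite, `S` has full column rank. -/
structure IsRegularSieve : Prop where
  J_le_K : ∀ n, M.J n ≤ M.K n
  K_isBigO : (fun n => (M.K n : ℝ)) =O[atTop] fun n => (M.J n : ℝ)
  posDef_Gψ : ∀ n, (M.Gψ μ n).PosDef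
  posDef_Gb : ∀ n, (M.Gb μ n).PosDef
  rank_S : ∀ n, (M.S μ n).rank = M.J n

/-- `ζ_{ψ,J} = sup_x ‖G_ψ^{-1/2} ψ^J(x)‖`, Euclidean norm. -/
def ζψ (n : ℕ) : ℝ := ⨆ x, ‖WithLp.toLp 2 (invSqrt (M.Gψ μ n) *ᵥ M.ψvec n x)‖

/-- `ζ_{b,K} = sup_w ‖G_b^{-1/2} b^K(w)‖`, Euclidean norm. -/
def ζb (n : ℕ) : ℝ := ⨆ w, ‖WithLp.toLp 2 (invSqrt (M.Gb μ n) *ᵥ M.bvec n w)‖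

/-- `ζ = ζ_{b,K} ∨ ζ_{ψ,J}`. -/
def ζ (n : ℕ) : ℝ := max (M.ζb μ n) (M.ζψ μ n)

/-! The operator, the sieve spaces and the measure of ill-posedness. -/

section Operator

variable [IsProbabilityMeasure μ]

/-- `T : L²(X) → L²(W)`, `T h = E[h(X) | W]`. -/
def T : L2of μ (M.X 0) →L[ℝ] L2of μ (M.W 0) := condExpOp μ (M.measurable_W 0)

/-- The sieve space `Ψ_{J(n)} ⊆ L²(X)`. -/
def ΨJ (n : ℕ) : Submodule ℝ (L2of μ (M.X 0)) :=
  sieveSpace μ (M.measurable_X 0) (M.ψ (M.J n))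

/-- The orthogonal projection `Π_K` of `L²(W)` onto the instrument sieve space `B_{K(n)}`. -/
def projK (n : ℕ) : L2of μ (M.W 0) →L[ℝ] L2of μ (M.W 0) :=
  (sieveSpace μ (M.measurable_W 0) (M.b (M.K n))).starProjection

/-- The unit sphere `Ψ_{J,1}` of the sieve space. -/
def ΨJ1 (n : ℕ) : Set (L2of μ (M.X 0)) := {h | h ∈ M.ΨJ μ n ∧ ‖h‖ = 1}

/-- The sieve measure of ill-posedness `τ_J = 1 / inf {‖T h‖ : h ∈ Ψ_J, ‖h‖ = 1}`. -/
def τ (n : ℕ) : ℝ := 1 / ⨅ h : M.ΨJ1 μ n, ‖M.T μ (h : L2of μ (M.X 0))‖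

/-- `sup {‖(Π_K T - T) h‖ : h ∈ Ψ_J, ‖h‖ = 1}`. -/
def instrErr (n : ℕ) : ℝ :=
  ⨆ h : M.ΨJ1 μ n, ‖M.projK μ n (M.T μ (h : L2of μ (M.X 0))) - M.T μ (h : L2of μ (M.X 0))‖

/-- The weak norm `‖h‖ = ‖Π_K T h‖_{L²(W)}`. -/
def weakNorm (n : ℕ) (h : Linf 𝒳) : ℝ :=
  ‖M.projK μ n (M.T μ (toL2 μ (M.measurable_X 0) h))‖

end Operator

/-! The sieve 2SLS estimator. -/

/-- The `n × J` matrix `Ψ` with rows `ψ^J(X_i)'`. -/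
def Ψmat (n : ℕ) (ω : Ω) : Matrix (Fin n) (Fin (M.J n)) ℝ :=
  Matrix.of fun i => M.ψvec n (M.X i ω)

/-- The `n × K` matrix `B` with rows `b^K(W_i)'`. -/
def Bmat (n : ℕ) (ω : Ω) : Matrix (Fin n) (Fin (M.K n)) ℝ :=
  Matrix.of fun i => M.bvec n (M.W i ω)

/-- The sieve 2SLS coefficient `[Ψ'B(B'B)⁻B'Ψ]⁻ Ψ'B(B'B)⁻B' y` for the response vector `y`. -/
def tsls (n : ℕ) (ω : Ω) (y : Fin n → ℝ) : Fin (M.J n) → ℝ :=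
  let Ψ := M.Ψmat n ω
  let B := M.Bmat n ω
  pinv (Ψᵀ * B * pinv (Bᵀ * B) * Bᵀ * Ψ) *ᵥ ((Ψᵀ * B * pinv (Bᵀ * B) * Bᵀ) *ᵥ y)

/-- The sieve NPIV estimator `ĥ`. -/
def hhat (n : ℕ) (ω : Ω) : Linf 𝒳 := M.lin n (M.tsls n ω fun i => M.Y i ω)

/-- `h̃`: the sieve NPIV estimator applied to the noiseless responses `h₀(X_i)`. -/
def htilde (n : ℕ) (ω : Ω) : Linf 𝒳 :=
  M.lin n (M.tsls n ω fun i => (M.h₀ : 𝒳 → ℝ) (M.X i ω))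

/-- `Ĝ_b = B'B/n`. -/
def Gbhat (n : ℕ) (ω : Ω) : Matrix (Fin (M.K n)) (Fin (M.K n)) ℝ :=
  (n : ℝ)⁻¹ • ((M.Bmat n ω)ᵀ * M.Bmat n ω)

/-- `Ŝ = B'Ψ/n`. -/
def Shat (n : ℕ) (ω : Ω) : Matrix (Fin (M.K n)) (Fin (M.J n)) ℝ :=
  (n : ℝ)⁻¹ • ((M.Bmat n ω)ᵀ * M.Ψmat n ω)

/-- The fitted residual `û_i = Y_i - ĥ(X_i)`. -/
def uhat (n : ℕ) (ω : Ω) (i : ℕ) : ℝ := M.Y i ω - (M.hhat n ω : 𝒳 → ℝ) (M.X i ω)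

/-- `n⁻¹ ∑ û_i² b^K(W_i) b^K(W_i)'`. -/
def Omhat (n : ℕ) (ω : Ω) : Matrix (Fin (M.K n)) (Fin (M.K n)) ℝ :=
  (n : ℝ)⁻¹ • ∑ i : Fin n, M.uhat n ω i ^ 2 •
    Matrix.vecMulVec (M.bvec n (M.W i ω)) (M.bvec n (M.W i ω))

/-! Riesz representers and sieve variances. -/

variable (f : Linf 𝒳 → ℝ)

/-- The vector `∂f(h)/∂h [ψ^J]`. -/
def Dψ (n : ℕ) (h : Linf 𝒳) : Fin (M.J n) → ℝ := fun j => dirDeriv f h (M.ψ (M.J n) j)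

/-- `v_n^*(x) = ψ^J(x)' [S' G_b^{-1} S]^{-1} ∂f(h₀)/∂h [ψ^J]`. -/
def vstar (n : ℕ) : Linf 𝒳 :=
  M.lin n (((M.S μ n)ᵀ * (M.Gb μ n)⁻¹ * M.S μ n)⁻¹ *ᵥ M.Dψ f n M.h₀)

/-- `v̂_n^*(x) = ψ^J(x)' [S' G_b^{-1} S]^{-1} ∂f(ĥ)/∂h [ψ^J]`. -/
def vhatstar (n : ℕ) (ω : Ω) : Linf 𝒳 :=
  M.lin n (((M.S μ n)ᵀ * (M.Gb μ n)⁻¹ * M.S μ n)⁻¹ *ᵥ M.Dψ f n (M.hhat n ω))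

end Model

/-- The sandwich form
`D' [S' G^{-1} S]^{-1} S' G^{-1} Ω G^{-1} S [S' G^{-1} S]^{-1} D`. -/
def sandwich {J K : ℕ} (D : Fin J → ℝ) (S : Matrix (Fin K) (Fin J) ℝ)
    (G Om : Matrix (Fin K) (Fin K) ℝ) : ℝ :=
  D ⬝ᵥ (((Sᵀ * G⁻¹ * S)⁻¹ * Sᵀ * G⁻¹ * Om * G⁻¹ * S * (Sᵀ * G⁻¹ * S)⁻¹) *ᵥ D)

namespace Model

variable (M : Model Ω 𝒳 𝒲) (μ : Measure Ω) (f : Linf 𝒳 → ℝ)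

/-- `‖v_n^*‖_sd`. -/
def sd (n : ℕ) : ℝ := Real.sqrt (sandwich (M.Dψ f n M.h₀) (M.S μ n) (M.Gb μ n) (M.Om μ n))

/-- The estimator of `‖v_n^*‖_sd`. -/
def sdhat (n : ℕ) (ω : Ω) : ℝ :=
  Real.sqrt (sandwich (M.Dψ f n (M.hhat n ω)) (M.Shat n ω) (M.Gbhat n ω) (M.Omhat n ω))

/-! The assumptions. -/

/-- `sup_w E[u² | W = w] ≤ σ̄² < ∞`. -/
def CondVarBounded : Prop :=
  MemLp (M.u 0) 2 μ ∧
    ∃ C : ℝ, ∀ᵐ ω ∂μ, (μ[fun ω => M.u 0 ω ^ 2 | M.sigmaW 0]) ω ≤ C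

/-- `E[u² | W = w] ≥ σ² > 0` uniformly in `w`. -/
def CondVarBddBelow : Prop :=
  ∃ c : ℝ, 0 < c ∧ ∀ᵐ ω ∂μ, c ≤ (μ[fun ω => M.u 0 ω ^ 2 | M.sigmaW 0]) ω

/-- `sup_w E[u² 1{|u| > ℓ(n)} | W = w] = o(1)` for every positive sequence `ℓ(n) ↗ ∞`. -/
def CondUnifIntegrable : Prop :=
  ∀ ℓ : ℕ → ℝ, (∀ n, 0 < ℓ n) → Monotone ℓ → Tendsto ℓ atTop atTop →
    ∀ ε : ℝ, 0 < ε → ∀ᶠ n in atTop, ∀ᵐ ω ∂μ,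
      (μ[{ω | ℓ n < |M.u 0 ω|}.indicator (fun ω => M.u 0 ω ^ 2) | M.sigmaW 0]) ω ≤ ε

variable [IsProbabilityMeasure μ]

/-- `f` is linear and `‖v_n^*‖^{-1} (f(h̃) - f(h₀)) = o_p(n^{-1/2})`. -/
def LinearCase : Prop :=
  IsLinearMap ℝ f ∧
    TendstoInMeasure μ
      (fun (n : ℕ) ω => Real.sqrt n * ((f (M.htilde n ω) - f M.h₀) / M.weakNorm μ n (M.vstar μ f n)))
      atTop (fun _ => 0)

/-- `g ↦ ∂f(h₀)/∂h [g]` is a (well defined) linear functional and `√n (f(ĥ) - f(h₀)) / ‖v_n^*‖`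
equals `√n ∂f(h₀)/∂h [ĥ - h̃] / ‖v_n^*‖` up to `o_p(1)`. -/
def LinearizableCase : Prop :=
  (∃ L : Linf 𝒳 →ₗ[ℝ] ℝ, ∀ g, HasDirDeriv f M.h₀ g (L g)) ∧
    TendstoInMeasure μ
      (fun (n : ℕ) ω =>
        Real.sqrt n * (f (M.hhat n ω) - f M.h₀) / M.weakNorm μ n (M.vstar μ f n) -
        Real.sqrt n * dirDeriv f M.h₀ (M.hhat n ω - M.htilde n ω) /
          M.weakNorm μ n (M.vstar μ f n))
      atTop (fun _ => 0)

/-- `‖v̂_n^* - v_n^*‖ / ‖v_n^*‖ = o_p(1)`, where the derivatives of `f` at `ĥ` in the directions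
`ψ_{J1}, …, ψ_{JJ}` exist with probability approaching one and are random variables. -/
def RepresenterConsistent : Prop :=
  (∀ n j, AEMeasurable (fun ω => M.Dψ f n (M.hhat n ω) j) μ) ∧
    Tendsto (fun n => μ {ω | ¬ ∀ j, ∃ d, HasDirDeriv f (M.hhat n ω) (M.ψ (M.J n) j) d})
      atTop (𝓝 0) ∧
    TendstoInMeasure μ
      (fun n ω => M.weakNorm μ n (M.vhatstar μ f n ω - M.vstar μ f n) /
        M.weakNorm μ n (M.vstar μ f n))
      atTop (fun _ => 0)

end Model

/-- Convergence in distribution to `N(0,1)`. -/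
def TendstoStdNormal (μ : Measure Ω) [IsProbabilityMeasure μ] (t : ℕ → Ω → ℝ) : Prop :=
  TendstoInDistribution t atTop (id : ℝ → ℝ) (fun _ => μ) (gaussianReal 0 1)

end NPIV

end

open NPIV

set_option linter.unusedSectionVars false

/-! Everything is transported to the orthonormalised bases `bw` = G_b^{-1/2} b and `pw` = G_ψ^{-1/2}
ψ. There G_b becomes the identity and S becomes a matrix `Sw` whose smallest singular value is
eventually at least 1/(2τ) (`le_vnorm_Sw_mulVec`). The weak norm of the representer is the Euclidean
norm of a coefficient vector a (`astar`), and the squared sieve standard deviation is E[u² (a'b)²],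
comparable to |a|² because the conditional variance of u is bounded above and away from zero.

Normality. Up to o_p(1), the t-statistic is √n L(ĥ - h̃)/sd, with L the derivative of f at h₀ (f
itself when f is linear). Two-stage least squares is linear in the response, so with probability
tending to one √n L(ĥ - h̃) = â · score, where â is the sample analogue of a and score = n^{-1/2} ∑
u_i b(W_i). The score has norm of order √K, and |â - a| = o_p(|a|/√K): this combines a deterministic
perturbation bound (`vnorm_avec_sub_le`) with second moments of the sample matrices applied to fixed
vectors. What remains, a · score / sd, is a normalised i.i.d. row sum. Lindeberg's condition holds
because ζ²/n → 0 and u² is conditionally uniformly integrable (`tendsto_lead`).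

Variance. The estimator `sdhat` is the empirical L² norm of û_i α'b(W_i), where α is built from the
derivative at ĥ. The triangle inequality compares it with the norm of u_i a'b(W_i). Replacing û by u
costs the sup norm of ĥ - h₀. Replacing α by a costs |α - a| times the root of the largest
eigenvalue of n⁻¹ ∑ u_i² b b'. The remaining norm converges to sd by a truncated weak law. Since the
derivative at ĥ is random, closeness of α must be uniform over directions
(`eventually_vnorm_ahat_sub_le_mul`).

That eigenvalue is O_p(1) (`exists_empMean_res_sq_le`): residuals are truncated, the tail is removed
by the 2+δ moment, and the bounded part is handled by a matrix Chernoff bound. The latter bounds E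
tr (1 + ∑ x_i x_i')^p by adding one observation at a time, using a scalar inequality for rank one
updates. Slutsky's lemma then replaces sd by its estimator. -/

namespace NPIV

/-! ### Convergence in probability as convergence along a filter. -/

section ProbFilter

variable {Ω : Type*} [MeasurableSpace Ω]

/-- The filter of events `A n` (subsets of `Ω` indexed by `ℕ`) whose probability tends to one,
in the sense that the outer measure of the complement tends to zero. Convergence in probability is
convergence along this filter. -/
def probFilter (μ : Measure Ω) : Filter (ℕ × Ω) where
  sets := {A | Tendsto (fun n => μ {ω | (n, ω) ∉ A}) atTop (𝓝 0)}
  univ_sets := by simp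
  sets_of_superset := by
    intro A B hA hAB
    refine tendsto_of_tendsto_of_tendsto_of_le_of_le tendsto_const_nhds hA (fun _ => zero_le) ?_
    exact fun n => measure_mono fun ω hω h => hω (hAB h)
  inter_sets := by
    intro A B hA hB
    have h := Tendsto.add (Set.mem_ofPred.1 hA) (Set.mem_ofPred.1 hB)
    rw [add_zero] at h
    refine tendsto_of_tendsto_of_tendsto_of_le_of_le tendsto_const_nhds h (fun _ => zero_le) ?_
    refine fun n => (measure_mono ?_).trans (measure_union_le _ _)
    intro ω hω
    by_contra hc
    simp only [Set.mem_union, Set.mem_ofPred_eq, not_or, not_not] at hc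
    exact hω hc

variable {μ : Measure Ω}

theorem eventually_probFilter {p : ℕ × Ω → Prop} :
    (∀ᶠ x in probFilter μ, p x) ↔ Tendsto (fun n => μ {ω | ¬ p (n, ω)}) atTop (𝓝 0) := Iff.rfl

theorem tendsto_fst_probFilter : Tendsto Prod.fst (probFilter μ) atTop := by
  intro A hA
  refine tendsto_const_nhds.congr' ?_
  filter_upwards [hA] with n hn
  rw [eq_comm, show {ω : Ω | (n, ω) ∉ Prod.fst ⁻¹' A} = ∅ by ext; simpa using hn]
  simp

theorem eventually_fst {p : ℕ → Prop} (h : ∀ᶠ n in atTop, p n) :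
    ∀ᶠ x in probFilter μ, p x.1 := tendsto_fst_probFilter.eventually h

/-- Turns the whole o_p calculus into filter calculus: sums, products, squeezing and finite
intersections of events of probability tending to one all come from the general theory of limits. -/
theorem tendstoInMeasure_iff_probFilter {Z : ℕ → Ω → ℝ} {c : ℝ} :
    TendstoInMeasure μ Z atTop (fun _ => c) ↔
      Tendsto (fun x : ℕ × Ω => Z x.1 x.2) (probFilter μ) (𝓝 c) := by
  rw [tendstoInMeasure_iff_dist, Metric.tendsto_nhds]
  refine forall_congr' fun ε => forall_congr' fun _ => ?_
  rw [eventually_probFilter]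
  simp only [not_lt]

/-- Markov's inequality along the filter. -/
theorem tendsto_zero_of_integral {Z : ℕ → Ω → ℝ} {c : ℕ → ℝ} (h0 : ∀ n ω, 0 ≤ Z n ω)
    (hint : ∀ᶠ n in atTop, Integrable (Z n) μ ∧ ∫ ω, Z n ω ∂μ ≤ c n)
    (hc : Tendsto c atTop (𝓝 0)) :
    Tendsto (fun x : ℕ × Ω => Z x.1 x.2) (probFilter μ) (𝓝 0) := by
  rw [Metric.tendsto_nhds]
  intro ε hε
  rw [eventually_probFilter]
  have h1 : Tendsto (fun n => ENNReal.ofReal (c n / ε)) atTop (𝓝 0) := by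
    have := ENNReal.tendsto_ofReal (hc.div_const ε)
    simpa using this
  refine tendsto_of_tendsto_of_tendsto_of_le_of_le' tendsto_const_nhds h1
    (Eventually.of_forall fun _ => zero_le) ?_
  filter_upwards [hint] with n ⟨hi, hn⟩
  simp only [dist_zero_right, not_lt, Real.norm_eq_abs, abs_of_nonneg (h0 n _)]
  have hm := mul_meas_ge_le_lintegral₀ (μ := μ) hi.1.aemeasurable.ennreal_ofReal (ENNReal.ofReal ε)
  rw [← ofReal_integral_eq_lintegral_ofReal hi (Eventually.of_forall (h0 n))] at hm
  have he : {ω | ε ≤ Z n ω} ⊆ {ω | ENNReal.ofReal ε ≤ ENNReal.ofReal (Z n ω)} :=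
    fun ω hω => ENNReal.ofReal_le_ofReal hω
  refine (measure_mono he).trans ?_
  rw [ENNReal.ofReal_div_of_pos hε, ENNReal.le_div_iff_mul_le (by simp [hε]) (by simp), mul_comm]
  exact hm.trans (ENNReal.ofReal_le_ofReal hn)

/-- A sequence that tends to zero in probability times a sequence bounded in mean tends to zero in
probability. -/
theorem tendsto_mul_of_integral_le {X Y : ℕ → Ω → ℝ} {C : ℝ}
    (hX : Tendsto (fun x : ℕ × Ω => X x.1 x.2) (probFilter μ) (𝓝 0)) (h0 : ∀ n ω, 0 ≤ Y n ω)
    (hint : ∀ᶠ n in atTop, Integrable (Y n) μ ∧ ∫ ω, Y n ω ∂μ ≤ C) :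
    Tendsto (fun x : ℕ × Ω => X x.1 x.2 * Y x.1 x.2) (probFilter μ) (𝓝 0) := by
  rw [Metric.tendsto_nhds]
  intro ε hε
  rw [eventually_probFilter, ENNReal.tendsto_nhds_zero]
  intro η hη
  -- By Markov, Y exceeds N with probability at most η/2. Where Y stays below N, the product is
  -- small as soon as |X| < ε/N.
  obtain ⟨N, hN0, hN⟩ : ∃ N : ℝ, 0 < N ∧ ENNReal.ofReal (C / N) ≤ η / 2 := by
    have h1 : Tendsto (fun N : ℝ => ENNReal.ofReal (C / N)) atTop (𝓝 0) := by
      have := ENNReal.tendsto_ofReal (tendsto_const_nhds.div_atTop (tendsto_id (α := ℝ)) (a := C))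
      simpa using this
    have h2 := (ENNReal.tendsto_nhds_zero.1 h1) (η / 2) (ENNReal.half_pos hη.ne')
    obtain ⟨N, hN1, hN2⟩ := (h2.and (eventually_gt_atTop (0 : ℝ))).exists
    exact ⟨N, hN2, hN1⟩
  have h3 := (eventually_probFilter.1
    ((Metric.tendsto_nhds.1 hX) (ε / N) (by positivity)))
  rw [ENNReal.tendsto_nhds_zero] at h3
  filter_upwards [h3 (η / 2) (ENNReal.half_pos hη.ne'), hint] with n hn ⟨hi, hC⟩
  have hm := mul_meas_ge_le_lintegral₀ (μ := μ) hi.1.aemeasurable.ennreal_ofReal (ENNReal.ofReal N)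
  rw [← ofReal_integral_eq_lintegral_ofReal hi (Eventually.of_forall (h0 n))] at hm
  have h4 : μ {ω | ENNReal.ofReal N ≤ ENNReal.ofReal (Y n ω)} ≤ η / 2 := by
    refine le_trans ?_ hN
    rw [ENNReal.ofReal_div_of_pos hN0, ENNReal.le_div_iff_mul_le (by simp [hN0]) (by simp),
      mul_comm]
    exact hm.trans (ENNReal.ofReal_le_ofReal hC)
  refine le_trans (measure_mono ?_) ((measure_union_le _ _).trans
    ((add_le_add hn h4).trans (ENNReal.add_halves η).le))
  intro ω hω
  simp only [Set.mem_union, Set.mem_ofPred_eq, dist_zero_right, not_lt] at hω ⊢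
  by_contra hc
  push Not at hc
  obtain ⟨ha, hb⟩ := hc
  have hb' : Y n ω < N := lt_of_not_ge fun h => hb.not_ge (ENNReal.ofReal_le_ofReal h)
  rw [norm_mul, Real.norm_eq_abs (Y n ω), abs_of_nonneg (h0 n ω)] at hω
  have : ‖X n ω‖ * Y n ω < ε := by
    calc ‖X n ω‖ * Y n ω ≤ ‖X n ω‖ * N := by gcongr
      _ < ε / N * N := by gcongr
      _ = ε := by field_simp
  exact absurd hω (not_le.2 this)

end ProbFilter

end NPIV

namespace NPIV

/-! ### Empirical means of an i.i.d. sample: variances and a truncated weak law. -/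

section RandomSample

variable {Ω 𝒵 : Type*} [MeasurableSpace Ω] [MeasurableSpace 𝒵] {μ : Measure Ω}
  [IsProbabilityMeasure μ] {Z : ℕ → Ω → 𝒵}

/-- The empirical mean of `g` over the first `n` observations. -/
noncomputable def empMean (Z : ℕ → Ω → 𝒵) (n : ℕ) (g : 𝒵 → ℝ) (ω : Ω) : ℝ :=
  (n : ℝ)⁻¹ * ∑ i ∈ Finset.range n, g (Z i ω)

theorem empMean_add (n : ℕ) (g h : 𝒵 → ℝ) (ω : Ω) :
    empMean Z n (fun z => g z + h z) ω = empMean Z n g ω + empMean Z n h ω := by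
  simp [empMean, Finset.sum_add_distrib, mul_add]

theorem empMean_mono (n : ℕ) {g h : 𝒵 → ℝ} (ω : Ω) (hgh : ∀ z, g z ≤ h z) :
    empMean Z n g ω ≤ empMean Z n h ω := by
  unfold empMean
  gcongr
  exact hgh _

theorem empMean_nonneg (n : ℕ) {g : 𝒵 → ℝ} (ω : Ω) (hg : ∀ z, 0 ≤ g z) :
    0 ≤ empMean Z n g ω :=
  mul_nonneg (by positivity) (Finset.sum_nonneg fun _ _ => hg _)

variable (hident : ∀ i, IdentDistrib (Z i) (Z 0) μ μ)
include hident

theorem integrable_empMean (n : ℕ) {g : 𝒵 → ℝ} (hg : Measurable g)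
    (hi : Integrable (fun ω => g (Z 0 ω)) μ) : Integrable (empMean Z n g) μ := by
  unfold empMean
  exact (integrable_finsetSum _ fun i _ => ((hident i).comp hg).integrable_iff.2 hi).const_mul _

theorem integral_empMean {n : ℕ} (hn : n ≠ 0) {g : 𝒵 → ℝ} (hg : Measurable g)
    (hi : Integrable (fun ω => g (Z 0 ω)) μ) :
    ∫ ω, empMean Z n g ω ∂μ = ∫ ω, g (Z 0 ω) ∂μ := by
  have hi' : ∀ i, Integrable (fun ω => g (Z i ω)) μ :=
    fun i => ((hident i).comp hg).integrable_iff.2 hi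
  unfold empMean
  rw [integral_const_mul, integral_finsetSum _ fun i _ => hi' i]
  have h : ∀ i, ∫ ω, g (Z i ω) ∂μ = ∫ ω, g (Z 0 ω) ∂μ :=
    fun i => ((hident i).comp hg).integral_eq
  simp only [h, Finset.sum_const, Finset.card_range, nsmul_eq_mul]
  field_simp

variable (hindep : iIndepFun Z μ)
include hindep

/-- The variance of an empirical mean. -/
theorem integral_empMean_sub_sq_le {n : ℕ} (hn : n ≠ 0) {g : 𝒵 → ℝ} (hg : Measurable g)
    (hi : MemLp (fun ω => g (Z 0 ω)) 2 μ) :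
    Integrable (fun ω => (empMean Z n g ω - ∫ ω, g (Z 0 ω) ∂μ) ^ 2) μ ∧
    ∫ ω, (empMean Z n g ω - ∫ ω, g (Z 0 ω) ∂μ) ^ 2 ∂μ ≤ (n : ℝ)⁻¹ * ∫ ω, g (Z 0 ω) ^ 2 ∂μ := by
  have hL : ∀ i, MemLp (fun ω => g (Z i ω)) 2 μ := fun i => ((hident i).comp hg).memLp_iff.2 hi
  have hS : MemLp (fun ω => ∑ i ∈ Finset.range n, g (Z i ω)) 2 μ :=
    memLp_finsetSum _ fun i _ => hL i
  have hM : MemLp (empMean Z n g) 2 μ := hS.const_mul _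
  refine ⟨(hM.sub (memLp_const _)).integrable_sq, ?_⟩
  have h1 := integral_empMean hident hn hg (hi.integrable (by norm_num))
  rw [← h1, ← variance_eq_integral hM.aemeasurable]
  unfold empMean
  rw [variance_const_mul]
  have h2 := IndepFun.variance_sum (μ := μ) (X := fun i ω => g (Z i ω)) (s := Finset.range n)
    (fun i _ => hL i) (fun i _ j _ hij => (hindep.indepFun hij).comp hg hg)
  have h3 : (fun ω => ∑ i ∈ Finset.range n, g (Z i ω))
      = ∑ i ∈ Finset.range n, fun ω => g (Z i ω) := by
    ext ω; simp
  rw [h3, h2]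
  have h4 : ∀ i, Var[fun ω => g (Z i ω); μ] = Var[fun ω => g (Z 0 ω); μ] :=
    fun i => ((hident i).comp hg).variance_eq
  simp only [h4, Finset.sum_const, Finset.card_range, nsmul_eq_mul]
  have h5 := variance_le_expectation_sq (μ := μ) hi.aestronglyMeasurable
  have h6 : (0 : ℝ) < n := by positivity
  calc ((n : ℝ)⁻¹) ^ 2 * (n * Var[fun ω => g (Z 0 ω); μ])
      = (n : ℝ)⁻¹ * Var[fun ω => g (Z 0 ω); μ] := by field_simp
    _ ≤ _ := by gcongr; exact h5

/-- The total variance of an empirical mean of vectors. -/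
theorem integral_sum_empMean_sub_sq_le {ι : Type*} [Fintype ι] {n : ℕ} (hn : n ≠ 0)
    {g : ι → 𝒵 → ℝ} (hg : ∀ k, Measurable (g k)) (hi : ∀ k, MemLp (fun ω => g k (Z 0 ω)) 2 μ)
    {C : ℝ} (hC : ∫ ω, ∑ k, g k (Z 0 ω) ^ 2 ∂μ ≤ C) :
    Integrable (fun ω => ∑ k, (empMean Z n (g k) ω - ∫ ω, g k (Z 0 ω) ∂μ) ^ 2) μ ∧
    ∫ ω, ∑ k, (empMean Z n (g k) ω - ∫ ω, g k (Z 0 ω) ∂μ) ^ 2 ∂μ ≤ (n : ℝ)⁻¹ * C := by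
  have h := fun k => integral_empMean_sub_sq_le hident hindep hn (hg k) (hi k)
  refine ⟨integrable_finsetSum _ fun k _ => (h k).1, ?_⟩
  rw [integral_finsetSum _ fun k _ => (h k).1]
  refine (Finset.sum_le_sum fun k _ => (h k).2).trans ?_
  rw [← Finset.mul_sum, ← integral_finsetSum _ fun k _ => (hi k).integrable_sq]
  gcongr

/-- A weak law of large numbers for triangular arrays, by truncation: `g n` is split into a part
with second moment `o(n)` and a part that vanishes in mean. -/
theorem tendsto_empMean_sub {g g' g'' : ℕ → 𝒵 → ℝ}
    (hgg : ∀ n z, g n z = g' n z + g'' n z) (hm' : ∀ n, Measurable (g' n))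
    (hm'' : ∀ n, Measurable (g'' n)) (h0 : ∀ n z, 0 ≤ g'' n z)
    {c c' : ℕ → ℝ}
    (hL : ∀ᶠ n in atTop, MemLp (fun ω => g' n (Z 0 ω)) 2 μ ∧
      (n : ℝ)⁻¹ * ∫ ω, g' n (Z 0 ω) ^ 2 ∂μ ≤ c n) (hc : Tendsto c atTop (𝓝 0))
    (hI : ∀ᶠ n in atTop, Integrable (fun ω => g'' n (Z 0 ω)) μ ∧ ∫ ω, g'' n (Z 0 ω) ∂μ ≤ c' n)
    (hc' : Tendsto c' atTop (𝓝 0)) :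
    Tendsto (fun x : ℕ × Ω => empMean Z x.1 (g x.1) x.2 - ∫ ω, g x.1 (Z 0 ω) ∂μ)
      (probFilter μ) (𝓝 0) := by
  have h1 : Tendsto (fun x : ℕ × Ω =>
      (empMean Z x.1 (g' x.1) x.2 - ∫ ω, g' x.1 (Z 0 ω) ∂μ) ^ 2) (probFilter μ) (𝓝 0) := by
    refine tendsto_zero_of_integral
      (Z := fun n ω => (empMean Z n (g' n) ω - ∫ ω, g' n (Z 0 ω) ∂μ) ^ 2)
      (fun n ω => sq_nonneg _) (c := c) ?_ hc
    filter_upwards [hL, eventually_ne_atTop 0] with n ⟨hn, hn'⟩ hn0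
    have := integral_empMean_sub_sq_le hident hindep hn0 (hm' n) hn
    exact ⟨this.1, this.2.trans hn'⟩
  have h1' : Tendsto (fun x : ℕ × Ω =>
      empMean Z x.1 (g' x.1) x.2 - ∫ ω, g' x.1 (Z 0 ω) ∂μ) (probFilter μ) (𝓝 0) := by
    have := h1.sqrt
    simp only [Real.sqrt_sq_eq_abs, Real.sqrt_zero] at this
    exact (tendsto_zero_iff_abs_tendsto_zero _).2 this
  have h2 : Tendsto (fun x : ℕ × Ω => empMean Z x.1 (g'' x.1) x.2) (probFilter μ) (𝓝 0) := by
    refine tendsto_zero_of_integral (Z := fun n => empMean Z n (g'' n))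
      (fun n ω => empMean_nonneg n ω (h0 n)) (c := c') ?_ hc'
    filter_upwards [hI, eventually_ne_atTop 0] with n ⟨hn, hn'⟩ hn0
    exact ⟨integrable_empMean hident n (hm'' n) hn,
      (integral_empMean hident hn0 (hm'' n) hn).trans_le hn'⟩
  have h3 : Tendsto (fun n => ∫ ω, g'' n (Z 0 ω) ∂μ) atTop (𝓝 0) :=
    tendsto_of_tendsto_of_tendsto_of_le_of_le' tendsto_const_nhds hc'
      (Eventually.of_forall fun n => integral_nonneg fun ω => h0 n _) (hI.mono fun n h => h.2)
  have h4 := (h1'.add h2).sub (h3.comp tendsto_fst_probFilter)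
  simp only [add_zero, sub_zero] at h4
  refine h4.congr' ?_
  filter_upwards [eventually_fst hL, eventually_fst hI] with x hx hx'
  have e1 : g x.1 = fun z => g' x.1 z + g'' x.1 z := funext (hgg x.1)
  simp only [Function.comp_apply]
  rw [e1, empMean_add, integral_add (hx.1.integrable (by norm_num)) hx'.1]
  ring

end RandomSample

/-! ### Lindeberg's theorem by characteristic functions. -/

section CLT

/-- The third order remainder |x|³ serves for |x| ≤ 1 and the crude bound 4x² for |x| ≥ 1. Between δ
and 1 the cubic bound is already below x². -/
theorem norm_exp_mul_I_sub_taylor_le {x δ : ℝ} (hδ : 0 < δ) (hδ1 : δ ≤ 1) :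
    ‖Complex.exp (x * Complex.I) - (1 + x * Complex.I - x ^ 2 / 2)‖
      ≤ δ * x ^ 2 + if δ < |x| then 4 * x ^ 2 else 0 := by
  have hsmall : |x| ≤ 1 →
      ‖Complex.exp (x * Complex.I) - (1 + x * Complex.I - x ^ 2 / 2)‖ ≤ |x| * x ^ 2 := by
    intro hx
    have h := Complex.exp_bound (x := x * Complex.I) (by simpa using hx) (n := 3) (by norm_num)
    have e : ∑ m ∈ Finset.range 3, ((x : ℂ) * Complex.I) ^ m / (m.factorial : ℂ)
        = 1 + x * Complex.I - x ^ 2 / 2 := by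
      simp [Finset.sum_range_succ, mul_pow, Nat.factorial]
      ring
    rw [e] at h
    refine h.trans ?_
    have : ‖(x : ℂ) * Complex.I‖ = |x| := by simp
    rw [this]
    have h2 : |x| ^ 3 = |x| * x ^ 2 := by rw [pow_succ', sq_abs]
    rw [h2]
    norm_num [Nat.factorial]
    nlinarith [mul_nonneg (abs_nonneg x) (sq_nonneg x)]
  have hbig : 1 ≤ |x| →
      ‖Complex.exp (x * Complex.I) - (1 + x * Complex.I - x ^ 2 / 2)‖ ≤ 4 * x ^ 2 := by
    intro hx
    have h1 : ‖Complex.exp (x * Complex.I)‖ = 1 := Complex.norm_exp_ofReal_mul_I x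
    have h2 : ‖(1 + x * Complex.I - x ^ 2 / 2 : ℂ)‖ ≤ 1 + |x| + x ^ 2 / 2 := by
      refine (norm_sub_le _ _).trans (add_le_add ((norm_add_le _ _).trans ?_) ?_) <;> simp
    have h3 : |x| ≤ x ^ 2 := by rw [← sq_abs]; nlinarith
    refine (norm_sub_le _ _).trans ?_
    nlinarith
  split_ifs with h
  · rcases le_total |x| 1 with h1 | h1
    · have := hsmall h1
      nlinarith [sq_nonneg x]
    · have := hbig h1
      nlinarith [sq_nonneg x]
  · rw [add_zero]
    refine (hsmall (by linarith)).trans ?_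
    gcongr
    linarith

variable {Ω 𝒵 : Type*} [MeasurableSpace Ω] [MeasurableSpace 𝒵] {μ : Measure Ω}
  [IsProbabilityMeasure μ] {Z : ℕ → Ω → 𝒵}

/-- The pointwise Taylor bound at sX is integrated. Mean zero and unit second moment make the Taylor
polynomial integrate to exactly 1 - s²/2. -/
theorem norm_charFun_sub_taylor_le {X : Ω → ℝ} (hX : MemLp X 2 μ) (h0 : ∫ ω, X ω ∂μ = 0)
    (h1 : ∫ ω, X ω ^ 2 ∂μ = 1) (s : ℝ) {δ : ℝ} (hδ : 0 < δ) (hδ1 : δ ≤ 1) :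
    ‖charFun (μ.map X) s - (1 - s ^ 2 / 2)‖ ≤
      s ^ 2 * (δ + 4 * ∫ ω, {ω | δ < |s * X ω|}.indicator (fun ω => X ω ^ 2) ω ∂μ) := by
  have hXm := hX.aemeasurable
  have hXi : Integrable X μ := hX.integrable (by norm_num)
  have hX2 : Integrable (fun ω => X ω ^ 2) μ := hX.integrable_sq
  rw [charFun_apply_real, integral_map hXm (by fun_prop)]
  have e1 : (1 - s ^ 2 / 2 : ℂ) =
      ∫ ω, (1 + ((s * X ω : ℝ) : ℂ) * Complex.I - ((s * X ω : ℝ) : ℂ) ^ 2 / 2) ∂μ := by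
    have i1 : Integrable (fun ω => ((s * X ω : ℝ) : ℂ) * Complex.I) μ :=
      ((hXi.const_mul s).ofReal).mul_const _
    have i2 : Integrable (fun ω => ((s * X ω : ℝ) : ℂ) ^ 2 / 2) μ := by
      have := ((hX2.const_mul (s ^ 2)).ofReal (𝕜 := ℂ)).div_const 2
      refine this.congr (Eventually.of_forall fun ω => ?_)
      simp [mul_pow]
    have i3 : Integrable (fun ω => 1 + ((s * X ω : ℝ) : ℂ) * Complex.I) μ :=
      (integrable_const _).add i1
    rw [integral_sub i3 i2, integral_add (integrable_const _) i1]
    have e2 : ∫ ω, ((s * X ω : ℝ) : ℂ) * Complex.I ∂μ = 0 := by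
      rw [integral_mul_const, integral_complex_ofReal, integral_const_mul, h0]
      simp
    have e3 : ∫ ω, ((s * X ω : ℝ) : ℂ) ^ 2 / 2 ∂μ = (s : ℂ) ^ 2 / 2 := by
      have : ∀ ω, ((s * X ω : ℝ) : ℂ) ^ 2 / 2 = ((s ^ 2 * X ω ^ 2 : ℝ) : ℂ) / 2 := by
        intro ω; simp [mul_pow]
      simp only [this]
      rw [integral_div, integral_complex_ofReal, integral_const_mul, h1]
      simp
    rw [e2, e3]
    simp
  have iexp : Integrable (fun ω => Complex.exp (s * X ω * Complex.I)) μ := by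
    refine (integrable_const (1 : ℝ)).mono' ?_ (Eventually.of_forall fun ω => ?_)
    · exact (Complex.measurable_exp.comp_aemeasurable (by fun_prop)).aestronglyMeasurable
    · have := Complex.norm_exp_ofReal_mul_I (s * X ω)
      push_cast at this
      exact this.le
  have ipoly : Integrable
      (fun ω => (1 + ((s * X ω : ℝ) : ℂ) * Complex.I - ((s * X ω : ℝ) : ℂ) ^ 2 / 2)) μ := by
    have i1 : Integrable (fun ω => ((s * X ω : ℝ) : ℂ) * Complex.I) μ :=
      ((hXi.const_mul s).ofReal).mul_const _
    have i2 : Integrable (fun ω => ((s * X ω : ℝ) : ℂ) ^ 2 / 2) μ := by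
      have := ((hX2.const_mul (s ^ 2)).ofReal (𝕜 := ℂ)).div_const 2
      refine this.congr (Eventually.of_forall fun ω => ?_)
      simp [mul_pow]
    exact ((integrable_const _).add i1).sub i2
  rw [e1, ← integral_sub iexp ipoly]
  have hset : NullMeasurableSet {ω | δ < |s * X ω|} μ :=
    nullMeasurableSet_lt aemeasurable_const (by fun_prop)
  have iind : Integrable ({ω | δ < |s * X ω|}.indicator (fun ω => X ω ^ 2)) μ :=
    hX2.indicator₀ hset
  have e5 : s ^ 2 * (δ + 4 * ∫ ω, {ω | δ < |s * X ω|}.indicator (fun ω => X ω ^ 2) ω ∂μ)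
      = ∫ ω, s ^ 2 * (δ * X ω ^ 2 + 4 * {ω | δ < |s * X ω|}.indicator (fun ω => X ω ^ 2) ω) ∂μ := by
    rw [integral_const_mul, integral_add (hX2.const_mul _) (iind.const_mul _),
      integral_const_mul, integral_const_mul, h1, mul_one]
  rw [e5]
  refine norm_integral_le_of_norm_le
    (((hX2.const_mul _).add (iind.const_mul _)).const_mul _) (Eventually.of_forall fun ω => ?_)
  have h := norm_exp_mul_I_sub_taylor_le (x := s * X ω) hδ hδ1
  push_cast at h ⊢
  refine h.trans (le_of_eq ?_)
  by_cases hc : δ < |s * X ω|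
  · rw [if_pos hc, Set.indicator_of_mem (by exact hc)]
    ring
  · rw [if_neg hc, Set.indicator_of_notMem (by exact hc)]
    ring

/-- **Lindeberg's central limit theorem** for triangular arrays with i.i.d. rows. -/
theorem tendsto_stdNormal_of_lindeberg (hident : ∀ i, IdentDistrib (Z i) (Z 0) μ μ)
    (hindep : iIndepFun Z μ) {g : ℕ → 𝒵 → ℝ} (hg : ∀ n, Measurable (g n))
    (hZ : ∀ i, Measurable (Z i))
    (hL : ∀ᶠ n in atTop, MemLp (fun ω => g n (Z 0 ω)) 2 μ)
    (h0 : ∀ᶠ n in atTop, ∫ ω, g n (Z 0 ω) ∂μ = 0)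
    (h1 : ∀ᶠ n in atTop, ∫ ω, g n (Z 0 ω) ^ 2 ∂μ = 1)
    (hlin : ∀ ε : ℝ, 0 < ε → Tendsto (fun n : ℕ =>
      ∫ ω, {ω | ε * Real.sqrt n < |g n (Z 0 ω)|}.indicator (fun ω => g n (Z 0 ω) ^ 2) ω ∂μ)
      atTop (𝓝 0)) :
    TendstoStdNormal μ (fun n ω => (Real.sqrt n)⁻¹ * ∑ i ∈ Finset.range n, g n (Z i ω)) where
  forall_aemeasurable n := by
    refine (Measurable.const_mul ?_ _).aemeasurable
    exact Finset.measurable_fun_sum _ fun i _ => (hg n).comp (hZ i)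
  tendsto := by
    refine ProbabilityMeasure.tendsto_iff_tendsto_charFun.2 fun t ↦ ?_
    simp only [ProbabilityMeasure.coe_mk, Measure.map_id, charFun_gaussianReal]
    have hcf : ∀ n : ℕ, charFun (μ.map (fun ω => (Real.sqrt n)⁻¹ *
        ∑ i ∈ Finset.range n, g n (Z i ω))) t =
        charFun (μ.map (fun ω => g n (Z 0 ω))) ((Real.sqrt n)⁻¹ * t) ^ n := fun n =>
      charFun_inv_sqrt_mul_sum (X := fun i ω => g n (Z i ω))
        (hindep.comp (fun _ => g n) fun _ => hg n) (fun i => (hident i).comp (hg n))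
    simp only [hcf]
    have e : Complex.exp (t * (0 : ℝ) * Complex.I - ((1 : NNReal) : ℝ) * t ^ 2 / 2)
        = Complex.exp (-(t : ℂ) ^ 2 / 2) := by
      congr 1; simp; ring
    rw [e]
    -- It remains to show that one factor, at t/√n, is 1 - t²/(2n) + o(1/n). Half of the tolerance c
    -- is met by the choice of δ, the other half by the Lindeberg condition at level δ/|t|.
    apply Complex.tendsto_pow_exp_of_isLittleO_sub_add_div
    rw [Asymptotics.isLittleO_iff]
    intro c hc
    by_cases ht : t = 0
    · subst ht
      filter_upwards with n
      have : IsProbabilityMeasure (μ.map (fun ω => g n (Z 0 ω))) :=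
        Measure.isProbabilityMeasure_map ((hg n).comp (hZ 0)).aemeasurable
      simp
      positivity
    have ht2 : 0 < t ^ 2 := by positivity
    obtain ⟨δ, hδ, hδ1, hδc⟩ : ∃ δ : ℝ, 0 < δ ∧ δ ≤ 1 ∧ t ^ 2 * δ ≤ c / 2 := by
      refine ⟨min 1 (c / 2 / t ^ 2), by positivity, min_le_left _ _, ?_⟩
      have := min_le_right 1 (c / 2 / t ^ 2)
      calc t ^ 2 * min 1 (c / 2 / t ^ 2) ≤ t ^ 2 * (c / 2 / t ^ 2) := by gcongr
        _ = c / 2 := by field_simp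
    have hl := (hlin (δ / |t|) (by positivity)).eventually
      (gt_mem_nhds (show 0 < c / 2 / (t ^ 2 * 4) by positivity))
    filter_upwards [hL, h0, h1, hl, eventually_gt_atTop 0] with n hn hn0 hn1 hnl hpos
    have hb := norm_charFun_sub_taylor_le hn hn0 hn1 ((Real.sqrt n)⁻¹ * t) hδ hδ1
    have hnp : (0 : ℝ) < n := by exact_mod_cast hpos
    have hs : 0 < Real.sqrt n := Real.sqrt_pos.2 hnp
    have hset : {ω | δ < |(Real.sqrt n)⁻¹ * t * g n (Z 0 ω)|}
        = {ω | δ / |t| * Real.sqrt n < |g n (Z 0 ω)|} := by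
      ext ω
      simp only [Set.mem_ofPred_eq]
      rw [abs_mul, abs_mul, abs_of_pos (inv_pos.2 hs), div_mul_eq_mul_div,
        div_lt_iff₀ (abs_pos.2 ht), inv_mul_eq_div, div_mul_eq_mul_div, lt_div_iff₀ hs, mul_comm |t|]
    rw [hset] at hb
    have hsq : ((Real.sqrt n)⁻¹ * t) ^ 2 = t ^ 2 / n := by
      rw [mul_pow, inv_pow, Real.sq_sqrt hnp.le]; ring
    rw [hsq] at hb
    have e2 : (1 + -(t : ℂ) ^ 2 / 2 / n) = 1 - (((Real.sqrt n)⁻¹ * t : ℝ) : ℂ) ^ 2 / 2 := by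
      rw [show (((Real.sqrt n)⁻¹ * t : ℝ) : ℂ) ^ 2 = ((t ^ 2 / n : ℝ) : ℂ) by
        rw [← hsq]; push_cast; ring]
      push_cast
      ring
    rw [e2]
    refine hb.trans ?_
    rw [norm_div, norm_one, Complex.norm_natCast]
    have : t ^ 2 * (4 * (∫ ω, {ω | δ / |t| * Real.sqrt n < |g n (Z 0 ω)|}.indicator
        (fun ω => g n (Z 0 ω) ^ 2) ω ∂μ)) ≤ c / 2 := by
      have := (lt_div_iff₀ (by positivity)).1 hnl
      nlinarith
    calc t ^ 2 / n * (δ + 4 * ∫ ω, {ω | δ / |t| * Real.sqrt n < |g n (Z 0 ω)|}.indicator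
        (fun ω => g n (Z 0 ω) ^ 2) ω ∂μ) 
        = (t ^ 2 * δ + t ^ 2 * (4 * ∫ ω, {ω | δ / |t| * Real.sqrt n < |g n (Z 0 ω)|}.indicator
        (fun ω => g n (Z 0 ω) ^ 2) ω ∂μ)) / n := by ring
      _ ≤ (c / 2 + c / 2) / n := by gcongr
      _ = c * (1 / n) := by ring

end CLT

end NPIV

namespace NPIV

/-! ### Euclidean and Frobenius norms. -/

section Euclid

variable {ι κ : Type*} [Fintype ι] [Fintype κ]

/-- The Euclidean norm of a vector of reals. -/
noncomputable def vnorm (v : ι → ℝ) : ℝ := ‖WithLp.toLp 2 v‖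

theorem vnorm_nonneg (v : ι → ℝ) : 0 ≤ vnorm v := norm_nonneg _

theorem vnorm_sq (v : ι → ℝ) : vnorm v ^ 2 = v ⬝ᵥ v := by
  unfold vnorm
  rw [EuclideanSpace.norm_sq_eq]
  simp [dotProduct, pow_two]

theorem vnorm_sq' (v : ι → ℝ) : vnorm v ^ 2 = ∑ i, v i ^ 2 := by
  rw [vnorm_sq]; simp [dotProduct, pow_two]

theorem abs_dotProduct_le (v w : ι → ℝ) : |v ⬝ᵥ w| ≤ vnorm v * vnorm w := by
  have h := abs_real_inner_le_norm (WithLp.toLp 2 w) (WithLp.toLp 2 v)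
  simp only [EuclideanSpace.inner_eq_star_dotProduct, star_trivial] at h
  rw [mul_comm]
  exact h

theorem dotProduct_le (v w : ι → ℝ) : v ⬝ᵥ w ≤ vnorm v * vnorm w :=
  (le_abs_self _).trans (abs_dotProduct_le v w)

theorem vnorm_add_le (v w : ι → ℝ) : vnorm (v + w) ≤ vnorm v + vnorm w := by
  unfold vnorm
  rw [WithLp.toLp_add]
  exact norm_add_le _ _

theorem vnorm_sub_le (v w : ι → ℝ) : vnorm (v - w) ≤ vnorm v + vnorm w := by
  unfold vnorm
  rw [WithLp.toLp_sub]
  exact norm_sub_le _ _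

theorem vnorm_smul (c : ℝ) (v : ι → ℝ) : vnorm (c • v) = |c| * vnorm v := by
  unfold vnorm
  rw [WithLp.toLp_smul, norm_smul, Real.norm_eq_abs]

theorem vnorm_eq_zero {v : ι → ℝ} : vnorm v = 0 ↔ v = 0 := by
  unfold vnorm; simp

theorem vnorm_eq_sqrt (v : ι → ℝ) : vnorm v = Real.sqrt (v ⬝ᵥ v) := by
  rw [← vnorm_sq, Real.sqrt_sq (vnorm_nonneg v)]

/-- The Frobenius norm. -/
noncomputable def frob (A : Matrix ι κ ℝ) : ℝ := Real.sqrt (∑ i, ∑ j, A i j ^ 2)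

theorem frob_sq (A : Matrix ι κ ℝ) : frob A ^ 2 = ∑ i, ∑ j, A i j ^ 2 :=
  Real.sq_sqrt (Finset.sum_nonneg fun _ _ => Finset.sum_nonneg fun _ _ => sq_nonneg _)

theorem frob_nonneg (A : Matrix ι κ ℝ) : 0 ≤ frob A := Real.sqrt_nonneg _

theorem frob_transpose (A : Matrix ι κ ℝ) : frob Aᵀ = frob A := by
  unfold frob
  rw [Finset.sum_comm]
  rfl

/-- Cauchy–Schwarz in each row. The Frobenius norm stands in for the operator norm throughout
because its second moment can be computed entrywise. -/
theorem vnorm_mulVec_le (A : Matrix ι κ ℝ) (v : κ → ℝ) : vnorm (A *ᵥ v) ≤ frob A * vnorm v := by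
  refine abs_le_of_sq_le_sq' ?_ (mul_nonneg (frob_nonneg _) (vnorm_nonneg _)) |>.2
  rw [mul_pow, frob_sq, vnorm_sq', vnorm_sq', Finset.sum_mul]
  refine Finset.sum_le_sum fun i _ => ?_
  exact Finset.sum_mul_sq_le_sq_mul_sq _ _ _

theorem dotProduct_mulVec_transpose (A : Matrix ι κ ℝ) (v : ι → ℝ) (w : κ → ℝ) :
    v ⬝ᵥ (A *ᵥ w) = (Aᵀ *ᵥ v) ⬝ᵥ w := by
  rw [Matrix.dotProduct_mulVec, Matrix.mulVec_transpose]

end Euclid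

/-! ### The two-stage coefficient vector and its perturbation theory. -/

section TwoStage

variable {J K : ℕ}

/-- The coefficient vector `a = G⁻¹ S [S' G⁻¹ S]⁻¹ D`, for which the sandwich form is `a' Ω a`. -/
noncomputable def avec (D : Fin J → ℝ) (S : Matrix (Fin K) (Fin J) ℝ)
    (G : Matrix (Fin K) (Fin K) ℝ) : Fin K → ℝ :=
  G⁻¹ *ᵥ (S *ᵥ ((Sᵀ * G⁻¹ * S)⁻¹ *ᵥ D))

/-- Symmetry of G makes the factors to the left of Ω the transpose of those to its right, which
exhibits the sandwich as a quadratic form in Ω. -/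
theorem sandwich_eq (D : Fin J → ℝ) (S : Matrix (Fin K) (Fin J) ℝ)
    {G : Matrix (Fin K) (Fin K) ℝ} (hG : Gᵀ = G) (Om : Matrix (Fin K) (Fin K) ℝ) :
    sandwich D S G Om = avec D S G ⬝ᵥ (Om *ᵥ avec D S G) := by
  have hGi : (G⁻¹)ᵀ = G⁻¹ := by rw [Matrix.transpose_nonsing_inv, hG]
  have hM : ((Sᵀ * G⁻¹ * S)⁻¹)ᵀ = (Sᵀ * G⁻¹ * S)⁻¹ := by
    rw [Matrix.transpose_nonsing_inv]
    simp only [Matrix.transpose_mul, Matrix.transpose_transpose, hGi, Matrix.mul_assoc]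
  unfold sandwich avec
  set P := (Sᵀ * G⁻¹ * S)⁻¹
  have h1 : G⁻¹ *ᵥ (S *ᵥ (P *ᵥ D)) = (P * Sᵀ * G⁻¹)ᵀ *ᵥ D := by
    simp only [Matrix.transpose_mul, Matrix.transpose_transpose, hGi, hM, Matrix.mulVec_mulVec]
  rw [h1, ← dotProduct_mulVec_transpose]
  congr 1
  simp only [Matrix.transpose_mul, Matrix.transpose_transpose, hGi, hM, Matrix.mulVec_mulVec,
    Matrix.mul_assoc]

/-- The inner factors U cancel against those of (UGU)⁻¹, while V survives outside. Only U has to be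
invertible. -/
theorem quad_whiten (S : Matrix (Fin K) (Fin J) ℝ) (G : Matrix (Fin K) (Fin K) ℝ)
    {U : Matrix (Fin K) (Fin K) ℝ} {V : Matrix (Fin J) (Fin J) ℝ} (hU : IsUnit U.det)
    (hUt : Uᵀ = U) (hVt : Vᵀ = V) :
    (U * S * V)ᵀ * (U * G * U)⁻¹ * (U * S * V) = V * (Sᵀ * G⁻¹ * S) * V := by
  have h0 : (U * G * U)⁻¹ = U⁻¹ * G⁻¹ * U⁻¹ := by
    rw [Matrix.mul_inv_rev, Matrix.mul_inv_rev, Matrix.mul_assoc]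
  rw [h0, Matrix.transpose_mul, Matrix.transpose_mul, hUt, hVt]
  calc V * (Sᵀ * U) * (U⁻¹ * G⁻¹ * U⁻¹) * (U * S * V)
      = V * Sᵀ * (U * U⁻¹) * G⁻¹ * (U⁻¹ * U) * S * V := by simp only [Matrix.mul_assoc]
    _ = _ := by
      rw [Matrix.mul_nonsing_inv _ hU, Matrix.nonsing_inv_mul _ hU]
      simp only [Matrix.mul_assoc, Matrix.mul_one]

/-- Equivariance of `avec` under changes of bases. -/
theorem avec_whiten (D : Fin J → ℝ) (S : Matrix (Fin K) (Fin J) ℝ) (G : Matrix (Fin K) (Fin K) ℝ)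
    {U : Matrix (Fin K) (Fin K) ℝ} {V : Matrix (Fin J) (Fin J) ℝ} (hU : IsUnit U.det)
    (hV : IsUnit V.det) (hUt : Uᵀ = U) (hVt : Vᵀ = V) :
    avec D S G = U *ᵥ avec (V *ᵥ D) (U * S * V) (U * G * U) := by
  unfold avec
  -- The matrix inverse reverses products even when G is singular, so equivariance holds for every
  -- sample, including those with singular moment matrices.
  have h0 : (U * G * U)⁻¹ = U⁻¹ * G⁻¹ * U⁻¹ := by
    rw [Matrix.mul_inv_rev, Matrix.mul_inv_rev, Matrix.mul_assoc]
  have h1 := quad_whiten S G hU hUt hVt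
  rw [h1, h0, Matrix.mul_inv_rev, Matrix.mul_inv_rev]
  simp only [Matrix.mulVec_mulVec]
  congr 1
  set P := (Sᵀ * G⁻¹ * S)⁻¹
  symm
  calc U * (U⁻¹ * G⁻¹ * U⁻¹ * (U * S * V * (V⁻¹ * (P * V⁻¹) * V)))
      = (U * U⁻¹) * G⁻¹ * (U⁻¹ * U) * S * (V * V⁻¹) * P * (V⁻¹ * V) := by
        simp only [Matrix.mul_assoc]
    _ = _ := by
        rw [Matrix.mul_nonsing_inv _ hU, Matrix.nonsing_inv_mul _ hU, Matrix.mul_nonsing_inv _ hV,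
          Matrix.nonsing_inv_mul _ hV]
        simp only [Matrix.mul_assoc, Matrix.mul_one, Matrix.one_mul]

/-- A matrix bounded below on vectors is invertible. -/
theorem isUnit_det_of_vnorm_le {m : ℕ} {A : Matrix (Fin m) (Fin m) ℝ} {c : ℝ} (hc : 0 < c)
    (h : ∀ v, c * vnorm v ^ 2 ≤ v ⬝ᵥ (A *ᵥ v)) : IsUnit A.det := by
  rw [← Matrix.isUnit_iff_isUnit_det, ← Matrix.mulVec_injective_iff_isUnit]
  rw [← Matrix.coe_mulVecLin, ← LinearMap.ker_eq_bot, LinearMap.ker_eq_bot']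
  intro v hv
  have h1 := h v
  rw [Matrix.mulVecLin_apply] at hv
  rw [hv, dotProduct_zero] at h1
  have : vnorm v ^ 2 ≤ 0 := by nlinarith
  exact vnorm_eq_zero.1 (pow_eq_zero_iff (by norm_num) |>.1 (le_antisymm this (sq_nonneg _)))

section NearIdentity

variable {G : Matrix (Fin K) (Fin K) ℝ} (hG : frob (G - 1) ≤ 1 / 2)
include hG

theorem vnorm_mulVec_sub_le_half (v : Fin K → ℝ) : vnorm (G *ᵥ v - v) ≤ 1 / 2 * vnorm v := by
  have h := vnorm_mulVec_le (G - 1) v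
  rw [Matrix.sub_mulVec, Matrix.one_mulVec] at h
  exact h.trans (by gcongr; exact vnorm_nonneg v)

theorem half_vnorm_sq_le (v : Fin K → ℝ) : 1 / 2 * vnorm v ^ 2 ≤ v ⬝ᵥ (G *ᵥ v) := by
  have h1 := abs_dotProduct_le v (G *ᵥ v - v)
  have h2 := vnorm_mulVec_sub_le_half hG v
  rw [dotProduct_sub, ← vnorm_sq] at h1
  have h3 := (abs_le.1 h1).1
  nlinarith [vnorm_nonneg v]

theorem isUnit_det_of_frob_le : IsUnit G.det :=
  isUnit_det_of_vnorm_le (by norm_num) (half_vnorm_sq_le hG)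

theorem vnorm_inv_mulVec_le (v : Fin K → ℝ) : vnorm (G⁻¹ *ᵥ v) ≤ 2 * vnorm v := by
  have h2 := vnorm_mulVec_sub_le_half hG (G⁻¹ *ᵥ v)
  rw [Matrix.mulVec_mulVec, Matrix.mul_nonsing_inv _ (isUnit_det_of_frob_le hG),
    Matrix.one_mulVec] at h2
  have h3 := vnorm_sub_le v (v - G⁻¹ *ᵥ v)
  rw [sub_sub_cancel] at h3
  linarith

/-- With w = G⁻¹v one has v·w ≥ |w|²/2 and |v| ≤ (3/2)|w|, whence the constant (1/2)(4/9) = 2/9. -/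
theorem vnorm_sq_le_inv (v : Fin K → ℝ) : 2 / 9 * vnorm v ^ 2 ≤ v ⬝ᵥ (G⁻¹ *ᵥ v) := by
  have h0 : G *ᵥ (G⁻¹ *ᵥ v) = v := by
    rw [Matrix.mulVec_mulVec, Matrix.mul_nonsing_inv _ (isUnit_det_of_frob_le hG),
      Matrix.one_mulVec]
  have h1 := half_vnorm_sq_le hG (G⁻¹ *ᵥ v)
  have h2 := vnorm_mulVec_sub_le_half hG (G⁻¹ *ᵥ v)
  rw [h0] at h1 h2
  rw [dotProduct_comm] at h1
  have h3 := vnorm_add_le (v - G⁻¹ *ᵥ v) (G⁻¹ *ᵥ v)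
  rw [sub_add_cancel] at h3
  have h4 : vnorm v ≤ 3 / 2 * vnorm (G⁻¹ *ᵥ v) := by linarith
  have h5 := vnorm_nonneg v
  nlinarith

end NearIdentity

section Perturbation

variable {S S' : Matrix (Fin K) (Fin J) ℝ} {G : Matrix (Fin K) (Fin K) ℝ} {s : ℝ}
  (hG : frob (G - 1) ≤ 1 / 2) (hs : 0 < s) (hS : ∀ q, s * vnorm q ≤ vnorm (S *ᵥ q))
  (hSS : frob (S' - S) ≤ s / 2)

include hs hS hSS in
theorem half_mul_vnorm_le (q : Fin J → ℝ) : s / 2 * vnorm q ≤ vnorm (S' *ᵥ q) := by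
  have h := vnorm_mulVec_le (S' - S) q
  rw [Matrix.sub_mulVec] at h
  have h1 := vnorm_sub_le (S' *ᵥ q) (S' *ᵥ q - S *ᵥ q)
  rw [sub_sub_cancel] at h1
  have h2 := hS q
  have h3 : frob (S' - S) * vnorm q ≤ s / 2 * vnorm q := by gcongr; exact vnorm_nonneg q
  linarith

include hG in
theorem quad_form_ge (q : Fin J → ℝ) :
    2 / 9 * vnorm (S' *ᵥ q) ^ 2 ≤ q ⬝ᵥ ((S'ᵀ * G⁻¹ * S') *ᵥ q) := by
  have h := vnorm_sq_le_inv hG (S' *ᵥ q)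
  rw [← Matrix.mulVec_mulVec, ← Matrix.mulVec_mulVec, dotProduct_mulVec_transpose,
    Matrix.transpose_transpose]
  exact h

include hG hs hS hSS in
-- A perturbation of at most s/2 leaves S' bounded below by s/2, and G⁻¹ is coercive, so the
-- quadratic form of S'ᵀG⁻¹S' is coercive.
theorem isUnit_det_quad : IsUnit (S'ᵀ * G⁻¹ * S').det := by
  refine isUnit_det_of_vnorm_le (c := 2 / 9 * (s / 2) ^ 2) (by positivity) fun q => ?_
  refine le_trans ?_ (quad_form_ge hG q)
  have h := half_mul_vnorm_le hs hS hSS q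
  have h2 : (s / 2 * vnorm q) ^ 2 ≤ vnorm (S' *ᵥ q) ^ 2 :=
    pow_le_pow_left₀ (mul_nonneg (by positivity) (vnorm_nonneg q)) h 2
  nlinarith

include hG hs hS hSS in
/-- Perturbation of `avec` around `S`, `G = 1`. -/
theorem vnorm_avec_sub_le (q : Fin J → ℝ) :
    vnorm (avec (Sᵀ *ᵥ (S *ᵥ q)) S' G - S *ᵥ q) ≤
      18 / s * vnorm ((S' - S)ᵀ *ᵥ (S *ᵥ q)) + 20 * vnorm (G *ᵥ (S *ᵥ q) - S' *ᵥ q) := by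
  have hGu := isUnit_det_of_frob_le hG
  have hPu := isUnit_det_quad hG hs hS hSS
  set a := S *ᵥ q with ha
  set ξ := G *ᵥ a - S' *ᵥ q with hξ
  set η := (S' - S)ᵀ *ᵥ a with hη
  set P := S'ᵀ * G⁻¹ * S' with hP
  set y := P⁻¹ *ᵥ (Sᵀ *ᵥ a) with hy
  have hPy : P *ᵥ y = Sᵀ *ᵥ a := by
    rw [hy, Matrix.mulVec_mulVec, Matrix.mul_nonsing_inv _ hPu, Matrix.one_mulVec]
  have hGξ : G⁻¹ *ᵥ ξ = a - G⁻¹ *ᵥ (S' *ᵥ q) := by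
    rw [hξ, Matrix.mulVec_sub, Matrix.mulVec_mulVec a, Matrix.nonsing_inv_mul _ hGu,
      Matrix.one_mulVec]
  -- Without perturbation y would equal q. Both data errors enter linearly: ξ is the residual of the
  -- first stage equation, η the error in the right-hand side. Testing with y - q and using
  -- coercivity bounds x = |S'(y - q)|.
  have hPw : P *ᵥ (y - q) = S'ᵀ *ᵥ (G⁻¹ *ᵥ ξ) - η := by
    rw [Matrix.mulVec_sub, hPy, hGξ, hη, Matrix.transpose_sub, Matrix.sub_mulVec,
      Matrix.mulVec_sub, hP, ← Matrix.mulVec_mulVec, ← Matrix.mulVec_mulVec]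
    abel
  set x := vnorm (S' *ᵥ (y - q)) with hx
  have hx0 : 0 ≤ x := vnorm_nonneg _
  have h1 := quad_form_ge (S' := S') hG (y - q)
  rw [← hP, hPw, dotProduct_sub, dotProduct_mulVec_transpose, Matrix.transpose_transpose] at h1
  have h2 := dotProduct_le (S' *ᵥ (y - q)) (G⁻¹ *ᵥ ξ)
  have h3 := vnorm_inv_mulVec_le hG ξ
  have h4 := (abs_le.1 (abs_dotProduct_le (y - q) η)).1
  have h5 := half_mul_vnorm_le hs hS hSS (y - q)
  have h6 : vnorm (y - q) ≤ 2 / s * x := by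
    rw [div_mul_eq_mul_div, le_div_iff₀ hs]
    linarith
  have h7 : 2 / 9 * x ^ 2 ≤ x * (2 * vnorm ξ + 2 / s * vnorm η) := by
    have h8 : vnorm (y - q) * vnorm η ≤ 2 / s * x * vnorm η := by
      gcongr; exact vnorm_nonneg η
    have h9 : x * vnorm (G⁻¹ *ᵥ ξ) ≤ x * (2 * vnorm ξ) := by gcongr
    nlinarith
  have h10 : x ≤ 9 * vnorm ξ + 9 / s * vnorm η := by
    rcases hx0.eq_or_lt with h | h
    · rw [← h]
      have := vnorm_nonneg ξ
      have := vnorm_nonneg η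
      positivity
    · have : 2 / 9 * x ≤ 2 * vnorm ξ + 2 / s * vnorm η := by
        refine le_of_mul_le_mul_left ?_ h
        nlinarith
      have e : 9 / s * vnorm η = 9 / 2 * (2 / s * vnorm η) := by ring
      linarith
  -- Since |G⁻¹v| ≤ 2|v|, the error is at most 2(x + |ξ|), which with the bound on x gives the
  -- constants 18/s and 20.
  have e : avec (Sᵀ *ᵥ a) S' G - a = G⁻¹ *ᵥ (S' *ᵥ (y - q) - ξ) := by
    rw [Matrix.mulVec_sub (G⁻¹), hGξ, Matrix.mulVec_sub, Matrix.mulVec_sub]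
    unfold avec
    rw [← hP, ← hy]
    abel
  rw [e]
  refine (vnorm_inv_mulVec_le hG _).trans ?_
  have h11 := vnorm_sub_le (S' *ᵥ (y - q)) ξ
  have e2 : 18 / s * vnorm η = 2 * (9 / s * vnorm η) := by ring
  rw [e2]
  linarith

end Perturbation

end TwoStage

/-! ### Pseudo-inverses and inverse square roots of matrices. -/

section PseudoInverse

/-- The identity A A⁻ A = A alone determines A⁻ once A is invertible. -/
theorem pinv_eq_inv {m : ℕ} {A : Matrix (Fin m) (Fin m) ℝ} (hA : A.IsHermitian)
    (hu : IsUnit A.det) : pinv A = A⁻¹ := by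
  have h := pinv_mul_self_mul hA
  calc pinv A = A⁻¹ * (A * pinv A * A) * A⁻¹ := by
        have e : A⁻¹ * (A * pinv A * A) * A⁻¹ = (A⁻¹ * A) * pinv A * (A * A⁻¹) := by
          simp only [Matrix.mul_assoc]
        rw [e, Matrix.nonsing_inv_mul _ hu, Matrix.mul_nonsing_inv _ hu, Matrix.one_mul,
          Matrix.mul_one]
    _ = A⁻¹ := by rw [h, Matrix.nonsing_inv_mul _ hu, Matrix.one_mul]

theorem invSqrt_transpose {m : ℕ} (A : Matrix (Fin m) (Fin m) ℝ) : (invSqrt A)ᵀ = invSqrt A := by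
  have h : IsSelfAdjoint (invSqrt A) := IsSelfAdjoint.cfc
  exact h

theorem isUnit_det_invSqrt {m : ℕ} {A : Matrix (Fin m) (Fin m) ℝ} (hA : A.PosDef) :
    IsUnit (invSqrt A).det := by
  have h := congrArg Matrix.det (invSqrt_mul_self_mul hA)
  rw [Matrix.mul_assoc, Matrix.det_mul, Matrix.det_one] at h
  exact IsUnit.of_mul_eq_one _ h

theorem invSqrt_mul_mul_invSqrt {m : ℕ} {A : Matrix (Fin m) (Fin m) ℝ} (hA : A.PosDef) :
    invSqrt A * A * invSqrt A = 1 := by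
  have h := invSqrt_mul_self_mul hA
  rw [Matrix.mul_assoc] at h
  exact mul_eq_one_comm.1 h

end PseudoInverse

end NPIV

namespace NPIV

/-! ### Traces of matrix powers under rank one updates. -/

section RankOne

variable {m : ℕ} {A : Matrix (Fin m) (Fin m) ℝ}

/-- Spectral form of the moments `x' A^k x` and of the traces `tr A^k`. -/
theorem exists_spectral_weights (hA : A.IsHermitian) :
    (∀ x : Fin m → ℝ, ∃ w : Fin m → ℝ, x ⬝ᵥ x = ∑ i, w i ^ 2 ∧
      ∀ k : ℕ, x ⬝ᵥ (A ^ k *ᵥ x) = ∑ i, hA.eigenvalues i ^ k * w i ^ 2) ∧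
    ∀ k : ℕ, (A ^ k).trace = ∑ i, hA.eigenvalues i ^ k := by
  set U : Matrix (Fin m) (Fin m) ℝ := hA.eigenvectorUnitary.1 with hU
  have hUU : Uᵀ * U = 1 := by
    have := Unitary.coe_star_mul_self hA.eigenvectorUnitary
    rwa [Matrix.star_eq_conjTranspose, Matrix.conjTranspose_eq_transpose_of_trivial] at this
  have hUU' : U * Uᵀ = 1 := mul_eq_one_comm.1 hUU
  have hspec : A = U * Matrix.diagonal hA.eigenvalues * Uᵀ := by
    have h := hA.spectral_theorem
    rw [Unitary.conjStarAlgAut_apply, Matrix.star_eq_conjTranspose,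
      Matrix.conjTranspose_eq_transpose_of_trivial] at h
    exact h
  have hpow : ∀ k : ℕ, A ^ k = U * Matrix.diagonal (fun i => hA.eigenvalues i ^ k) * Uᵀ := by
    intro k
    induction k with
    | zero => simp [hUU']
    | succ k ih =>
      rw [pow_succ, ih]
      nth_rewrite 2 [hspec]
      calc U * Matrix.diagonal (fun i => hA.eigenvalues i ^ k) * Uᵀ *
            (U * Matrix.diagonal hA.eigenvalues * Uᵀ)
          = U * Matrix.diagonal (fun i => hA.eigenvalues i ^ k) * (Uᵀ * U) *
            Matrix.diagonal hA.eigenvalues * Uᵀ := by simp only [Matrix.mul_assoc]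
        _ = _ := by
          rw [hUU, Matrix.mul_one, Matrix.mul_assoc U, Matrix.diagonal_mul_diagonal]
          simp only [pow_succ]
  refine ⟨fun x => ⟨Uᵀ *ᵥ x, ?_, fun k => ?_⟩, fun k => ?_⟩
  · have : x ⬝ᵥ x = x ⬝ᵥ ((U * Uᵀ) *ᵥ x) := by rw [hUU', Matrix.one_mulVec]
    rw [this, ← Matrix.mulVec_mulVec, dotProduct_mulVec_transpose]
    simp [dotProduct, pow_two]
  · rw [hpow, ← Matrix.mulVec_mulVec, ← Matrix.mulVec_mulVec, dotProduct_mulVec_transpose]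
    simp only [dotProduct, Matrix.mulVec_diagonal]
    exact Finset.sum_congr rfl fun i _ => by ring
  · rw [hpow, Matrix.trace_mul_comm, ← Matrix.mul_assoc, hUU, Matrix.one_mul,
      Matrix.trace_diagonal]

variable (hA : A.IsHermitian) (h1 : ∀ i, 1 ≤ hA.eigenvalues i)
include h1

/-- In the eigenbasis these are moments of a finite measure on [1, ∞). The first claim is
Chebyshev's association inequality: t^k and t^l increase together, so they are positively
correlated. The third uses that the eigenvalues are at least 1. -/
theorem one_le_moments (x : Fin m → ℝ) :
    (∀ k l : ℕ, (x ⬝ᵥ (A ^ k *ᵥ x)) * (x ⬝ᵥ (A ^ l *ᵥ x)) ≤ (x ⬝ᵥ x) * (x ⬝ᵥ (A ^ (k + l) *ᵥ x))) ∧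
    (∀ k, 0 ≤ x ⬝ᵥ (A ^ k *ᵥ x)) ∧
    ∀ k, x ⬝ᵥ (A ^ k *ᵥ x) ≤ x ⬝ᵥ (A ^ (k + 1) *ᵥ x) := by
  obtain ⟨w, hw0, hw⟩ := (exists_spectral_weights hA).1 x
  set e := hA.eigenvalues
  have he0 : ∀ i, 0 ≤ e i := fun i => zero_le_one.trans (h1 i)
  simp only [hw, hw0]
  refine ⟨fun k l => ?_, fun k => ?_, fun k => ?_⟩
  · have key : 0 ≤ ∑ i, ∑ j, w i ^ 2 * w j ^ 2 * ((e i ^ k - e j ^ k) * (e i ^ l - e j ^ l)) := by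
      refine Finset.sum_nonneg fun i _ => Finset.sum_nonneg fun j _ => mul_nonneg (by positivity) ?_
      rcases le_total (e i) (e j) with h | h
      · exact mul_nonneg_of_nonpos_of_nonpos
          (sub_nonpos.2 (pow_le_pow_left₀ (he0 i) h k)) (sub_nonpos.2 (pow_le_pow_left₀ (he0 i) h l))
      · exact mul_nonneg
          (sub_nonneg.2 (pow_le_pow_left₀ (he0 j) h k)) (sub_nonneg.2 (pow_le_pow_left₀ (he0 j) h l))
    have exp : ∑ i, ∑ j, w i ^ 2 * w j ^ 2 * ((e i ^ k - e j ^ k) * (e i ^ l - e j ^ l))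
        = 2 * ((∑ i, w i ^ 2) * ∑ i, e i ^ (k + l) * w i ^ 2)
          - 2 * ((∑ i, e i ^ k * w i ^ 2) * ∑ i, e i ^ l * w i ^ 2) := by
      have c1 : (∑ i, w i ^ 2) * ∑ i, e i ^ (k + l) * w i ^ 2
          = ∑ i, ∑ j, w i ^ 2 * (e j ^ (k + l) * w j ^ 2) := Finset.sum_mul_sum _ _ _ _
      have c2 : (∑ i, w i ^ 2) * ∑ i, e i ^ (k + l) * w i ^ 2
          = ∑ i, ∑ j, w j ^ 2 * (e i ^ (k + l) * w i ^ 2) := by rw [c1, Finset.sum_comm]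
      have c3 : (∑ i, e i ^ k * w i ^ 2) * ∑ i, e i ^ l * w i ^ 2
          = ∑ i, ∑ j, e i ^ k * w i ^ 2 * (e j ^ l * w j ^ 2) := Finset.sum_mul_sum _ _ _ _
      have c4 : (∑ i, e i ^ k * w i ^ 2) * ∑ i, e i ^ l * w i ^ 2
          = ∑ i, ∑ j, e j ^ k * w j ^ 2 * (e i ^ l * w i ^ 2) := by rw [c3, Finset.sum_comm]
      have c5 : ∀ X Y : ℝ, 2 * X - 2 * Y = X + X - (Y + Y) := fun X Y => by ring
      rw [c5]
      nth_rewrite 1 [c1]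
      nth_rewrite 1 [c2]
      nth_rewrite 1 [c3]
      nth_rewrite 1 [c4]
      rw [← Finset.sum_add_distrib, ← Finset.sum_add_distrib, ← Finset.sum_sub_distrib]
      refine Finset.sum_congr rfl fun i _ => ?_
      rw [← Finset.sum_add_distrib, ← Finset.sum_add_distrib, ← Finset.sum_sub_distrib]
      refine Finset.sum_congr rfl fun j _ => ?_
      rw [pow_add, pow_add]
      ring
    linarith
  · exact Finset.sum_nonneg fun i _ => mul_nonneg (pow_nonneg (he0 i) k) (sq_nonneg _)
  · refine Finset.sum_le_sum fun i _ => ?_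
    have : e i ^ k ≤ e i ^ (k + 1) := pow_le_pow_right₀ (h1 i) (Nat.le_succ k)
    gcongr

variable {x : Fin m → ℝ} {R : ℝ} (hx : x ⬝ᵥ x ≤ R)
include hx

/-- One factor A + xx' is expanded at a time. The summand A raises the exponent k. The summand xx'
splits the form into a product of two moments, which the association inequality merges again at the
price of a factor x·x ≤ R. Each factor thus costs 1 + R. -/
theorem moment_rank_one_update_le (k l : ℕ) :
    x ⬝ᵥ ((A ^ k * (A + Matrix.vecMulVec x x) ^ l) *ᵥ x)
      ≤ (1 + R) ^ l * (x ⬝ᵥ (A ^ (k + l) *ᵥ x)) := by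
  obtain ⟨hm1, hm2, hm3⟩ := one_le_moments hA h1 x
  have hxx : 0 ≤ x ⬝ᵥ x := by rw [← vnorm_sq]; positivity
  have hR : 0 ≤ R := hxx.trans hx
  induction l generalizing k with
  | zero => simp
  | succ l ih =>
    have e : A ^ k * (A + Matrix.vecMulVec x x) ^ (l + 1)
        = A ^ (k + 1) * (A + Matrix.vecMulVec x x) ^ l
          + A ^ k * Matrix.vecMulVec x x * (A + Matrix.vecMulVec x x) ^ l := by
      rw [pow_succ' (A + Matrix.vecMulVec x x), Matrix.add_mul, Matrix.mul_add, pow_succ,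
        Matrix.mul_assoc, Matrix.mul_assoc]
    have e2 : x ⬝ᵥ ((A ^ k * Matrix.vecMulVec x x * (A + Matrix.vecMulVec x x) ^ l) *ᵥ x)
        = (x ⬝ᵥ (A ^ k *ᵥ x)) * (x ⬝ᵥ ((A + Matrix.vecMulVec x x) ^ l *ᵥ x)) := by
      rw [← Matrix.mulVec_mulVec, ← Matrix.mulVec_mulVec, Matrix.vecMulVec_mulVec,
        Matrix.mulVec_smul, dotProduct_smul]
      simp
    rw [e, Matrix.add_mulVec, dotProduct_add, e2]
    have i1 := ih (k + 1)
    have i2 := ih 0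
    rw [pow_zero, Matrix.one_mul, zero_add] at i2
    have i3 := mul_le_mul_of_nonneg_left i2 (hm2 k)
    have i4 := hm1 k l
    have i5 := hm3 (k + l)
    have i6 : (x ⬝ᵥ x) * (x ⬝ᵥ (A ^ (k + l) *ᵥ x)) ≤ R * (x ⬝ᵥ (A ^ (k + l + 1) *ᵥ x)) :=
      mul_le_mul hx i5 (hm2 _) hR
    have hp : 0 ≤ (1 + R) ^ l := by positivity
    have i7 : (1 + R) ^ l * ((x ⬝ᵥ (A ^ k *ᵥ x)) * (x ⬝ᵥ (A ^ l *ᵥ x)))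
        ≤ (1 + R) ^ l * (R * (x ⬝ᵥ (A ^ (k + l + 1) *ᵥ x))) := by
      exact mul_le_mul_of_nonneg_left (i4.trans i6) hp
    rw [show k + 1 + l = k + l + 1 by ring] at i1
    rw [show k + (l + 1) = k + l + 1 by ring, pow_succ (1 + R) l]
    nlinarith

/-- The effect of a rank one update on the traces of powers. -/
theorem trace_rank_one_update_le (p : ℕ) :
    ((A + Matrix.vecMulVec x x) ^ p).trace
      ≤ (A ^ p).trace + p * (1 + R) ^ p * (x ⬝ᵥ (A ^ p *ᵥ x)) := by
  obtain ⟨hm1, hm2, hm3⟩ := one_le_moments hA h1 x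
  have hxx : 0 ≤ x ⬝ᵥ x := by rw [← vnorm_sq]; positivity
  have hR : 0 ≤ R := hxx.trans hx
  -- The prefix A^k is what makes the induction close: each expansion trades one perturbed factor
  -- for a factor A, and cyclicity of the trace turns the xx' term into the quadratic form just
  -- bounded.
  have key : ∀ l k : ℕ, (A ^ k * (A + Matrix.vecMulVec x x) ^ l).trace
      ≤ (A ^ (k + l)).trace + l * (1 + R) ^ l * (x ⬝ᵥ (A ^ (k + l) *ᵥ x)) := by
    intro l
    induction l with
    | zero => simp
    | succ l ih =>
      intro k
      have e : A ^ k * (A + Matrix.vecMulVec x x) ^ (l + 1)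
          = A ^ (k + 1) * (A + Matrix.vecMulVec x x) ^ l
            + A ^ k * Matrix.vecMulVec x x * (A + Matrix.vecMulVec x x) ^ l := by
        rw [pow_succ' (A + Matrix.vecMulVec x x), Matrix.add_mul, Matrix.mul_add, pow_succ,
          Matrix.mul_assoc, Matrix.mul_assoc]
      have hAt : (A ^ k)ᵀ = A ^ k := by
        rw [Matrix.transpose_pow]
        congr 1
      have hBt : ((A + Matrix.vecMulVec x x) ^ l)ᵀ = (A + Matrix.vecMulVec x x) ^ l := by
        rw [Matrix.transpose_pow, Matrix.transpose_add, Matrix.transpose_vecMulVec]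
        congr 2
      have e2 : (A ^ k * Matrix.vecMulVec x x * (A + Matrix.vecMulVec x x) ^ l).trace
          = x ⬝ᵥ ((A ^ k * (A + Matrix.vecMulVec x x) ^ l) *ᵥ x) := by
        rw [Matrix.mul_vecMulVec, Matrix.vecMulVec_mul, Matrix.trace_vecMulVec,
          ← Matrix.mulVec_mulVec, dotProduct_mulVec_transpose, hAt, ← Matrix.mulVec_transpose, hBt]
      rw [e, Matrix.trace_add, e2]
      have i1 := ih (k + 1)
      have i2 := moment_rank_one_update_le hA h1 hx k l
      have i5 := hm3 (k + l)
      have h6 := hm2 (k + l + 1)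
      rw [show k + 1 + l = k + l + 1 by ring] at i1
      rw [show k + (l + 1) = k + l + 1 by ring]
      have hp : 0 ≤ (1 + R) ^ l := by positivity
      have hp1 : (1 + R) ^ l ≤ (1 + R) ^ (l + 1) :=
        pow_le_pow_right₀ (by linarith) (Nat.le_succ l)
      set y := x ⬝ᵥ (A ^ (k + l + 1) *ᵥ x)
      have i8 : (1 + R) ^ l * (x ⬝ᵥ (A ^ (k + l) *ᵥ x)) ≤ (1 + R) ^ (l + 1) * y :=
        mul_le_mul hp1 i5 (hm2 _) (by positivity)
      have i9 : (l : ℝ) * (1 + R) ^ l * y ≤ l * (1 + R) ^ (l + 1) * y := by gcongr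
      push_cast
      nlinarith
  have h := key p 0
  simpa using h

end RankOne

/-- The form is tested on a unit eigenvector. -/
theorem eigenvalues_ge_one {m : ℕ} {A : Matrix (Fin m) (Fin m) ℝ} (hA : A.IsHermitian)
    (h : ∀ v, v ⬝ᵥ v ≤ v ⬝ᵥ (A *ᵥ v)) (i : Fin m) : 1 ≤ hA.eigenvalues i := by
  have h1 := hA.mulVec_eigenvectorBasis i
  have h2 := h (hA.eigenvectorBasis i)
  rw [h1, dotProduct_smul] at h2
  have h3 : (⇑(hA.eigenvectorBasis i) : Fin m → ℝ) ⬝ᵥ ⇑(hA.eigenvectorBasis i) = 1 := by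
    have h4 := vnorm_sq (⇑(hA.eigenvectorBasis i) : Fin m → ℝ)
    rw [← h4]
    have : vnorm (⇑(hA.eigenvectorBasis i) : Fin m → ℝ) = ‖hA.eigenvectorBasis i‖ := rfl
    rw [this, hA.eigenvectorBasis.orthonormal.1 i, one_pow]
  rw [h3] at h2
  simpa using h2

/-- A bound on `tr A^p` bounds the quadratic form of `A`. -/
theorem dotProduct_mulVec_le_of_trace_pow_le {m : ℕ} {A : Matrix (Fin m) (Fin m) ℝ}
    (hA : A.IsHermitian) (h0 : ∀ i, 0 ≤ hA.eigenvalues i) {p : ℕ} (hp : p ≠ 0) {L : ℝ} (hL : 0 ≤ L)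
    (ht : (A ^ p).trace ≤ L ^ p) (v : Fin m → ℝ) : v ⬝ᵥ (A *ᵥ v) ≤ L * vnorm v ^ 2 := by
  obtain ⟨h1, h2⟩ := exists_spectral_weights hA
  obtain ⟨w, hw0, hw⟩ := h1 v
  have hw1 := hw 1
  rw [pow_one] at hw1
  rw [hw1, vnorm_sq, hw0, Finset.mul_sum]
  refine Finset.sum_le_sum fun i _ => ?_
  rw [pow_one]
  gcongr
  -- Each λ_i^p is one nonnegative term of the trace of A^p, hence at most L^p.
  refine le_of_pow_le_pow_left₀ hp hL (le_trans ?_ ht)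
  rw [h2]
  exact Finset.single_le_sum (f := fun i => hA.eigenvalues i ^ p)
    (fun i _ => pow_nonneg (h0 i) p) (Finset.mem_univ i)

end NPIV

namespace NPIV

/-! ### Closure properties of bounded measurable functions. -/

section BoundedMeasurable

variable {α : Type*} [MeasurableSpace α]

theorem const_mem_Linf (c : ℝ) : (fun _ : α => c) ∈ Linf α :=
  ⟨measurable_const, |c|, fun _ => le_rfl⟩

theorem mul_mem_Linf {f g : α → ℝ} (hf : f ∈ Linf α) (hg : g ∈ Linf α) :
    (fun x => f x * g x) ∈ Linf α := by
  obtain ⟨hf, C, hC⟩ := hf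
  obtain ⟨hg, D, hD⟩ := hg
  refine ⟨hf.mul hg, C * D, fun x => ?_⟩
  rw [abs_mul]
  exact mul_le_mul (hC x) (hD x) (abs_nonneg _) ((abs_nonneg _).trans (hC x))

theorem add_mem_Linf {f g : α → ℝ} (hf : f ∈ Linf α) (hg : g ∈ Linf α) :
    (fun x => f x + g x) ∈ Linf α := (Linf α).add_mem hf hg

theorem sum_mem_Linf {ι : Type*} {s : Finset ι} {f : ι → α → ℝ} (hf : ∀ i ∈ s, f i ∈ Linf α) :
    (fun x => ∑ i ∈ s, f i x) ∈ Linf α := by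
  have h := (Linf α).sum_mem hf
  convert! h using 1
  ext x
  simp

theorem comp_mem_Linf {β : Type*} [MeasurableSpace β] {f : α → ℝ} (hf : f ∈ Linf α) {g : β → α}
    (hg : Measurable g) : (fun x => f (g x)) ∈ Linf β := by
  obtain ⟨hf, C, hC⟩ := hf
  exact ⟨hf.comp hg, C, fun x => hC _⟩

theorem integrable_of_mem_Linf {μ : Measure α} [IsFiniteMeasure μ] {f : α → ℝ} (hf : f ∈ Linf α) :
    Integrable f μ := by
  obtain ⟨hf, C, hC⟩ := hf
  exact Integrable.of_bound hf.aestronglyMeasurable C (Eventually.of_forall hC)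

theorem memLp_of_mem_Linf {μ : Measure α} [IsFiniteMeasure μ] {f : α → ℝ} (hf : f ∈ Linf α) :
    MemLp f 2 μ := by
  obtain ⟨hf, C, hC⟩ := hf
  exact MemLp.of_bound hf.aestronglyMeasurable C (Eventually.of_forall hC)

theorem pow_mem_Linf {m : ℕ} {A : α → Matrix (Fin m) (Fin m) ℝ}
    (hA : ∀ i j, (fun x => A x i j) ∈ Linf α) (p : ℕ) (i j : Fin m) :
    (fun x => (A x ^ p) i j) ∈ Linf α := by
  induction p generalizing i j with
  | zero => simpa using const_mem_Linf _
  | succ p ih =>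
    simp only [pow_succ, Matrix.mul_apply]
    exact sum_mem_Linf fun k _ => mul_mem_Linf (ih i k) (hA k j)

end BoundedMeasurable

/-! ### A matrix Chernoff bound through moments of traces. -/

section Concentration

variable {Ω 𝒵 : Type*} [MeasurableSpace Ω] [MeasurableSpace 𝒵] {μ : Measure Ω}
  [IsProbabilityMeasure μ] {Z : ℕ → Ω → 𝒵} {m : ℕ}

/-- `1 + ∑_{i ∈ s} x_i x_i'`. -/
noncomputable def gram {ι : Type*} [Fintype ι] (x : ι → Fin m → ℝ) : Matrix (Fin m) (Fin m) ℝ :=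
  1 + ∑ i, Matrix.vecMulVec (x i) (x i)

theorem gram_isHermitian {ι : Type*} [Fintype ι] (x : ι → Fin m → ℝ) : (gram x).IsHermitian := by
  unfold gram
  refine Matrix.IsHermitian.add Matrix.isHermitian_one ?_
  rw [Matrix.IsHermitian, Matrix.conjTranspose_sum]
  refine Finset.sum_congr rfl fun i _ => ?_
  rw [Matrix.conjTranspose_eq_transpose_of_trivial, Matrix.transpose_vecMulVec]

theorem dotProduct_gram_mulVec {ι : Type*} [Fintype ι] (x : ι → Fin m → ℝ) (v : Fin m → ℝ) :
    v ⬝ᵥ (gram x *ᵥ v) = v ⬝ᵥ v + ∑ i, (v ⬝ᵥ x i) ^ 2 := by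
  unfold gram
  rw [Matrix.add_mulVec, Matrix.one_mulVec, dotProduct_add, Matrix.sum_mulVec, dotProduct_sum]
  congr 1
  refine Finset.sum_congr rfl fun i _ => ?_
  rw [Matrix.vecMulVec_mulVec, dotProduct_smul, pow_two, dotProduct_comm (x i) v]
  simp

/-- This is why the identity is included in `gram`: the rank one inequalities need all eigenvalues
to be at least 1. -/
theorem one_le_gram_eigenvalues {ι : Type*} [Fintype ι] (x : ι → Fin m → ℝ) (i : Fin m) :
    1 ≤ (gram_isHermitian x).eigenvalues i := by
  refine eigenvalues_ge_one _ (fun v => ?_) i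
  rw [dotProduct_gram_mulVec]
  exact le_add_of_nonneg_right (Finset.sum_nonneg fun _ _ => sq_nonneg _)

theorem gram_mem_Linf {α ι : Type*} [MeasurableSpace α] [Fintype ι] {x : α → ι → Fin m → ℝ}
    (hx : ∀ i j, (fun a => x a i j) ∈ Linf α) (i j : Fin m) :
    (fun a => gram (x a) i j) ∈ Linf α := by
  simp only [gram, Matrix.add_apply, Matrix.sum_apply, Matrix.vecMulVec_apply]
  exact add_mem_Linf (const_mem_Linf _) (sum_mem_Linf fun k _ => mul_mem_Linf (hx k i) (hx k j))

variable {φ : 𝒵 → Fin m → ℝ} (hφ : ∀ j, (fun z => φ z j) ∈ Linf 𝒵)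

/-- The expectation of a positive semidefinite quadratic form in an independent vector. -/
theorem integral_quadForm_le {c : ℝ} {N : Matrix (Fin m) (Fin m) ℝ} (hN : N.PosSemidef)
    {x : Ω → Fin m → ℝ} (hx : ∀ j, (fun ω => x ω j) ∈ Linf Ω)
    (hc : ∀ v : Fin m → ℝ, ∫ ω, (v ⬝ᵥ x ω) ^ 2 ∂μ ≤ c * (v ⬝ᵥ v)) :
    ∫ ω, x ω ⬝ᵥ (N *ᵥ x ω) ∂μ ≤ c * N.trace := by
  obtain ⟨B, rfl⟩ : ∃ B : Matrix (Fin m) (Fin m) ℝ, N = Bᵀ * B := by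
    open scoped MatrixOrder in
    obtain ⟨B, hB⟩ := CStarAlgebra.nonneg_iff_eq_star_mul_self.mp hN.nonneg
    exact ⟨B, by
      rw [hB, Matrix.star_eq_conjTranspose, Matrix.conjTranspose_eq_transpose_of_trivial]⟩
  have e : ∀ ω, x ω ⬝ᵥ ((Bᵀ * B) *ᵥ x ω) = ∑ k, (B k ⬝ᵥ x ω) ^ 2 := by
    intro ω
    rw [← Matrix.mulVec_mulVec, dotProduct_mulVec_transpose, Matrix.transpose_transpose]
    simp [dotProduct, Matrix.mulVec, pow_two]
  simp only [e]
  have hB : ∀ k, (fun ω => (B k ⬝ᵥ x ω) ^ 2) ∈ Linf Ω := by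
    intro k
    have h : (fun ω => B k ⬝ᵥ x ω) ∈ Linf Ω :=
      sum_mem_Linf fun j _ => mul_mem_Linf (const_mem_Linf _) (hx j)
    simpa [pow_two] using mul_mem_Linf h h
  rw [integral_finsetSum _ fun k _ => integrable_of_mem_Linf (hB k)]
  refine (Finset.sum_le_sum fun k _ => hc (B k)).trans ?_
  rw [← Finset.mul_sum]
  refine le_of_eq ?_
  congr 1
  rw [Matrix.trace_mul_comm]
  simp [Matrix.trace, Matrix.mul_apply, dotProduct]

/-- The expectation of `x' P x` when the symmetric positive semidefinite random matrix `P` and the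
random vector `x` are independent. -/
theorem integral_indep_quadForm_le {c : ℝ} {P : Ω → Matrix (Fin m) (Fin m) ℝ}
    {x : Ω → Fin m → ℝ} (hP : ∀ i j, (fun ω => P ω i j) ∈ Linf Ω)
    (hx : ∀ j, (fun ω => x ω j) ∈ Linf Ω) (hPs : ∀ ω, (P ω).PosSemidef)
    (hind : ∀ i j, IndepFun (fun ω => P ω i j) (fun ω => x ω i * x ω j) μ)
    (hc : ∀ v : Fin m → ℝ, ∫ ω, (v ⬝ᵥ x ω) ^ 2 ∂μ ≤ c * (v ⬝ᵥ v)) :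
    ∫ ω, x ω ⬝ᵥ (P ω *ᵥ x ω) ∂μ ≤ c * ∫ ω, (P ω).trace ∂μ := by
  -- By independence P may be replaced by its entrywise mean N, which is again positive
  -- semidefinite; this reduces the claim to a fixed matrix.
  set N : Matrix (Fin m) (Fin m) ℝ := Matrix.of fun i j => ∫ ω, P ω i j ∂μ with hN
  have hxx : ∀ i j, (fun ω => x ω i * x ω j) ∈ Linf Ω := fun i j => mul_mem_Linf (hx i) (hx j)
  have hform : ∀ (Q : Matrix (Fin m) (Fin m) ℝ) (v : Fin m → ℝ),
      v ⬝ᵥ (Q *ᵥ v) = ∑ i, ∑ j, Q i j * (v i * v j) := by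
    intro Q v
    simp only [dotProduct, Matrix.mulVec, Finset.mul_sum]
    exact Finset.sum_congr rfl fun i _ => Finset.sum_congr rfl fun j _ => by ring
  have hPx : ∀ i j, Integrable (fun ω => P ω i j * (x ω i * x ω j)) μ := fun i j =>
    integrable_of_mem_Linf (mul_mem_Linf (hP i j) (hxx i j))
  have hNx : ∀ i j, Integrable (fun ω => N i j * (x ω i * x ω j)) μ := fun i j =>
    (integrable_of_mem_Linf (hxx i j)).const_mul _
  have e1 : ∫ ω, x ω ⬝ᵥ (P ω *ᵥ x ω) ∂μ = ∫ ω, x ω ⬝ᵥ (N *ᵥ x ω) ∂μ := by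
    simp only [hform]
    rw [integral_finsetSum _ fun i _ => integrable_finsetSum _ fun j _ => hPx i j,
      integral_finsetSum _ fun i _ => integrable_finsetSum _ fun j _ => hNx i j]
    refine Finset.sum_congr rfl fun i _ => ?_
    rw [integral_finsetSum _ fun j _ => hPx i j,
      integral_finsetSum _ fun j _ => hNx i j]
    refine Finset.sum_congr rfl fun j _ => ?_
    rw [integral_const_mul, (hind i j).integral_fun_mul_eq_mul_integral
      (hP i j).1.aestronglyMeasurable (hxx i j).1.aestronglyMeasurable]
    rfl
  have e2 : ∫ ω, (P ω).trace ∂μ = N.trace := by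
    simp only [Matrix.trace, Matrix.diag]
    rw [integral_finsetSum _ fun i _ => integrable_of_mem_Linf (hP i i)]
    rfl
  rw [e1, e2]
  refine integral_quadForm_le ?_ hx hc
  refine Matrix.PosSemidef.of_dotProduct_mulVec_nonneg ?_ fun v => ?_
  · ext i j
    simp only [hN, Matrix.conjTranspose_apply, Matrix.of_apply, star_trivial]
    refine integral_congr_ae (Eventually.of_forall fun ω => ?_)
    simpa using (hPs ω).1.apply i j
  · rw [star_trivial, hform]
    have : ∑ i, ∑ j, N i j * (v i * v j) = ∫ ω, v ⬝ᵥ (P ω *ᵥ v) ∂μ := by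
      simp only [hform]
      have hi : ∀ i j, Integrable (fun ω => P ω i j * (v i * v j)) μ := fun i j =>
        (integrable_of_mem_Linf (hP i j)).mul_const _
      rw [integral_finsetSum _ fun i _ => integrable_finsetSum _ fun j _ => hi i j]
      refine Finset.sum_congr rfl fun i _ => ?_
      rw [integral_finsetSum _ fun j _ => hi i j]
      exact Finset.sum_congr rfl fun j _ => (integral_mul_const _ _).symm
    rw [this]
    exact integral_nonneg fun ω => by simpa using (hPs ω).dotProduct_mulVec_nonneg v

variable (hident : ∀ i, IdentDistrib (Z i) (Z 0) μ μ) (hindep : iIndepFun Z μ)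
  (hZ : ∀ i, Measurable (Z i))
include hφ hident hindep hZ

/-- The observations are added one by one. A new one is independent of the matrix built from the
previous ones, so by the rank one bound the expected trace grows by a factor of at most 1 + p(1+R)^p
c. The empty product has trace m. -/
theorem integral_trace_gram_pow_le {R c : ℝ} (hc0 : 0 ≤ c) (hR : ∀ z, φ z ⬝ᵥ φ z ≤ R)
    (hc : ∀ v : Fin m → ℝ, ∫ ω, (v ⬝ᵥ φ (Z 0 ω)) ^ 2 ∂μ ≤ c * (v ⬝ᵥ v)) (p k : ℕ) :
    ∫ ω, (gram (fun i : Fin k => φ (Z i ω)) ^ p).trace ∂μ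
      ≤ m * (1 + p * (1 + R) ^ p * c) ^ k := by
  have hφZ : ∀ i j, (fun ω => φ (Z i ω) j) ∈ Linf Ω := fun i j => comp_mem_Linf (hφ j) (hZ i)
  have hpow : ∀ k i j, (fun ω => (gram (fun i : Fin k => φ (Z i ω)) ^ p) i j) ∈ Linf Ω := fun k =>
    pow_mem_Linf (gram_mem_Linf (x := fun ω (i : Fin k) => φ (Z i ω)) fun i j => hφZ i j) p
  have htr : ∀ k, Integrable (fun ω => (gram (fun i : Fin k => φ (Z i ω)) ^ p).trace) μ :=
    fun k => integrable_of_mem_Linf (sum_mem_Linf fun i _ => hpow k i i)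
  induction k with
  | zero =>
    simp [gram]
  | succ k ih =>
    by_cases hm : m = 0
    · subst hm
      simp [Matrix.trace]
    have : Nonempty Ω := μ.nonempty_of_neZero
    obtain ⟨ω₀⟩ := this
    have hR0 : 0 ≤ R := le_trans (by rw [← vnorm_sq]; positivity) (hR (Z 0 ω₀))
    have hq : Integrable (fun ω =>
        φ (Z k ω) ⬝ᵥ (gram (fun i : Fin k => φ (Z i ω)) ^ p *ᵥ φ (Z k ω))) μ := by
      refine integrable_of_mem_Linf (sum_mem_Linf fun i _ => mul_mem_Linf (hφZ k i) ?_)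
      simp only [Matrix.mulVec, dotProduct]
      exact sum_mem_Linf fun j _ => mul_mem_Linf (hpow k i j) (hφZ k j)
    have step : ∀ ω, (gram (fun i : Fin (k + 1) => φ (Z i ω)) ^ p).trace
        ≤ (gram (fun i : Fin k => φ (Z i ω)) ^ p).trace + p * (1 + R) ^ p *
          (φ (Z k ω) ⬝ᵥ (gram (fun i : Fin k => φ (Z i ω)) ^ p *ᵥ φ (Z k ω))) := by
      intro ω
      have e : gram (fun i : Fin (k + 1) => φ (Z i ω))
          = gram (fun i : Fin k => φ (Z i ω)) + Matrix.vecMulVec (φ (Z k ω)) (φ (Z k ω)) := by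
        unfold gram
        rw [Fin.sum_univ_castSucc, ← add_assoc]
        rfl
      rw [e]
      exact trace_rank_one_update_le _ (one_le_gram_eigenvalues _) (hR _) p
    have hind : ∫ ω, φ (Z k ω) ⬝ᵥ (gram (fun i : Fin k => φ (Z i ω)) ^ p *ᵥ φ (Z k ω)) ∂μ
        ≤ c * ∫ ω, (gram (fun i : Fin k => φ (Z i ω)) ^ p).trace ∂μ := by
      refine integral_indep_quadForm_le (hpow k) (hφZ k) (fun ω => ?_) (fun i j => ?_) (fun v => ?_)
      · refine Matrix.PosSemidef.pow ?_ p
        refine Matrix.PosSemidef.of_dotProduct_mulVec_nonneg (gram_isHermitian _) fun v => ?_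
        rw [star_trivial, dotProduct_gram_mulVec]
        exact add_nonneg (by rw [← vnorm_sq]; positivity)
          (Finset.sum_nonneg fun _ _ => sq_nonneg _)
      · have h1 := hindep.indepFun_finset (Finset.range k) {k} (by simp) hZ
        have hf : Measurable (fun z : (Finset.range k) → 𝒵 =>
            (gram (fun i : Fin k => φ (z ⟨i, Finset.mem_range.2 i.2⟩)) ^ p) i j) :=
          (pow_mem_Linf (gram_mem_Linf
            (x := fun (z : (Finset.range k) → 𝒵) (i : Fin k) => φ (z ⟨i, Finset.mem_range.2 i.2⟩))
            fun i j => comp_mem_Linf (hφ j) (measurable_pi_apply _)) p i j).1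
        have hg : Measurable (fun z : ({k} : Finset ℕ) → 𝒵 =>
            φ (z ⟨k, by simp⟩) i * φ (z ⟨k, by simp⟩) j) :=
          ((hφ i).1.comp (measurable_pi_apply _)).mul ((hφ j).1.comp (measurable_pi_apply _))
        exact h1.comp hf hg
      · have hm : Measurable (fun z => (v ⬝ᵥ φ z) ^ 2) :=
          (Finset.measurable_fun_sum _ fun j _ => (hφ j).1.const_mul _).pow_const 2
        have := ((hident k).comp hm).integral_eq
        exact this.trans_le (hc v)
    refine (integral_mono (htr _) ((htr k).add (hq.const_mul _)) step).trans ?_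
    simp only [Pi.add_apply]
    rw [integral_add (htr k) (hq.const_mul _), integral_const_mul]
    have hpos : 0 ≤ (p : ℝ) * (1 + R) ^ p := by positivity
    calc _ ≤ ∫ ω, (gram (fun i : Fin k => φ (Z i ω)) ^ p).trace ∂μ + p * (1 + R) ^ p *
          (c * ∫ ω, (gram (fun i : Fin k => φ (Z i ω)) ^ p).trace ∂μ) := by gcongr
      _ = (1 + p * (1 + R) ^ p * c) * ∫ ω, (gram (fun i : Fin k => φ (Z i ω)) ^ p).trace ∂μ := by
        ring
      _ ≤ (1 + p * (1 + R) ^ p * c) * (m * (1 + p * (1 + R) ^ p * c) ^ k) := by gcongr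
      _ = _ := by ring

/-- **Matrix Chernoff bound** for the largest eigenvalue of an empirical second moment matrix. -/
theorem measure_exists_lt_empMean_sq_le {n p : ℕ} (hn : n ≠ 0) (hp : p ≠ 0) {R c : ℝ}
    (hc0 : 0 ≤ c) (hpR : p * R ≤ n) (hR : ∀ z, φ z ⬝ᵥ φ z ≤ R)
    (hc : ∀ v : Fin m → ℝ, ∫ ω, (v ⬝ᵥ φ (Z 0 ω)) ^ 2 ∂μ ≤ c * (v ⬝ᵥ v)) :
    μ {ω | ¬ ∀ v : Fin m → ℝ, empMean Z n (fun z => (v ⬝ᵥ φ z) ^ 2) ω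
        ≤ Real.exp (c * Real.exp 1 + 1) * vnorm v ^ 2}
      ≤ ENNReal.ofReal (m * Real.exp (-p)) := by
  have hn0 : (0 : ℝ) < n := by positivity
  have : Nonempty Ω := μ.nonempty_of_neZero
  obtain ⟨ω₀⟩ := this
  have hR0 : 0 ≤ R := le_trans (by rw [← vnorm_sq]; positivity) (hR (Z 0 ω₀))
  -- Scaling by n^{-1/2} makes `gram` the identity plus the empirical second moment matrix, and
  -- divides both R and c by n.
  set t : ℝ := (Real.sqrt n)⁻¹ with ht
  have ht2 : t * t = (n : ℝ)⁻¹ := by rw [ht, ← mul_inv, Real.mul_self_sqrt hn0.le]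
  have hφ' : ∀ j, (fun z => (t • φ z) j) ∈ Linf 𝒵 := fun j =>
    mul_mem_Linf (const_mem_Linf t) (hφ j)
  have hR' : ∀ z, (t • φ z) ⬝ᵥ (t • φ z) ≤ R / n := by
    intro z
    rw [smul_dotProduct, dotProduct_smul, smul_smul, ht2, smul_eq_mul, inv_mul_eq_div]
    gcongr
    exact hR z
  have hc' : ∀ v : Fin m → ℝ, ∫ ω, (v ⬝ᵥ (t • φ (Z 0 ω))) ^ 2 ∂μ ≤ c / n * (v ⬝ᵥ v) := by
    intro v
    simp only [dotProduct_smul, smul_eq_mul, mul_pow]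
    rw [integral_const_mul, pow_two, ht2, inv_mul_eq_div, div_mul_eq_mul_div]
    gcongr
    exact hc v
  have h1 := integral_trace_gram_pow_le hφ' hident hindep hZ (c := c / n) (by positivity) hR' hc' p n
  set F : Ω → ℝ := fun ω => (gram (fun i : Fin n => t • φ (Z i ω)) ^ p).trace with hF
  have hL : F ∈ Linf Ω := sum_mem_Linf fun i _ => pow_mem_Linf
    (gram_mem_Linf (x := fun ω (i : Fin n) => t • φ (Z i ω))
      fun i j => comp_mem_Linf (hφ' j) (hZ i)) p i i
  have hF0 : ∀ ω, 0 ≤ F ω := by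
    intro ω
    simp only [hF]
    rw [(exists_spectral_weights (gram_isHermitian _)).2 p]
    exact Finset.sum_nonneg fun i _ =>
      pow_nonneg (zero_le_one.trans (one_le_gram_eigenvalues _ i)) p
  -- The condition pR ≤ n keeps (1 + R/n)^p below e, so the n growth factors multiply to at most
  -- exp(c e p).
  have hexp : (1 + p * (1 + R / n) ^ p * (c / n)) ^ n ≤ Real.exp (c * Real.exp 1 * p) := by
    have i1 : (1 + R / n) ^ p ≤ Real.exp 1 := by
      have : 1 + R / n ≤ Real.exp (R / n) := by
        rw [add_comm]; exact Real.add_one_le_exp _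
      calc (1 + R / n) ^ p ≤ Real.exp (R / n) ^ p := by gcongr
        _ = Real.exp (p * (R / n)) := (Real.exp_nat_mul _ _).symm
        _ ≤ Real.exp 1 := by
          rw [Real.exp_le_exp, mul_div_assoc', div_le_one hn0]
          exact hpR
    have i2 : 1 + p * (1 + R / n) ^ p * (c / n) ≤ Real.exp (p * Real.exp 1 * (c / n)) := by
      calc _ ≤ 1 + p * Real.exp 1 * (c / n) := by gcongr
        _ ≤ _ := by rw [add_comm]; exact Real.add_one_le_exp _
    calc _ ≤ Real.exp (p * Real.exp 1 * (c / n)) ^ n := by gcongr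
      _ = Real.exp (n * (p * Real.exp 1 * (c / n))) := (Real.exp_nat_mul _ _).symm
      _ = _ := by congr 1; field_simp
  have h2 : ∫ ω, F ω ∂μ ≤ m * Real.exp (c * Real.exp 1 * p) :=
    h1.trans (by gcongr)
  have hsub : {ω | ¬ ∀ v : Fin m → ℝ, empMean Z n (fun z => (v ⬝ᵥ φ z) ^ 2) ω
        ≤ Real.exp (c * Real.exp 1 + 1) * vnorm v ^ 2}
      ⊆ {ω | Real.exp (c * Real.exp 1 + 1) ^ p ≤ F ω} := by
    intro ω hω
    by_contra hlt
    refine hω fun v => ?_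
    have h3 := dotProduct_mulVec_le_of_trace_pow_le (gram_isHermitian _)
      (fun i => zero_le_one.trans (one_le_gram_eigenvalues _ i)) hp (Real.exp_pos _).le
      (le_of_lt (not_le.1 hlt)) v
    rw [dotProduct_gram_mulVec] at h3
    refine le_trans ?_ h3
    have e : empMean Z n (fun z => (v ⬝ᵥ φ z) ^ 2) ω = ∑ i : Fin n, (v ⬝ᵥ (t • φ (Z i ω))) ^ 2 := by
      unfold empMean
      simp only [dotProduct_smul, smul_eq_mul, mul_pow]
      rw [← Finset.mul_sum, pow_two, ht2, Finset.sum_range]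
    rw [e]
    exact le_add_of_nonneg_left (by rw [← vnorm_sq]; positivity)
  refine (measure_mono hsub).trans ?_
  -- Markov at level exp((ce+1)p): the mean is at most m exp(cep), and the extra 1 in the exponent
  -- leaves m exp(-p).
  have hm := mul_meas_ge_le_integral_of_nonneg (Eventually.of_forall hF0)
    (integrable_of_mem_Linf hL) (μ := μ) (Real.exp (c * Real.exp 1 + 1) ^ p)
  rw [← ofReal_measureReal]
  refine ENNReal.ofReal_le_ofReal ?_
  have h4 := hm.trans h2
  have hpos : (0 : ℝ) < Real.exp (c * Real.exp 1 + 1) ^ p := by positivity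
  rw [mul_comm, ← le_div_iff₀ hpos] at h4
  refine h4.trans (le_of_eq ?_)
  rw [mul_div_assoc, ← Real.exp_nat_mul, ← Real.exp_sub]
  congr 2
  ring

end Concentration

end NPIV

/-! ### Orthonormalised bases, whitened sample moments, conditional moments of the residual. -/

namespace NPIV

theorem mulVec_mem_Linf {α : Type*} [MeasurableSpace α] {k m : ℕ} (A : Matrix (Fin k) (Fin m) ℝ)
    {x : α → Fin m → ℝ} (hx : ∀ j, (fun a => x a j) ∈ Linf α) (i : Fin k) :
    (fun a => (A *ᵥ x a) i) ∈ Linf α := by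
  simp only [Matrix.mulVec, dotProduct]
  exact sum_mem_Linf fun j _ => mul_mem_Linf (const_mem_Linf _) (hx j)

theorem dotProduct_mem_Linf {α : Type*} [MeasurableSpace α] {m : ℕ} (v : Fin m → ℝ)
    {x : α → Fin m → ℝ} (hx : ∀ j, (fun a => x a j) ∈ Linf α) :
    (fun a => v ⬝ᵥ x a) ∈ Linf α := by
  simp only [dotProduct]
  exact sum_mem_Linf fun j _ => mul_mem_Linf (const_mem_Linf _) (hx j)

theorem sq_mem_Linf {α : Type*} [MeasurableSpace α] {f : α → ℝ} (hf : f ∈ Linf α) :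
    (fun a => f a ^ 2) ∈ Linf α := by
  simpa [pow_two] using mul_mem_Linf hf hf

theorem vnorm_le_iSup {α : Type*} [MeasurableSpace α] {m : ℕ} {x : α → Fin m → ℝ}
    (hx : ∀ j, (fun a => x a j) ∈ Linf α) (a : α) : vnorm (x a) ≤ ⨆ a, vnorm (x a) := by
  have h : (fun a => ∑ j, x a j ^ 2) ∈ Linf α := sum_mem_Linf fun j _ => sq_mem_Linf (hx j)
  obtain ⟨-, C, hC⟩ := h
  refine le_ciSup (f := fun a => vnorm (x a)) ⟨Real.sqrt C, ?_⟩ a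
  rintro _ ⟨b, rfl⟩
  refine Real.le_sqrt_of_sq_le ?_
  rw [vnorm_sq']
  exact (le_abs_self _).trans (hC b)

/-- Linearity of the integral, A E[xy'] B' = E[(Ax)(By)'], with B symmetric. It transfers every
moment matrix to the whitened bases. -/
theorem mul_integral_mul_apply {Ω : Type*} [MeasurableSpace Ω] {μ : Measure Ω} {a k m : ℕ}
    (A : Matrix (Fin a) (Fin k) ℝ) {B : Matrix (Fin m) (Fin m) ℝ} (hB : Bᵀ = B) {x : Ω → Fin k → ℝ}
    {y : Ω → Fin m → ℝ} (h : ∀ i j, Integrable (fun ω => x ω i * y ω j) μ) (i : Fin a) (j : Fin m) :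
    (A * (Matrix.of fun i j => ∫ ω, x ω i * y ω j ∂μ) * B) i j
      = ∫ ω, (A *ᵥ x ω) i * (B *ᵥ y ω) j ∂μ := by
  have e : ∀ ω, (A *ᵥ x ω) i * (B *ᵥ y ω) j
      = ∑ l, ∑ k', A i k' * B j l * (x ω k' * y ω l) := by
    intro ω
    simp only [Matrix.mulVec, dotProduct]
    rw [Finset.sum_mul_sum, Finset.sum_comm]
    exact Finset.sum_congr rfl fun _ _ => Finset.sum_congr rfl fun _ _ => by ring
  simp only [e]
  rw [integral_finsetSum _ fun l _ => integrable_finsetSum _ fun k' _ => (h k' l).const_mul _]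
  have hB' : ∀ l, B l j = B j l := fun l => congrFun (congrFun hB j) l
  simp only [Matrix.mul_apply, hB', Matrix.of_apply]
  refine Finset.sum_congr rfl fun l _ => ?_
  rw [integral_finsetSum _ fun k' _ => (h k' l).const_mul _, Finset.sum_mul]
  refine Finset.sum_congr rfl fun k' _ => ?_
  rw [integral_const_mul]
  ring

namespace Model

variable {Ω 𝒳 𝒲 : Type*} [MeasurableSpace Ω] [MeasurableSpace 𝒳] [MeasurableSpace 𝒲]
  (M : Model Ω 𝒳 𝒲) (μ : Measure Ω)

/-- The observation `(Y_i, X_i, W_i)`. -/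
def obs (i : ℕ) (ω : Ω) : ℝ × 𝒳 × 𝒲 := (M.Y i ω, M.X i ω, M.W i ω)

theorem measurable_obs (i : ℕ) : Measurable (M.obs i) :=
  (M.measurable_Y i).prodMk ((M.measurable_X i).prodMk (M.measurable_W i))

/-- The residual as a function of the observation. -/
def res (z : ℝ × 𝒳 × 𝒲) : ℝ := z.1 - (M.h₀ : 𝒳 → ℝ) z.2.1

theorem measurable_res : Measurable M.res :=
  measurable_fst.sub (M.h₀.2.1.comp (measurable_fst.comp measurable_snd))

theorem res_obs (i : ℕ) (ω : Ω) : M.res (M.obs i ω) = M.u i ω := rfl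

theorem measurable_u (i : ℕ) : Measurable (M.u i) := M.measurable_res.comp (M.measurable_obs i)

/-- The matrix `G_b^{-1/2}`. -/
noncomputable def U (n : ℕ) : Matrix (Fin (M.K n)) (Fin (M.K n)) ℝ := invSqrt (M.Gb μ n)

/-- The matrix `G_ψ^{-1/2}`. -/
noncomputable def V (n : ℕ) : Matrix (Fin (M.J n)) (Fin (M.J n)) ℝ := invSqrt (M.Gψ μ n)

/-- The orthonormalized instrument basis `G_b^{-1/2} b^K`. -/
noncomputable def bw (n : ℕ) (w : 𝒲) : Fin (M.K n) → ℝ := M.U μ n *ᵥ M.bvec n w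

/-- The orthonormalized sieve basis `G_ψ^{-1/2} ψ^J`. -/
noncomputable def pw (n : ℕ) (x : 𝒳) : Fin (M.J n) → ℝ := M.V μ n *ᵥ M.ψvec n x

/-- `G_b^{-1/2} S G_ψ^{-1/2}`. -/
noncomputable def Sw (n : ℕ) : Matrix (Fin (M.K n)) (Fin (M.J n)) ℝ := M.U μ n * M.S μ n * M.V μ n

theorem bvec_mem_Linf (n : ℕ) (k : Fin (M.K n)) : (fun w => M.bvec n w k) ∈ Linf 𝒲 :=
  (M.b (M.K n) k).2

theorem ψvec_mem_Linf (n : ℕ) (j : Fin (M.J n)) : (fun x => M.ψvec n x j) ∈ Linf 𝒳 :=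
  (M.ψ (M.J n) j).2

theorem bw_mem_Linf (n : ℕ) (k : Fin (M.K n)) : (fun w => M.bw μ n w k) ∈ Linf 𝒲 :=
  mulVec_mem_Linf _ (M.bvec_mem_Linf n) k

theorem pw_mem_Linf (n : ℕ) (j : Fin (M.J n)) : (fun x => M.pw μ n x j) ∈ Linf 𝒳 :=
  mulVec_mem_Linf _ (M.ψvec_mem_Linf n) j

theorem vnorm_bw_le (n : ℕ) (w : 𝒲) : vnorm (M.bw μ n w) ≤ M.ζ μ n :=
  (vnorm_le_iSup (M.bw_mem_Linf μ n) w).trans (le_max_left _ _)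

theorem vnorm_pw_le (n : ℕ) (x : 𝒳) : vnorm (M.pw μ n x) ≤ M.ζ μ n :=
  (vnorm_le_iSup (M.pw_mem_Linf μ n) x).trans (le_max_right _ _)

theorem U_transpose (n : ℕ) : (M.U μ n)ᵀ = M.U μ n := invSqrt_transpose _

theorem V_transpose (n : ℕ) : (M.V μ n)ᵀ = M.V μ n := invSqrt_transpose _

variable {M μ}

theorem isUnit_det_U (h : M.IsRegularSieve μ) (n : ℕ) : IsUnit (M.U μ n).det :=
  isUnit_det_invSqrt (h.posDef_Gb n)

theorem isUnit_det_V (h : M.IsRegularSieve μ) (n : ℕ) : IsUnit (M.V μ n).det :=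
  isUnit_det_invSqrt (h.posDef_Gψ n)

theorem U_mul_Gb_mul_U (h : M.IsRegularSieve μ) (n : ℕ) : M.U μ n * M.Gb μ n * M.U μ n = 1 :=
  invSqrt_mul_mul_invSqrt (h.posDef_Gb n)

theorem V_mul_Gψ_mul_V (h : M.IsRegularSieve μ) (n : ℕ) : M.V μ n * M.Gψ μ n * M.V μ n = 1 :=
  invSqrt_mul_mul_invSqrt (h.posDef_Gψ n)

variable [IsProbabilityMeasure μ]

theorem integrable_W {g : 𝒲 → ℝ} (hg : g ∈ Linf 𝒲) : Integrable (fun ω => g (M.W 0 ω)) μ :=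
  integrable_of_mem_Linf (comp_mem_Linf hg (M.measurable_W 0))

theorem integral_bw_mul_bw (h : M.IsRegularSieve μ) (n : ℕ) (k l : Fin (M.K n)) :
    ∫ ω, M.bw μ n (M.W 0 ω) k * M.bw μ n (M.W 0 ω) l ∂μ
      = (1 : Matrix (Fin (M.K n)) (Fin (M.K n)) ℝ) k l := by
  rw [← U_mul_Gb_mul_U h n]
  exact (mul_integral_mul_apply (M.U μ n) (M.U_transpose μ n) (fun i j => integrable_of_mem_Linf
    (mul_mem_Linf (comp_mem_Linf (M.bvec_mem_Linf n i) (M.measurable_W 0))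
      (comp_mem_Linf (M.bvec_mem_Linf n j) (M.measurable_W 0)))) k l).symm

theorem integral_pw_mul_pw (h : M.IsRegularSieve μ) (n : ℕ) (k l : Fin (M.J n)) :
    ∫ ω, M.pw μ n (M.X 0 ω) k * M.pw μ n (M.X 0 ω) l ∂μ
      = (1 : Matrix (Fin (M.J n)) (Fin (M.J n)) ℝ) k l := by
  rw [← V_mul_Gψ_mul_V h n]
  exact (mul_integral_mul_apply (M.V μ n) (M.V_transpose μ n) (fun i j => integrable_of_mem_Linf
    (mul_mem_Linf (comp_mem_Linf (M.ψvec_mem_Linf n i) (M.measurable_X 0))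
      (comp_mem_Linf (M.ψvec_mem_Linf n j) (M.measurable_X 0)))) k l).symm

theorem bw_mul_pw_mem_Linf (n : ℕ) (k : Fin (M.K n)) (j : Fin (M.J n)) :
    (fun ω => M.bw μ n (M.W 0 ω) k * M.pw μ n (M.X 0 ω) j) ∈ Linf Ω :=
  mul_mem_Linf (comp_mem_Linf (M.bw_mem_Linf μ n k) (M.measurable_W 0))
    (comp_mem_Linf (M.pw_mem_Linf μ n j) (M.measurable_X 0))

theorem integral_bw_mul_pw (n : ℕ) (k : Fin (M.K n)) (j : Fin (M.J n)) :
    ∫ ω, M.bw μ n (M.W 0 ω) k * M.pw μ n (M.X 0 ω) j ∂μ = M.Sw μ n k j := by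
  unfold Sw
  exact (mul_integral_mul_apply (M.U μ n) (M.V_transpose μ n) (fun i j => integrable_of_mem_Linf
    (mul_mem_Linf (comp_mem_Linf (M.bvec_mem_Linf n i) (M.measurable_W 0))
      (comp_mem_Linf (M.ψvec_mem_Linf n j) (M.measurable_X 0)))) k j).symm

theorem integral_dotProduct_sq {m : ℕ} {x : Ω → Fin m → ℝ} (hx : ∀ j, (fun ω => x ω j) ∈ Linf Ω)
    (h1 : ∀ i j, ∫ ω, x ω i * x ω j ∂μ = (1 : Matrix (Fin m) (Fin m) ℝ) i j) (v : Fin m → ℝ) :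
    ∫ ω, (v ⬝ᵥ x ω) ^ 2 ∂μ = v ⬝ᵥ v := by
  have e : ∀ ω, (v ⬝ᵥ x ω) ^ 2 = ∑ i, ∑ j, v i * v j * (x ω i * x ω j) := by
    intro ω
    rw [pow_two]
    simp only [dotProduct]
    rw [Finset.sum_mul_sum]
    exact Finset.sum_congr rfl fun _ _ => Finset.sum_congr rfl fun _ _ => by ring
  have hi : ∀ i j, Integrable (fun ω => v i * v j * (x ω i * x ω j)) μ := fun i j =>
    (integrable_of_mem_Linf (mul_mem_Linf (hx i) (hx j))).const_mul _
  simp only [e]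
  rw [integral_finsetSum _ fun i _ => integrable_finsetSum _ fun j _ => hi i j, dotProduct]
  refine Finset.sum_congr rfl fun i _ => ?_
  rw [integral_finsetSum _ fun j _ => hi i j]
  simp only [integral_const_mul, h1, Matrix.one_apply]
  simp

theorem integral_dotProduct_bw_sq (h : M.IsRegularSieve μ) (n : ℕ) (v : Fin (M.K n) → ℝ) :
    ∫ ω, (v ⬝ᵥ M.bw μ n (M.W 0 ω)) ^ 2 ∂μ = v ⬝ᵥ v :=
  integral_dotProduct_sq (fun k => comp_mem_Linf (M.bw_mem_Linf μ n k) (M.measurable_W 0))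
    (integral_bw_mul_bw h n) v

theorem integral_dotProduct_pw_sq (h : M.IsRegularSieve μ) (n : ℕ) (v : Fin (M.J n) → ℝ) :
    ∫ ω, (v ⬝ᵥ M.pw μ n (M.X 0 ω)) ^ 2 ∂μ = v ⬝ᵥ v :=
  integral_dotProduct_sq (fun k => comp_mem_Linf (M.pw_mem_Linf μ n k) (M.measurable_X 0))
    (integral_pw_mul_pw h n) v

theorem integral_bw_dotProduct_self (h : M.IsRegularSieve μ) (n : ℕ) :
    ∫ ω, M.bw μ n (M.W 0 ω) ⬝ᵥ M.bw μ n (M.W 0 ω) ∂μ = M.K n := by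
  simp only [dotProduct]
  rw [integral_finsetSum _ fun k _ =>
    integrable_W (mul_mem_Linf (M.bw_mem_Linf μ n k) (M.bw_mem_Linf μ n k))]
  simp [integral_bw_mul_bw h n]

/-- The trace of E[bb'] = 1 is K, and the integrand |b|² is at most ζ². -/
theorem K_le_ζ_sq (h : M.IsRegularSieve μ) (n : ℕ) : (M.K n : ℝ) ≤ M.ζ μ n ^ 2 := by
  rw [← integral_bw_dotProduct_self h n]
  have hi : Integrable (fun ω => M.bw μ n (M.W 0 ω) ⬝ᵥ M.bw μ n (M.W 0 ω)) μ :=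
    integrable_finsetSum _ fun k _ =>
    integrable_W (mul_mem_Linf (M.bw_mem_Linf μ n k) (M.bw_mem_Linf μ n k))
  have : ∫ _ω : Ω, M.ζ μ n ^ 2 ∂μ = M.ζ μ n ^ 2 := by simp
  rw [← this]
  refine integral_mono hi (integrable_const _) fun ω => ?_
  simp only
  rw [← vnorm_sq]
  exact pow_le_pow_left₀ (vnorm_nonneg _) (M.vnorm_bw_le μ n _) 2

omit [IsProbabilityMeasure μ] in
theorem ζ_nonneg (n : ℕ) : 0 ≤ M.ζ μ n :=
  le_max_of_le_left (Real.iSup_nonneg fun _ => norm_nonneg _)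

/-! Whitened sample moments. -/

omit [IsProbabilityMeasure μ] in
theorem mul_smul_transpose_mul_mul {n k m : ℕ} (B : Matrix (Fin n) (Fin k) ℝ)
    (P : Matrix (Fin n) (Fin m) ℝ) (A : Matrix (Fin k) (Fin k) ℝ) (C : Matrix (Fin m) (Fin m) ℝ)
    (hC : Cᵀ = C) (i : Fin k) (j : Fin m) :
    (A * ((n : ℝ)⁻¹ • (Bᵀ * P)) * C) i j
      = (n : ℝ)⁻¹ * ∑ l, (A *ᵥ B l) i * (C *ᵥ P l) j := by
  have e : A * ((n : ℝ)⁻¹ • (Bᵀ * P)) * C = (n : ℝ)⁻¹ • ((B * Aᵀ)ᵀ * (P * C)) := by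
    rw [Matrix.mul_smul, Matrix.smul_mul, Matrix.transpose_mul, Matrix.transpose_transpose]
    simp only [Matrix.mul_assoc]
  rw [e, Matrix.smul_apply, Matrix.mul_apply, smul_eq_mul]
  congr 1
  refine Finset.sum_congr rfl fun l _ => ?_
  rw [Matrix.transpose_apply]
  congr 1
  · simp [Matrix.mul_apply, Matrix.mulVec, dotProduct, mul_comm]
  · nth_rewrite 2 [← hC]
    simp [Matrix.mul_apply, Matrix.mulVec, dotProduct, mul_comm]

/-- `G_b^{-1/2} Ĝ_b G_b^{-1/2}`. -/
noncomputable def Gwhat (M : Model Ω 𝒳 𝒲) (μ : Measure Ω) (n : ℕ) (ω : Ω) :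
    Matrix (Fin (M.K n)) (Fin (M.K n)) ℝ := M.U μ n * M.Gbhat n ω * M.U μ n

/-- `G_b^{-1/2} Ŝ G_ψ^{-1/2}`. -/
noncomputable def Swhat (M : Model Ω 𝒳 𝒲) (μ : Measure Ω) (n : ℕ) (ω : Ω) :
    Matrix (Fin (M.K n)) (Fin (M.J n)) ℝ := M.U μ n * M.Shat n ω * M.V μ n

omit [IsProbabilityMeasure μ] in
theorem Gwhat_apply (n : ℕ) (ω : Ω) (k l : Fin (M.K n)) :
    M.Gwhat μ n ω k l = empMean M.obs n (fun z => M.bw μ n z.2.2 k * M.bw μ n z.2.2 l) ω := by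
  unfold Gwhat Gbhat
  rw [mul_smul_transpose_mul_mul _ _ _ _ (M.U_transpose μ n)]
  unfold empMean
  rw [Finset.sum_range]
  rfl

omit [IsProbabilityMeasure μ] in
theorem Swhat_apply (n : ℕ) (ω : Ω) (k : Fin (M.K n)) (j : Fin (M.J n)) :
    M.Swhat μ n ω k j = empMean M.obs n (fun z => M.bw μ n z.2.2 k * M.pw μ n z.2.1 j) ω := by
  unfold Swhat Shat
  rw [mul_smul_transpose_mul_mul _ _ _ _ (M.V_transpose μ n)]
  unfold empMean
  rw [Finset.sum_range]
  rfl

theorem empMean_sum_mul {Ω 𝒵 : Type*} {Z : ℕ → Ω → 𝒵} (n : ℕ) {ι : Type*} (s : Finset ι)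
    (c : ι → ℝ) (g : ι → 𝒵 → ℝ) (ω : Ω) :
    ∑ i ∈ s, empMean Z n (g i) ω * c i = empMean Z n (fun z => ∑ i ∈ s, g i z * c i) ω := by
  simp only [empMean, Finset.mul_sum, Finset.sum_mul]
  rw [Finset.sum_comm]
  exact Finset.sum_congr rfl fun _ _ => Finset.sum_congr rfl fun _ _ => by ring

omit [IsProbabilityMeasure μ] in
theorem Gwhat_mulVec (n : ℕ) (ω : Ω) (v : Fin (M.K n) → ℝ) (k : Fin (M.K n)) :
    (M.Gwhat μ n ω *ᵥ v) k
      = empMean M.obs n (fun z => M.bw μ n z.2.2 k * (v ⬝ᵥ M.bw μ n z.2.2)) ω := by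
  simp only [Matrix.mulVec, dotProduct, Gwhat_apply]
  rw [empMean_sum_mul]
  congr 1
  ext z
  rw [Finset.mul_sum]
  exact Finset.sum_congr rfl fun _ _ => by ring

omit [IsProbabilityMeasure μ] in
theorem Swhat_mulVec (n : ℕ) (ω : Ω) (v : Fin (M.J n) → ℝ) (k : Fin (M.K n)) :
    (M.Swhat μ n ω *ᵥ v) k
      = empMean M.obs n (fun z => M.bw μ n z.2.2 k * (v ⬝ᵥ M.pw μ n z.2.1)) ω := by
  simp only [Matrix.mulVec, dotProduct, Swhat_apply]
  rw [empMean_sum_mul]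
  congr 1
  ext z
  rw [Finset.mul_sum]
  exact Finset.sum_congr rfl fun _ _ => by ring

omit [IsProbabilityMeasure μ] in
theorem Swhat_transpose_mulVec (n : ℕ) (ω : Ω) (v : Fin (M.K n) → ℝ) (j : Fin (M.J n)) :
    ((M.Swhat μ n ω)ᵀ *ᵥ v) j
      = empMean M.obs n (fun z => M.pw μ n z.2.1 j * (v ⬝ᵥ M.bw μ n z.2.2)) ω := by
  simp only [Matrix.mulVec, dotProduct, Swhat_apply, Matrix.transpose_apply]
  rw [empMean_sum_mul]
  congr 1
  ext z
  rw [Finset.mul_sum]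
  exact Finset.sum_congr rfl fun _ _ => by ring

/-! Conditional moments of the residual. -/

/-- Pulling the bounded function g(W) out of the conditional expectation. All conditional hypotheses
on u are used only through weighted integrals of this kind. -/
theorem integral_mul_condExp {H : Ω → ℝ} (hH : Integrable H μ) {g : 𝒲 → ℝ} (hg : g ∈ Linf 𝒲) :
    Integrable (fun ω => H ω * g (M.W 0 ω)) μ ∧
    Integrable (fun ω => (μ[H | M.sigmaW 0]) ω * g (M.W 0 ω)) μ ∧
    ∫ ω, H ω * g (M.W 0 ω) ∂μ = ∫ ω, (μ[H | M.sigmaW 0]) ω * g (M.W 0 ω) ∂μ := by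
  obtain ⟨hgm, C, hC⟩ := hg
  have hle : M.sigmaW 0 ≤ (inferInstance : MeasurableSpace Ω) := (M.measurable_W 0).comap_le
  have hgW : AEStronglyMeasurable (fun ω => g (M.W 0 ω)) μ :=
    (hgm.comp (M.measurable_W 0)).aestronglyMeasurable
  have hsm : StronglyMeasurable[M.sigmaW 0] (fun ω => g (M.W 0 ω)) :=
    (hgm.comp (comap_measurable (M.W 0))).stronglyMeasurable
  have i1 : Integrable (fun ω => H ω * g (M.W 0 ω)) μ :=
    hH.mul_bdd (c := C) hgW (Eventually.of_forall fun ω => hC _)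
  have i2 : Integrable (fun ω => (μ[H | M.sigmaW 0]) ω * g (M.W 0 ω)) μ :=
    integrable_condExp.mul_bdd (c := C) hgW (Eventually.of_forall fun ω => hC _)
  refine ⟨i1, i2, ?_⟩
  rw [← integral_condExp hle]
  exact integral_congr_ae (condExp_mul_of_stronglyMeasurable_right hsm i1 hH)

theorem integral_mul_le_of_condExp_le {H : Ω → ℝ} (hH : Integrable H μ) {C : ℝ}
    (hC : ∀ᵐ ω ∂μ, (μ[H | M.sigmaW 0]) ω ≤ C) {g : 𝒲 → ℝ} (hg : g ∈ Linf 𝒲) (h0 : ∀ w, 0 ≤ g w) :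
    ∫ ω, H ω * g (M.W 0 ω) ∂μ ≤ C * ∫ ω, g (M.W 0 ω) ∂μ := by
  obtain ⟨-, i2, e⟩ := integral_mul_condExp (M := M) hH hg
  rw [e, ← integral_const_mul]
  refine integral_mono_ae i2 ((integrable_W hg).const_mul _) ?_
  filter_upwards [hC] with ω hω
  exact mul_le_mul_of_nonneg_right hω (h0 _)

theorem le_integral_mul_of_le_condExp {H : Ω → ℝ} (hH : Integrable H μ) {c : ℝ}
    (hc : ∀ᵐ ω ∂μ, c ≤ (μ[H | M.sigmaW 0]) ω) {g : 𝒲 → ℝ} (hg : g ∈ Linf 𝒲) (h0 : ∀ w, 0 ≤ g w) :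
    c * ∫ ω, g (M.W 0 ω) ∂μ ≤ ∫ ω, H ω * g (M.W 0 ω) ∂μ := by
  obtain ⟨-, i2, e⟩ := integral_mul_condExp (M := M) hH hg
  rw [e, ← integral_const_mul]
  refine integral_mono_ae ((integrable_W hg).const_mul _) i2 ?_
  filter_upwards [hc] with ω hω
  exact mul_le_mul_of_nonneg_right hω (h0 _)

theorem integral_u_mul (hs : M.IsRandomSample μ) {g : 𝒲 → ℝ} (hg : g ∈ Linf 𝒲) :
    ∫ ω, M.u 0 ω * g (M.W 0 ω) ∂μ = 0 := by
  obtain ⟨-, -, e⟩ := integral_mul_condExp (M := M) hs.integrable_u hg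
  rw [e]
  refine (integral_congr_ae ?_).trans (integral_zero Ω ℝ)
  filter_upwards [hs.condExp_u] with ω hω
  rw [hω]; simp

/-- The hypothesis on all sequences is used for ℓ(n) = n + 1 at a single n, which fixes a level L; a
larger level only shrinks the tail event. -/
theorem integral_tail_le (hvar : M.CondVarBounded μ) (hui : M.CondUnifIntegrable μ) {ε : ℝ}
    (hε : 0 < ε) : ∃ L : ℝ, 0 < L ∧ ∀ L' ≥ L, ∀ g ∈ Linf 𝒲, (∀ w, 0 ≤ g w) →
      ∫ ω, {ω | L' < |M.u 0 ω|}.indicator (fun ω => M.u 0 ω ^ 2) ω * g (M.W 0 ω) ∂μ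
        ≤ ε * ∫ ω, g (M.W 0 ω) ∂μ := by
  have hu2 : Integrable (fun ω => M.u 0 ω ^ 2) μ := hvar.1.integrable_sq
  have hset : ∀ L : ℝ, MeasurableSet {ω | L < |M.u 0 ω|} := fun L =>
    measurableSet_lt measurable_const (measurable_abs.comp (M.measurable_u 0))
  obtain ⟨n, hn⟩ := (hui (fun n => (n : ℝ) + 1) (fun n => by positivity)
    (fun a b hab => by simpa using hab)
    (tendsto_atTop_add_const_right _ _ tendsto_natCast_atTop_atTop) ε hε).exists
  refine ⟨n + 1, by positivity, fun L' hL' g hg h0 => ?_⟩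
  refine le_trans ?_ (integral_mul_le_of_condExp_le (hu2.indicator (hset _)) hn hg h0)
  refine integral_mono (integral_mul_condExp (hu2.indicator (hset _)) hg).1
    (integral_mul_condExp (hu2.indicator (hset _)) hg).1 fun ω => ?_
  refine mul_le_mul_of_nonneg_right ?_ (h0 _)
  refine Set.indicator_le_indicator_of_subset (fun ω hω => lt_of_le_of_lt hL' hω)
    (fun ω => sq_nonneg _) ω

end Model

end NPIV

/-! ### Hilbert space preliminaries: inner products, projections, compactness. -/

namespace NPIV

section L2

variable {Ω : Type*} [MeasurableSpace Ω] {μ : Measure Ω} [IsProbabilityMeasure μ]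

/-- `toL2` as a linear map. -/
noncomputable def toL2Lin (μ : Measure Ω) [IsProbabilityMeasure μ] {𝒱 : Type*}
    [MeasurableSpace 𝒱] {V : Ω → 𝒱} (hV : Measurable V) : Linf 𝒱 →ₗ[ℝ] L2of μ V where
  toFun := toL2 μ hV
  map_add' _ _ := rfl
  map_smul' _ _ := rfl

theorem toL2Lin_apply {𝒱 : Type*} [MeasurableSpace 𝒱] {V : Ω → 𝒱} (hV : Measurable V)
    (h : Linf 𝒱) : toL2Lin μ hV h = toL2 μ hV h := rfl

theorem coe_toL2_ae {𝒱 : Type*} [MeasurableSpace 𝒱] {V : Ω → 𝒱} (hV : Measurable V) (h : Linf 𝒱) :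
    ((toL2 μ hV h : L2of μ V) : Lp ℝ 2 μ) =ᵐ[μ] fun ω => (h : 𝒱 → ℝ) (V ω) :=
  MemLp.coeFn_toLp (memLp_comp μ hV h)

theorem inner_toL2 {𝒱 𝒱' : Type*} [MeasurableSpace 𝒱] [MeasurableSpace 𝒱'] {V : Ω → 𝒱}
    {V' : Ω → 𝒱'} (hV : Measurable V) (hV' : Measurable V') (g : Linf 𝒱) (h : Linf 𝒱') :
    inner ℝ ((toL2 μ hV g : L2of μ V) : Lp ℝ 2 μ) ((toL2 μ hV' h : L2of μ V') : Lp ℝ 2 μ)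
      = ∫ ω, (g : 𝒱 → ℝ) (V ω) * (h : 𝒱' → ℝ) (V' ω) ∂μ := by
  rw [L2.inner_def]
  refine integral_congr_ae ?_
  filter_upwards [coe_toL2_ae hV g, coe_toL2_ae hV' h] with ω h1 h2
  rw [h1, h2]
  simp [mul_comm]

theorem norm_toL2_sq {𝒱 : Type*} [MeasurableSpace 𝒱] {V : Ω → 𝒱} (hV : Measurable V) (h : Linf 𝒱) :
    ‖toL2 μ hV h‖ ^ 2 = ∫ ω, (h : 𝒱 → ℝ) (V ω) ^ 2 ∂μ := by
  rw [← real_inner_self_eq_norm_sq, Submodule.coe_inner, inner_toL2]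
  simp [pow_two]

/-- The norm of an orthogonal projection onto the span of an orthonormal family. -/
theorem norm_starProjection_sq {E : Type*} [NormedAddCommGroup E] [InnerProductSpace ℝ E]
    {m : ℕ} {e : Fin m → E} (he : Orthonormal ℝ e) {B : Submodule ℝ E}
    [B.HasOrthogonalProjection] (hB : B = Submodule.span ℝ (Set.range e)) (y : E) :
    ‖B.starProjection y‖ ^ 2 = ∑ k, (inner ℝ (e k) y) ^ 2 := by
  have h : B.starProjection y = ∑ k, (inner ℝ (e k) y) • e k := by
    apply Submodule.eq_starProjection_of_mem_of_inner_eq_zero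
    · rw [hB]
      exact Submodule.sum_mem _ fun k _ => Submodule.smul_mem _ _
        (Submodule.subset_span (Set.mem_range_self k))
    · intro w hw
      rw [hB] at hw
      refine Submodule.span_induction (p := fun w _ =>
        inner ℝ (y - ∑ k, (inner ℝ (e k) y) • e k) w = 0) ?_ ?_ ?_ ?_ hw
      · rintro _ ⟨k, rfl⟩
        rw [inner_sub_left, he.inner_left_sum _ (Finset.mem_univ k), real_inner_comm]
        simp
      · simp
      · intro a b _ _ ha hb
        rw [inner_add_right, ha, hb, add_zero]
      · intro c a _ ha
        rw [inner_smul_right, ha, mul_zero]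
  rw [← real_inner_self_eq_norm_sq, h, he.inner_sum]
  simp [pow_two]

/-- An injective operator is bounded below on finite dimensional subspaces. -/
theorem exists_pos_le_norm {E F : Type*} [NormedAddCommGroup E] [NormedSpace ℝ E]
    [NormedAddCommGroup F] [NormedSpace ℝ F] {T : E →L[ℝ] F} (hT : Function.Injective T)
    (P : Submodule ℝ E) [FiniteDimensional ℝ P] :
    ∃ c : ℝ, 0 < c ∧ ∀ h ∈ P, ‖h‖ = 1 → c ≤ ‖T h‖ := by
  by_cases hne : ∃ h ∈ P, ‖h‖ = 1
  · obtain ⟨h₀, hh₀, hh₀'⟩ := hne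
    have : ProperSpace P := FiniteDimensional.proper ℝ _
    have hcont : Continuous fun g : P => ‖T (g : E)‖ :=
      (T.continuous.comp continuous_subtype_val).norm
    obtain ⟨g, hg, hmin⟩ := (isCompact_sphere (0 : P) 1).exists_isMinOn
      ⟨⟨h₀, hh₀⟩, by simpa using hh₀'⟩ hcont.continuousOn
    have hg1 : ‖g‖ = 1 := by simpa using hg
    refine ⟨‖T (g : E)‖, ?_, fun f hf hf1 => hmin (a := ⟨f, hf⟩) (by simpa using hf1)⟩
    rw [norm_pos_iff]
    intro h0
    have h1 : (g : E) = 0 := hT (by rw [h0, map_zero])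
    have h2 : g = 0 := Subtype.ext h1
    rw [h2, norm_zero] at hg1
    exact zero_ne_one hg1
  · push Not at hne
    exact ⟨1, one_pos, fun h hh h1 => absurd h1 (hne h hh)⟩

end L2

/-! ### The weak norm and the measure of ill-posedness in whitened coordinates. -/

namespace Model

variable {Ω 𝒳 𝒲 : Type*} [MeasurableSpace Ω] [MeasurableSpace 𝒳] [MeasurableSpace 𝒲]
  {M : Model Ω 𝒳 𝒲} {μ : Measure Ω} [IsProbabilityMeasure μ]

theorem lin_apply (n : ℕ) (c : Fin (M.J n) → ℝ) (x : 𝒳) :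
    (M.lin n c : 𝒳 → ℝ) x = c ⬝ᵥ M.ψvec n x := by
  simp [lin, ψvec, dotProduct, Finset.sum_apply]

theorem lin_V_apply (n : ℕ) (q : Fin (M.J n) → ℝ) (x : 𝒳) :
    (M.lin n (M.V μ n *ᵥ q) : 𝒳 → ℝ) x = q ⬝ᵥ M.pw μ n x := by
  rw [lin_apply, pw, dotProduct_mulVec_transpose, V_transpose]

/-- The orthonormalized instruments as bounded functions. -/
noncomputable def bwL (M : Model Ω 𝒳 𝒲) (μ : Measure Ω) (n : ℕ) (k : Fin (M.K n)) : Linf 𝒲 :=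
  ∑ l, M.U μ n k l • M.b (M.K n) l

theorem bwL_apply (n : ℕ) (k : Fin (M.K n)) (w : 𝒲) :
    (M.bwL μ n k : 𝒲 → ℝ) w = M.bw μ n w k := by
  simp [bwL, bw, bvec, Matrix.mulVec, dotProduct, Finset.sum_apply]

theorem orthonormal_bwL (h : M.IsRegularSieve μ) (n : ℕ) :
    Orthonormal ℝ (fun k => toL2 μ (M.measurable_W 0) (M.bwL μ n k)) := by
  classical
  rw [orthonormal_iff_ite]
  intro i j
  rw [Submodule.coe_inner, inner_toL2]
  simp only [bwL_apply]
  rw [integral_bw_mul_bw h, Matrix.one_apply]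

/-- The whitening matrix is invertible, so each basis is a linear combination of the other. -/
theorem sieveSpace_eq_span_bwL (h : M.IsRegularSieve μ) (n : ℕ) :
    sieveSpace μ (M.measurable_W 0) (M.b (M.K n))
      = Submodule.span ℝ (Set.range fun k => toL2 μ (M.measurable_W 0) (M.bwL μ n k)) := by
  unfold sieveSpace
  apply le_antisymm
  · rw [Submodule.span_le]
    rintro _ ⟨l, rfl⟩
    have e : M.b (M.K n) l = ∑ k, (M.U μ n)⁻¹ l k • M.bwL μ n k := by
      simp only [bwL, Finset.smul_sum, smul_smul]
      rw [Finset.sum_comm]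
      simp only [← Finset.sum_smul]
      have : ∀ l', ∑ k, (M.U μ n)⁻¹ l k * M.U μ n k l'
          = (1 : Matrix (Fin (M.K n)) (Fin (M.K n)) ℝ) l l' := by
        intro l'
        rw [← Matrix.nonsing_inv_mul _ (isUnit_det_U h n), Matrix.mul_apply]
      simp [this, Matrix.one_apply]
    simp only [SetLike.mem_coe]
    rw [e, ← toL2Lin_apply, map_sum]
    refine Submodule.sum_mem _ fun k _ => ?_
    rw [map_smul]
    exact Submodule.smul_mem _ _ (Submodule.subset_span ⟨k, rfl⟩)
  · rw [Submodule.span_le]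
    rintro _ ⟨k, rfl⟩
    simp only [SetLike.mem_coe]
    rw [← toL2Lin_apply, bwL, map_sum]
    refine Submodule.sum_mem _ fun l _ => ?_
    rw [map_smul]
    exact Submodule.smul_mem _ _ (Submodule.subset_span ⟨l, rfl⟩)

/-- The coordinates of Π_K T h in the orthonormal instruments are E[b_k E[h(X) | W]] = E[b_k h(X)],
that is, the entries of `Sw` applied to q. -/
theorem weakNorm_lin_V (h : M.IsRegularSieve μ) (n : ℕ) (q : Fin (M.J n) → ℝ) :
    M.weakNorm μ n (M.lin n (M.V μ n *ᵥ q)) = vnorm (M.Sw μ n *ᵥ q) := by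
  have h1 : M.weakNorm μ n (M.lin n (M.V μ n *ᵥ q)) ^ 2 = vnorm (M.Sw μ n *ᵥ q) ^ 2 := by
    unfold weakNorm projK
    refine (norm_starProjection_sq (orthonormal_bwL h n) (sieveSpace_eq_span_bwL h n) _).trans ?_
    rw [vnorm_sq']
    refine Finset.sum_congr rfl fun k _ => ?_
    congr 1
    -- T is the orthogonal projection onto L²(W), so it drops out of inner products with functions
    -- of W.
    have e1 : inner ℝ (toL2 μ (M.measurable_W 0) (M.bwL μ n k))
          (M.T μ (toL2 μ (M.measurable_X 0) (M.lin n (M.V μ n *ᵥ q))))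
        = inner ℝ ((toL2 μ (M.measurable_W 0) (M.bwL μ n k) : L2of μ (M.W 0)) : Lp ℝ 2 μ)
          ((toL2 μ (M.measurable_X 0) (M.lin n (M.V μ n *ᵥ q)) : L2of μ (M.X 0)) : Lp ℝ 2 μ) := by
      have : Fact (M.sigmaW 0 ≤ (inferInstance : MeasurableSpace Ω)) :=
        ⟨(M.measurable_W 0).comap_le⟩
      exact Submodule.inner_orthogonalProjectionOnto_eq_of_mem_left
        (K := lpMeas ℝ ℝ (M.sigmaW 0) 2 μ) _ _
    rw [e1, inner_toL2]
    simp only [bwL_apply, lin_V_apply, Matrix.mulVec, dotProduct]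
    simp only [← integral_bw_mul_pw (M := M) (μ := μ) n k, Finset.mul_sum]
    rw [integral_finsetSum]
    · refine Finset.sum_congr rfl fun j _ => ?_
      rw [← integral_mul_const]
      refine integral_congr_ae (Eventually.of_forall fun ω => ?_)
      simp only
      ring
    · intro j _
      refine ((integrable_of_mem_Linf (bw_mul_pw_mem_Linf (μ := μ) n k j)).const_mul (q j)).congr
        (Eventually.of_forall fun ω => ?_)
      simp only
      ring
  exact (pow_left_inj₀ (norm_nonneg _) (vnorm_nonneg _) (by norm_num)).1 h1

theorem norm_toL2_lin_V (h : M.IsRegularSieve μ) (n : ℕ) (q : Fin (M.J n) → ℝ) :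
    ‖toL2 μ (M.measurable_X 0) (M.lin n (M.V μ n *ᵥ q))‖ = vnorm q := by
  have h1 : ‖toL2 μ (M.measurable_X 0) (M.lin n (M.V μ n *ᵥ q))‖ ^ 2 = vnorm q ^ 2 := by
    rw [norm_toL2_sq]
    simp only [lin_V_apply]
    rw [integral_dotProduct_pw_sq h, vnorm_sq]
  exact (pow_left_inj₀ (norm_nonneg _) (vnorm_nonneg _) (by norm_num)).1 h1

theorem toL2_lin_mem (n : ℕ) (c : Fin (M.J n) → ℝ) :
    toL2 μ (M.measurable_X 0) (M.lin n c) ∈ M.ΨJ μ n := by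
  rw [← toL2Lin_apply, lin, map_sum]
  refine Submodule.sum_mem _ fun j _ => ?_
  rw [map_smul]
  exact Submodule.smul_mem _ _ (Submodule.subset_span ⟨j, rfl⟩)

theorem norm_T_le (h : L2of μ (M.X 0)) : ‖M.T μ h‖ ≤ ‖h‖ :=
  norm_condExpL2_le (M.measurable_W 0).comap_le (h : Lp ℝ 2 μ)

theorem ΨJ1_nonempty (h : M.IsRegularSieve μ) {n : ℕ} (hJ : M.J n ≠ 0) :
    (M.ΨJ1 μ n).Nonempty := by
  have : Nonempty (Fin (M.J n)) := ⟨⟨0, Nat.pos_of_ne_zero hJ⟩⟩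
  obtain ⟨j⟩ := this
  refine ⟨toL2 μ (M.measurable_X 0) (M.lin n (M.V μ n *ᵥ Pi.single j 1)), toL2_lin_mem n _, ?_⟩
  rw [norm_toL2_lin_V h, vnorm_eq_sqrt]
  simp

theorem bddBelow_norm_T (n : ℕ) :
    BddBelow (Set.range fun h : M.ΨJ1 μ n => ‖M.T μ (h : L2of μ (M.X 0))‖) :=
  ⟨0, by rintro _ ⟨h, rfl⟩; exact norm_nonneg _⟩

/-- An injective operator attains a positive minimum on the compact unit sphere of the finite
dimensional sieve space. Nonemptiness, from J ≠ 0, avoids the default value of an empty infimum. -/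
theorem iInf_norm_T_pos (h : M.IsRegularSieve μ) (hT : Function.Injective (M.T μ)) {n : ℕ}
    (hJ : M.J n ≠ 0) : 0 < ⨅ h : M.ΨJ1 μ n, ‖M.T μ (h : L2of μ (M.X 0))‖ := by
  obtain ⟨h₀, hh₀, hh₀'⟩ := ΨJ1_nonempty h hJ
  have : FiniteDimensional ℝ (M.ΨJ μ n) :=
    inferInstanceAs (FiniteDimensional ℝ (sieveSpace μ (M.measurable_X 0) (M.ψ (M.J n))))
  obtain ⟨c, hc, hcT⟩ := exists_pos_le_norm hT (M.ΨJ μ n)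
  have : Nonempty (M.ΨJ1 μ n) := ⟨⟨h₀, hh₀, hh₀'⟩⟩
  exact lt_of_lt_of_le hc (le_ciInf fun f => hcT _ f.2.1 f.2.2)

/-- Conditional expectation is a contraction, so the infimum defining τ is at most 1. -/
theorem one_le_τ (h : M.IsRegularSieve μ) (hT : Function.Injective (M.T μ)) {n : ℕ}
    (hJ : M.J n ≠ 0) : 1 ≤ M.τ μ n := by
  have hpos := iInf_norm_T_pos h hT hJ
  obtain ⟨h₀, hh₀⟩ := ΨJ1_nonempty h hJ
  unfold τ
  rw [one_le_div hpos]
  refine (ciInf_le (bddBelow_norm_T n) ⟨h₀, hh₀⟩).trans ?_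
  exact (norm_T_le h₀).trans_eq hh₀.2

/-- The smallest singular value of `Sw` is at least `1 / (2 τ)` when the instruments are
sufficiently informative. -/
theorem le_vnorm_Sw_mulVec (h : M.IsRegularSieve μ) (hT : Function.Injective (M.T μ)) {n : ℕ}
    (hJ : M.J n ≠ 0) (hinstr : M.τ μ n * M.instrErr μ n ≤ 1 / 2) (q : Fin (M.J n) → ℝ) :
    1 / (2 * M.τ μ n) * vnorm q ≤ vnorm (M.Sw μ n *ᵥ q) := by
  have hτ : 0 < M.τ μ n := zero_lt_one.trans_le (one_le_τ h hT hJ)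
  have hinf : (⨅ h : M.ΨJ1 μ n, ‖M.T μ (h : L2of μ (M.X 0))‖) = 1 / M.τ μ n := by
    unfold τ; rw [one_div_one_div]
  have herr : M.instrErr μ n ≤ 1 / (2 * M.τ μ n) := by
    rw [le_div_iff₀ (by positivity)]
    linarith
  -- On the unit sphere |Tg| ≥ 1/τ, and projecting onto the instruments loses at most `instrErr`,
  -- which is at most 1/(2τ).
  have unit : ∀ g ∈ M.ΨJ1 μ n, 1 / (2 * M.τ μ n) ≤ ‖M.projK μ n (M.T μ g)‖ := by
    intro g hg
    have h1 : 1 / M.τ μ n ≤ ‖M.T μ g‖ := by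
      rw [← hinf]; exact ciInf_le (bddBelow_norm_T n) ⟨g, hg⟩
    have h2 : ‖M.projK μ n (M.T μ g) - M.T μ g‖ ≤ M.instrErr μ n := by
      refine le_ciSup (f := fun h : M.ΨJ1 μ n =>
        ‖M.projK μ n (M.T μ (h : L2of μ (M.X 0))) - M.T μ (h : L2of μ (M.X 0))‖) ?_ ⟨g, hg⟩
      -- An upper bound is needed here because an unbounded real supremum would take the default
      -- value 0; the operator norm provides it.
      refine ⟨‖(M.projK μ n).comp (M.T μ) - M.T μ‖, ?_⟩
      rintro _ ⟨f, rfl⟩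
      have := ((M.projK μ n).comp (M.T μ) - M.T μ).le_opNorm (f : L2of μ (M.X 0))
      rwa [f.2.2, mul_one] at this
    have h3 := norm_sub_le (M.projK μ n (M.T μ g)) (M.projK μ n (M.T μ g) - M.T μ g)
    rw [sub_sub_cancel] at h3
    have h4 : 1 / M.τ μ n = 1 / (2 * M.τ μ n) + 1 / (2 * M.τ μ n) := by field_simp; norm_num
    linarith
  rcases (vnorm_nonneg q).eq_or_lt with h0 | h0
  · rw [← h0, mul_zero]; exact vnorm_nonneg _
  · have hmem : toL2 μ (M.measurable_X 0) (M.lin n (M.V μ n *ᵥ ((vnorm q)⁻¹ • q))) ∈ M.ΨJ1 μ n := by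
      refine ⟨toL2_lin_mem n _, ?_⟩
      rw [norm_toL2_lin_V h, vnorm_smul, abs_of_pos (inv_pos.2 h0), inv_mul_cancel₀ h0.ne']
    have h1 := unit _ hmem
    have h2 := weakNorm_lin_V h n ((vnorm q)⁻¹ • q)
    unfold weakNorm at h2
    rw [h2, Matrix.mulVec_smul, vnorm_smul, abs_of_pos (inv_pos.2 h0), inv_mul_eq_div,
      le_div_iff₀ h0] at h1
    exact h1

end Model

end NPIV

/-! ### Population and sample coefficients of the representer. -/

namespace NPIV

namespace Model

variable {Ω 𝒳 𝒲 : Type*} [MeasurableSpace Ω] [MeasurableSpace 𝒳] [MeasurableSpace 𝒲]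
  {M : Model Ω 𝒳 𝒲} {μ : Measure Ω}

/-- The coefficient of the normalized representer in the orthonormalized sieve basis. -/
noncomputable def qpop (M : Model Ω 𝒳 𝒲) (μ : Measure Ω) (n : ℕ) (D : Fin (M.J n) → ℝ) :
    Fin (M.J n) → ℝ :=
  ((M.Sw μ n)ᵀ * (1 : Matrix (Fin (M.K n)) (Fin (M.K n)) ℝ)⁻¹ * M.Sw μ n)⁻¹ *ᵥ (M.V μ n *ᵥ D)

/-- The population coefficient vector in the orthonormalized instrument basis. -/
noncomputable def apop (M : Model Ω 𝒳 𝒲) (μ : Measure Ω) (n : ℕ) (D : Fin (M.J n) → ℝ) :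
    Fin (M.K n) → ℝ := M.Sw μ n *ᵥ M.qpop μ n D

/-- The sample coefficient vector in the orthonormalized instrument basis. -/
noncomputable def ahat (M : Model Ω 𝒳 𝒲) (μ : Measure Ω) (n : ℕ) (ω : Ω) (D : Fin (M.J n) → ℝ) :
    Fin (M.K n) → ℝ := avec (M.V μ n *ᵥ D) (M.Swhat μ n ω) (M.Gwhat μ n ω)

theorem apop_sub (n : ℕ) (D D' : Fin (M.J n) → ℝ) :
    M.apop μ n (D - D') = M.apop μ n D - M.apop μ n D' := by
  simp only [apop, qpop, Matrix.mulVec_sub]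

/-- Equivariance of `avec` with U = G_b^{-1/2} and V = G_ψ^{-1/2}, for which the weighting matrix
becomes the identity. -/
theorem avec_pop (h : M.IsRegularSieve μ) (n : ℕ) (D : Fin (M.J n) → ℝ) :
    avec D (M.S μ n) (M.Gb μ n) = M.U μ n *ᵥ M.apop μ n D := by
  rw [avec_whiten D _ _ (isUnit_det_U h n) (isUnit_det_V h n) (M.U_transpose μ n)
    (M.V_transpose μ n), U_mul_Gb_mul_U h]
  unfold avec
  rw [inv_one, Matrix.one_mulVec, apop, qpop, inv_one]
  rfl

theorem avec_hat (h : M.IsRegularSieve μ) (n : ℕ) (ω : Ω) (D : Fin (M.J n) → ℝ) :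
    avec D (M.Shat n ω) (M.Gbhat n ω) = M.U μ n *ᵥ M.ahat μ n ω D :=
  avec_whiten D _ _ (isUnit_det_U h n) (isUnit_det_V h n) (M.U_transpose μ n) (M.V_transpose μ n)

/-- Identifies `qpop` as the coefficient of the representer in the whitened sieve basis, so that its
weak norm is |Sw q| = |a|. -/
theorem V_mulVec_qpop (h : M.IsRegularSieve μ) (n : ℕ) (D : Fin (M.J n) → ℝ) :
    M.V μ n *ᵥ M.qpop μ n D = ((M.S μ n)ᵀ * (M.Gb μ n)⁻¹ * M.S μ n)⁻¹ *ᵥ D := by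
  have h1 := quad_whiten (M.S μ n) (M.Gb μ n) (isUnit_det_U h n) (M.U_transpose μ n)
    (M.V_transpose μ n)
  rw [U_mul_Gb_mul_U h] at h1
  have hV := isUnit_det_V h n
  unfold qpop Sw
  rw [h1, Matrix.mul_inv_rev, Matrix.mul_inv_rev]
  simp only [Matrix.mulVec_mulVec]
  congr 1
  set P := ((M.S μ n)ᵀ * (M.Gb μ n)⁻¹ * M.S μ n)⁻¹
  calc M.V μ n * ((M.V μ n)⁻¹ * (P * (M.V μ n)⁻¹) * M.V μ n)
      = (M.V μ n * (M.V μ n)⁻¹) * P * ((M.V μ n)⁻¹ * M.V μ n) := by simp only [Matrix.mul_assoc]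
    _ = P := by
      rw [Matrix.mul_nonsing_inv _ hV, Matrix.nonsing_inv_mul _ hV, Matrix.one_mul, Matrix.mul_one]

section

variable [IsProbabilityMeasure μ]

theorem weakNorm_lin (h : M.IsRegularSieve μ) (n : ℕ) (D : Fin (M.J n) → ℝ) :
    M.weakNorm μ n (M.lin n (((M.S μ n)ᵀ * (M.Gb μ n)⁻¹ * M.S μ n)⁻¹ *ᵥ D))
      = vnorm (M.apop μ n D) := by
  rw [← V_mulVec_qpop h, weakNorm_lin_V h, apop]

theorem weakNorm_vstar (h : M.IsRegularSieve μ) (f : Linf 𝒳 → ℝ) (n : ℕ) :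
    M.weakNorm μ n (M.vstar μ f n) = vnorm (M.apop μ n (M.Dψ f n M.h₀)) :=
  weakNorm_lin h n _

theorem weakNorm_vhatstar_sub (h : M.IsRegularSieve μ) (f : Linf 𝒳 → ℝ) (n : ℕ) (ω : Ω) :
    M.weakNorm μ n (M.vhatstar μ f n ω - M.vstar μ f n)
      = vnorm (M.apop μ n (M.Dψ f n (M.hhat n ω)) - M.apop μ n (M.Dψ f n M.h₀)) := by
  rw [← apop_sub, ← weakNorm_lin h]
  congr 1
  unfold vhatstar vstar lin
  rw [← Finset.sum_sub_distrib]
  refine Finset.sum_congr rfl fun j _ => ?_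
  rw [Matrix.mulVec_sub]
  exact (sub_smul _ _ _).symm

end

theorem U_mulVec_dotProduct (n : ℕ) (a : Fin (M.K n) → ℝ) (w : 𝒲) :
    (M.U μ n *ᵥ a) ⬝ᵥ M.bvec n w = a ⬝ᵥ M.bw μ n w := by
  rw [bw, dotProduct_mulVec_transpose, U_transpose]

theorem dotProduct_vecMulVec_mulVec {m : ℕ} (v b : Fin m → ℝ) :
    v ⬝ᵥ (Matrix.vecMulVec b b *ᵥ v) = (v ⬝ᵥ b) ^ 2 := by
  rw [Matrix.vecMulVec_mulVec, dotProduct_smul, pow_two, dotProduct_comm b v]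
  simp

theorem Gbhat_transpose (n : ℕ) (ω : Ω) : (M.Gbhat n ω)ᵀ = M.Gbhat n ω := by
  unfold Gbhat
  rw [Matrix.transpose_smul, Matrix.transpose_mul, Matrix.transpose_transpose]

theorem Gb_transpose (h : M.IsRegularSieve μ) (n : ℕ) : (M.Gb μ n)ᵀ = M.Gb μ n := by
  have := (h.posDef_Gb n).1
  rwa [Matrix.IsHermitian, Matrix.conjTranspose_eq_transpose_of_trivial] at this

/-- The estimated sieve variance as an empirical second moment. -/
theorem sandwich_hat (h : M.IsRegularSieve μ) (n : ℕ) (ω : Ω) (D : Fin (M.J n) → ℝ) :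
    sandwich D (M.Shat n ω) (M.Gbhat n ω) (M.Omhat n ω)
      = (n : ℝ)⁻¹ * ∑ i ∈ Finset.range n,
        (M.uhat n ω i * (M.ahat μ n ω D ⬝ᵥ M.bw μ n (M.W i ω))) ^ 2 := by
  rw [sandwich_eq _ _ (Gbhat_transpose n ω), avec_hat h]
  unfold Omhat
  rw [Matrix.smul_mulVec, dotProduct_smul, Matrix.sum_mulVec, dotProduct_sum, smul_eq_mul,
    Finset.sum_range]
  congr 1
  refine Finset.sum_congr rfl fun i _ => ?_
  rw [Matrix.smul_mulVec, dotProduct_smul, dotProduct_vecMulVec_mulVec, U_mulVec_dotProduct,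
    smul_eq_mul, mul_pow]

/-- The 2SLS coefficient in terms of `avec`. -/
theorem dotProduct_tsls {n : ℕ} (hn : n ≠ 0) (ω : Ω) (hG : IsUnit (M.Gbhat n ω).det)
    (hP : IsUnit ((M.Shat n ω)ᵀ * (M.Gbhat n ω)⁻¹ * M.Shat n ω).det) (D : Fin (M.J n) → ℝ)
    (y : Fin n → ℝ) :
    D ⬝ᵥ M.tsls n ω y = avec D (M.Shat n ω) (M.Gbhat n ω) ⬝ᵥ
      ((n : ℝ)⁻¹ • ((M.Bmat n ω)ᵀ *ᵥ y)) := by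
  have hn0 : (n : ℝ) ≠ 0 := by exact_mod_cast hn
  set Ψ := M.Ψmat n ω with hΨ
  set B := M.Bmat n ω with hB
  set G := M.Gbhat n ω with hGdef
  set S := M.Shat n ω with hSdef
  have hGt : Gᵀ = G := Gbhat_transpose n ω
  have hBB : Bᵀ * B = (n : ℝ) • G := by
    rw [hGdef, Gbhat, ← hB, smul_smul, mul_inv_cancel₀ hn0, one_smul]
  have hBΨ : Bᵀ * Ψ = (n : ℝ) • S := by
    rw [hSdef, Shat, ← hB, ← hΨ, smul_smul, mul_inv_cancel₀ hn0, one_smul]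
  have hΨB : Ψᵀ * B = (n : ℝ) • Sᵀ := by
    rw [← Matrix.transpose_smul, ← hBΨ, Matrix.transpose_mul, Matrix.transpose_transpose]
  have hdetn : ∀ {m : ℕ} {A : Matrix (Fin m) (Fin m) ℝ}, IsUnit A.det →
      IsUnit ((n : ℝ) • A).det := by
    intro m A hA
    rw [Matrix.det_smul]
    exact (IsUnit.mk0 _ (pow_ne_zero _ hn0)).mul hA
  have hinvn : ∀ {m : ℕ} {A : Matrix (Fin m) (Fin m) ℝ}, IsUnit A.det →
      ((n : ℝ) • A)⁻¹ = (n : ℝ)⁻¹ • A⁻¹ := by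
    intro m A hA
    apply Matrix.inv_eq_right_inv
    rw [Matrix.smul_mul, Matrix.mul_smul, smul_smul, mul_inv_cancel₀ hn0, one_smul,
      Matrix.mul_nonsing_inv _ hA]
  have hherm : ∀ {m : ℕ} {A : Matrix (Fin m) (Fin m) ℝ}, Aᵀ = A → A.IsHermitian := by
    intro m A hA
    rw [Matrix.IsHermitian, Matrix.conjTranspose_eq_transpose_of_trivial, hA]
  -- On the event of invertible moment matrices the pseudo-inverses are inverses, and the powers of
  -- n recombine into a single n⁻¹.
  have e1 : pinv (Bᵀ * B) = (n : ℝ)⁻¹ • G⁻¹ := by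
    rw [hBB, pinv_eq_inv (hherm (by rw [Matrix.transpose_smul, hGt])) (hdetn hG), hinvn hG]
  have hGi : (G⁻¹)ᵀ = G⁻¹ := by rw [Matrix.transpose_nonsing_inv, hGt]
  have e2 : Ψᵀ * B * pinv (Bᵀ * B) = Sᵀ * G⁻¹ := by
    rw [e1, hΨB, Matrix.smul_mul, Matrix.mul_smul, smul_smul, mul_inv_cancel₀ hn0, one_smul]
  have e3 : Ψᵀ * B * pinv (Bᵀ * B) * Bᵀ * Ψ = (n : ℝ) • (Sᵀ * G⁻¹ * S) := by
    rw [e2, Matrix.mul_assoc, hBΨ, Matrix.mul_smul]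
  have hPt : (Sᵀ * G⁻¹ * S)ᵀ = Sᵀ * G⁻¹ * S := by
    simp only [Matrix.transpose_mul, Matrix.transpose_transpose, hGi, Matrix.mul_assoc]
  have e4 : M.tsls n ω y = (n : ℝ)⁻¹ • ((Sᵀ * G⁻¹ * S)⁻¹ *ᵥ (Sᵀ *ᵥ (G⁻¹ *ᵥ (Bᵀ *ᵥ y)))) := by
    unfold tsls
    simp only
    rw [← hΨ, ← hB, e3, e2, pinv_eq_inv (hherm (by rw [Matrix.transpose_smul, hPt])) (hdetn hP),
      hinvn hP, Matrix.smul_mulVec, ← Matrix.mulVec_mulVec, ← Matrix.mulVec_mulVec]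
  rw [e4, dotProduct_smul, dotProduct_smul]
  congr 1
  unfold avec
  have hPi : ((Sᵀ * G⁻¹ * S)⁻¹)ᵀ = (Sᵀ * G⁻¹ * S)⁻¹ := by
    rw [Matrix.transpose_nonsing_inv, hPt]
  rw [dotProduct_mulVec_transpose, hPi, dotProduct_mulVec_transpose, Matrix.transpose_transpose,
    dotProduct_mulVec_transpose, hGi]

theorem isUnit_det_Gbhat {n : ℕ} {ω : Ω}
    (hG : IsUnit (M.Gwhat μ n ω).det) : IsUnit (M.Gbhat n ω).det := by
  unfold Gwhat at hG
  rw [Matrix.det_mul, Matrix.det_mul] at hG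
  exact (IsUnit.mul_iff.1 (IsUnit.mul_iff.1 hG).1).2

theorem isUnit_det_quad_hat (h : M.IsRegularSieve μ) {n : ℕ} {ω : Ω}
    (hP : IsUnit ((M.Swhat μ n ω)ᵀ * (M.Gwhat μ n ω)⁻¹ * M.Swhat μ n ω).det) :
    IsUnit ((M.Shat n ω)ᵀ * (M.Gbhat n ω)⁻¹ * M.Shat n ω).det := by
  unfold Gwhat Swhat at hP
  rw [quad_whiten _ _ (isUnit_det_U h n) (M.U_transpose μ n) (M.V_transpose μ n),
    Matrix.det_mul, Matrix.det_mul] at hP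
  exact (IsUnit.mul_iff.1 (IsUnit.mul_iff.1 hP).1).2

/-- The 2SLS functional as an empirical mean. -/
theorem dotProduct_tsls_eq_empMean (h : M.IsRegularSieve μ) {n : ℕ} (hn : n ≠ 0) {ω : Ω}
    (hG : IsUnit (M.Gwhat μ n ω).det)
    (hP : IsUnit ((M.Swhat μ n ω)ᵀ * (M.Gwhat μ n ω)⁻¹ * M.Swhat μ n ω).det)
    (D : Fin (M.J n) → ℝ) (y : ℝ × 𝒳 × 𝒲 → ℝ) :
    D ⬝ᵥ M.tsls n ω (fun i => y (M.obs i ω))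
      = empMean M.obs n (fun z => y z * (M.ahat μ n ω D ⬝ᵥ M.bw μ n z.2.2)) ω := by
  rw [dotProduct_tsls hn ω (isUnit_det_Gbhat hG) (isUnit_det_quad_hat h hP), avec_hat h,
    dotProduct_smul, dotProduct_mulVec_transpose, Matrix.transpose_transpose, smul_eq_mul]
  unfold empMean
  rw [Finset.sum_range]
  congr 1
  simp only [dotProduct]
  refine Finset.sum_congr rfl fun i _ => ?_
  rw [mul_comm]
  congr 1
  have := M.U_mulVec_dotProduct (μ := μ) n (M.ahat μ n ω D) (M.W i ω)
  rw [dotProduct_comm] at this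
  exact this

end Model

end NPIV

/-! ### Rates for the whitened sample matrices and consistency of the coefficient vector. -/

namespace NPIV

/-- Column by column, so that Frobenius moments follow from moments of the matrix applied to unit
vectors. -/
theorem frob_sq_eq_sum_vnorm_sq {k m : ℕ} (A : Matrix (Fin k) (Fin m) ℝ) :
    frob A ^ 2 = ∑ j, vnorm (A *ᵥ Pi.single j 1) ^ 2 := by
  simp only [frob_sq, vnorm_sq', Matrix.mulVec_single_one, Matrix.col_apply]
  exact Finset.sum_comm

theorem vnorm_single {m : ℕ} (j : Fin m) : vnorm (Pi.single j (1 : ℝ)) = 1 := by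
  rw [vnorm_eq_sqrt]; simp

theorem tendsto_zero_of_sq {α : Type*} {l : Filter α} {f : α → ℝ}
    (h : Tendsto (fun x => f x ^ 2) l (𝓝 0)) : Tendsto f l (𝓝 0) := by
  have := h.sqrt
  simp only [Real.sqrt_sq_eq_abs, Real.sqrt_zero] at this
  exact (tendsto_zero_iff_abs_tendsto_zero _).2 this

namespace Model

variable {Ω 𝒳 𝒲 : Type*} [MeasurableSpace Ω] [MeasurableSpace 𝒳] [MeasurableSpace 𝒲]
  {M : Model Ω 𝒳 𝒲} {μ : Measure Ω} [IsProbabilityMeasure μ]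

theorem obs_bw_mem_Linf (n : ℕ) (k : Fin (M.K n)) :
    (fun z : ℝ × 𝒳 × 𝒲 => M.bw μ n z.2.2 k) ∈ Linf (ℝ × 𝒳 × 𝒲) :=
  comp_mem_Linf (M.bw_mem_Linf μ n k) (measurable_snd.comp measurable_snd)

theorem obs_pw_mem_Linf (n : ℕ) (j : Fin (M.J n)) :
    (fun z : ℝ × 𝒳 × 𝒲 => M.pw μ n z.2.1 j) ∈ Linf (ℝ × 𝒳 × 𝒲) :=
  comp_mem_Linf (M.pw_mem_Linf μ n j) (measurable_fst.comp measurable_snd)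

section Moments

variable (h : M.IsRegularSieve μ) (hs : M.IsRandomSample μ) {n : ℕ} (hn : n ≠ 0)
include hs hn

/-- The total variance of the mean of αβ is at most n⁻¹ E[|α|²β²] ≤ n⁻¹ ζ² E[β²]. Applied to a fixed
vector, a sample moment matrix therefore has error of order ζ/√n, with no factor for the dimension.
-/
theorem integral_vec_empMean_sub_sq_le {k : ℕ} {α : ℝ × 𝒳 × 𝒲 → Fin k → ℝ}
    (hα : ∀ j, (fun z => α z j) ∈ Linf (ℝ × 𝒳 × 𝒲)) {ζ : ℝ} (hζ : ∀ z, vnorm (α z) ≤ ζ)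
    {β : ℝ × 𝒳 × 𝒲 → ℝ} (hβ : β ∈ Linf (ℝ × 𝒳 × 𝒲)) {c : ℝ}
    (hc : ∫ ω, β (M.obs 0 ω) ^ 2 ∂μ ≤ c) :
    Integrable (fun ω => ∑ j, (empMean M.obs n (fun z => α z j * β z) ω
      - ∫ ω, α (M.obs 0 ω) j * β (M.obs 0 ω) ∂μ) ^ 2) μ ∧
    ∫ ω, ∑ j, (empMean M.obs n (fun z => α z j * β z) ω
      - ∫ ω, α (M.obs 0 ω) j * β (M.obs 0 ω) ∂μ) ^ 2 ∂μ ≤ (n : ℝ)⁻¹ * (ζ ^ 2 * c) := by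
  have hm : ∀ j, (fun z => α z j * β z) ∈ Linf (ℝ × 𝒳 × 𝒲) := fun j => mul_mem_Linf (hα j) hβ
  refine integral_sum_empMean_sub_sq_le hs.ident hs.indep hn (fun j => (hm j).1)
    (fun j => memLp_of_mem_Linf (comp_mem_Linf (hm j) (M.measurable_obs 0))) ?_
  have e : ∀ z, ∑ j, (α z j * β z) ^ 2 = vnorm (α z) ^ 2 * β z ^ 2 := by
    intro z
    rw [vnorm_sq', Finset.sum_mul]
    simp only [mul_pow]
  have hβ2 := comp_mem_Linf (sq_mem_Linf hβ) (M.measurable_obs 0)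
  have hsum := comp_mem_Linf (sum_mem_Linf (s := Finset.univ)
    fun j _ => sq_mem_Linf (hm j)) (M.measurable_obs 0)
  have hle : ∫ ω, ∑ j, (α (M.obs 0 ω) j * β (M.obs 0 ω)) ^ 2 ∂μ
      ≤ ∫ ω, ζ ^ 2 * β (M.obs 0 ω) ^ 2 ∂μ := by
    refine integral_mono (integrable_of_mem_Linf hsum)
      ((integrable_of_mem_Linf hβ2).const_mul _) fun ω => ?_
    simp only
    rw [e]
    exact mul_le_mul_of_nonneg_right (pow_le_pow_left₀ (vnorm_nonneg _) (hζ _) 2) (sq_nonneg _)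
  refine hle.trans ?_
  rw [integral_const_mul]
  gcongr

include h

theorem integral_Gwhat_sub_sq_le (v : Fin (M.K n) → ℝ) :
    Integrable (fun ω => vnorm (M.Gwhat μ n ω *ᵥ v - v) ^ 2) μ ∧
    ∫ ω, vnorm (M.Gwhat μ n ω *ᵥ v - v) ^ 2 ∂μ ≤ (n : ℝ)⁻¹ * (M.ζ μ n ^ 2 * vnorm v ^ 2) := by
  have key := integral_vec_empMean_sub_sq_le hs hn (α := fun z => M.bw μ n z.2.2)
    (obs_bw_mem_Linf n) (fun z => M.vnorm_bw_le μ n _) (β := fun z => v ⬝ᵥ M.bw μ n z.2.2)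
    (dotProduct_mem_Linf v (obs_bw_mem_Linf n)) (c := vnorm v ^ 2)
    (by rw [vnorm_sq]; exact (integral_dotProduct_bw_sq h n v).le)
  have e : ∀ k, ∫ ω, M.bw μ n (M.obs 0 ω).2.2 k * (v ⬝ᵥ M.bw μ n (M.obs 0 ω).2.2) ∂μ = v k := by
    intro k
    simp only [dotProduct, Finset.mul_sum]
    have hi : ∀ l, Integrable (fun ω => M.bw μ n (M.W 0 ω) k * M.bw μ n (M.W 0 ω) l) μ :=
      fun l => integrable_W (mul_mem_Linf (M.bw_mem_Linf μ n k) (M.bw_mem_Linf μ n l))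
    have e1 : ∀ ω l, M.bw μ n (M.obs 0 ω).2.2 k * (v l * M.bw μ n (M.obs 0 ω).2.2 l)
        = v l * (M.bw μ n (M.W 0 ω) k * M.bw μ n (M.W 0 ω) l) := fun ω l => by
      simp only [obs]; ring
    simp only [e1]
    rw [integral_finsetSum _ fun l _ => (hi l).const_mul _]
    simp only [integral_const_mul, integral_bw_mul_bw h, Matrix.one_apply]
    simp
  simp only [e, ← Gwhat_mulVec] at key
  simpa only [vnorm_sq', Pi.sub_apply] using key

theorem integral_Swhat_sub_sq_le (q : Fin (M.J n) → ℝ) :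
    Integrable (fun ω => vnorm (M.Swhat μ n ω *ᵥ q - M.Sw μ n *ᵥ q) ^ 2) μ ∧
    ∫ ω, vnorm (M.Swhat μ n ω *ᵥ q - M.Sw μ n *ᵥ q) ^ 2 ∂μ
      ≤ (n : ℝ)⁻¹ * (M.ζ μ n ^ 2 * vnorm q ^ 2) := by
  have key := integral_vec_empMean_sub_sq_le hs hn (α := fun z => M.bw μ n z.2.2)
    (obs_bw_mem_Linf n) (fun z => M.vnorm_bw_le μ n _) (β := fun z => q ⬝ᵥ M.pw μ n z.2.1)
    (dotProduct_mem_Linf q (obs_pw_mem_Linf n)) (c := vnorm q ^ 2)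
    (by rw [vnorm_sq]; exact (integral_dotProduct_pw_sq h n q).le)
  have e : ∀ k, ∫ ω, M.bw μ n (M.obs 0 ω).2.2 k * (q ⬝ᵥ M.pw μ n (M.obs 0 ω).2.1) ∂μ
      = (M.Sw μ n *ᵥ q) k := by
    intro k
    simp only [dotProduct, Matrix.mulVec, Finset.mul_sum]
    have e1 : ∀ ω l, M.bw μ n (M.obs 0 ω).2.2 k * (q l * M.pw μ n (M.obs 0 ω).2.1 l)
        = (M.bw μ n (M.W 0 ω) k * M.pw μ n (M.X 0 ω) l) * q l := fun ω l => by
      simp only [obs]; ring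
    simp only [e1]
    rw [integral_finsetSum _ fun l _ =>
      (integrable_of_mem_Linf (bw_mul_pw_mem_Linf n k l)).mul_const _]
    simp only [integral_mul_const, integral_bw_mul_pw]
  simp only [e, ← Swhat_mulVec] at key
  simpa only [vnorm_sq', Pi.sub_apply] using key

theorem integral_Swhat_transpose_sub_sq_le (v : Fin (M.K n) → ℝ) :
    Integrable (fun ω => vnorm ((M.Swhat μ n ω - M.Sw μ n)ᵀ *ᵥ v) ^ 2) μ ∧
    ∫ ω, vnorm ((M.Swhat μ n ω - M.Sw μ n)ᵀ *ᵥ v) ^ 2 ∂μ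
      ≤ (n : ℝ)⁻¹ * (M.ζ μ n ^ 2 * vnorm v ^ 2) := by
  have key := integral_vec_empMean_sub_sq_le hs hn (α := fun z => M.pw μ n z.2.1)
    (obs_pw_mem_Linf n) (fun z => M.vnorm_pw_le μ n _) (β := fun z => v ⬝ᵥ M.bw μ n z.2.2)
    (dotProduct_mem_Linf v (obs_bw_mem_Linf n)) (c := vnorm v ^ 2)
    (by rw [vnorm_sq]; exact (integral_dotProduct_bw_sq h n v).le)
  have e : ∀ j, ∫ ω, M.pw μ n (M.obs 0 ω).2.1 j * (v ⬝ᵥ M.bw μ n (M.obs 0 ω).2.2) ∂μ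
      = ((M.Sw μ n)ᵀ *ᵥ v) j := by
    intro j
    simp only [dotProduct, Matrix.mulVec, Finset.mul_sum, Matrix.transpose_apply]
    have e1 : ∀ ω l, M.pw μ n (M.obs 0 ω).2.1 j * (v l * M.bw μ n (M.obs 0 ω).2.2 l)
        = (M.bw μ n (M.W 0 ω) l * M.pw μ n (M.X 0 ω) j) * v l := fun ω l => by
      simp only [obs]; ring
    simp only [e1]
    rw [integral_finsetSum _ fun l _ =>
      (integrable_of_mem_Linf (bw_mul_pw_mem_Linf n l j)).mul_const _]
    simp only [integral_mul_const, integral_bw_mul_pw]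
  simp only [e, ← Swhat_transpose_mulVec] at key
  simpa only [vnorm_sq', Matrix.transpose_sub, Matrix.sub_mulVec, Pi.sub_apply] using key

/-- Summing the fixed-vector bound over the K unit vectors costs the factor K. -/
theorem integral_frob_Gwhat_sub_le :
    Integrable (fun ω => frob (M.Gwhat μ n ω - 1) ^ 2) μ ∧
    ∫ ω, frob (M.Gwhat μ n ω - 1) ^ 2 ∂μ ≤ (n : ℝ)⁻¹ * (M.ζ μ n ^ 2 * M.K n) := by
  simp only [frob_sq_eq_sum_vnorm_sq, Matrix.sub_mulVec, Matrix.one_mulVec]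
  have key := fun k : Fin (M.K n) => integral_Gwhat_sub_sq_le h hs hn (Pi.single k 1)
  refine ⟨integrable_finsetSum _ fun k _ => (key k).1, ?_⟩
  rw [integral_finsetSum _ fun k _ => (key k).1]
  refine (Finset.sum_le_sum fun k _ => (key k).2).trans (le_of_eq ?_)
  simp only [vnorm_single, one_pow, mul_one, Finset.sum_const, Finset.card_univ, Fintype.card_fin,
    nsmul_eq_mul]
  ring

theorem integral_frob_Swhat_sub_le :
    Integrable (fun ω => frob (M.Swhat μ n ω - M.Sw μ n) ^ 2) μ ∧
    ∫ ω, frob (M.Swhat μ n ω - M.Sw μ n) ^ 2 ∂μ ≤ (n : ℝ)⁻¹ * (M.ζ μ n ^ 2 * M.K n) := by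
  simp only [frob_sq_eq_sum_vnorm_sq, Matrix.sub_mulVec]
  have key := fun k : Fin (M.J n) => integral_Swhat_sub_sq_le h hs hn (Pi.single k 1)
  refine ⟨integrable_finsetSum _ fun k _ => (key k).1, ?_⟩
  rw [integral_finsetSum _ fun k _ => (key k).1]
  refine (Finset.sum_le_sum fun k _ => (key k).2).trans ?_
  simp only [vnorm_single, one_pow, mul_one, Finset.sum_const, Finset.card_univ, Fintype.card_fin,
    nsmul_eq_mul]
  have hJK : (M.J n : ℝ) ≤ M.K n := by exact_mod_cast h.J_le_K n
  calc (M.J n : ℝ) * ((n : ℝ)⁻¹ * M.ζ μ n ^ 2) ≤ M.K n * ((n : ℝ)⁻¹ * M.ζ μ n ^ 2) := by gcongr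
    _ = _ := by ring

end Moments

/-- The standing conditions on the growth of the sieve: eventually `J ≠ 0` and the instruments are
informative enough, and `τ² ζ² K / n` and `ζ² log n / n` vanish. -/
structure SieveRates (M : Model Ω 𝒳 𝒲) (μ : Measure Ω) [IsProbabilityMeasure μ] : Prop where
  regular : M.IsRegularSieve μ
  injective : Function.Injective (M.T μ)
  J_ne_zero : ∀ᶠ n in atTop, M.J n ≠ 0
  informative : ∀ᶠ n in atTop, M.τ μ n * M.instrErr μ n ≤ 1 / 2
  rate : Tendsto (fun n : ℕ => M.τ μ n ^ 2 * M.ζ μ n ^ 2 * M.K n / n) atTop (𝓝 0)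
  rate_log : Tendsto (fun n : ℕ => M.ζ μ n ^ 2 * Real.log n / n) atTop (𝓝 0)

/-- Both rates come from squaring the hypothesis. For the first, K = O(J) and log n ≥ 1 eventually;
for the second, τ²J ≥ 1. -/
theorem sieveRates_of_rate (h : M.IsRegularSieve μ) (hT : Function.Injective (M.T μ))
    (hJ : ∀ᶠ n in atTop, M.J n ≠ 0)
    (hinstr : Tendsto (fun n => M.τ μ n * M.instrErr μ n) atTop (𝓝 0))
    (hrate : Tendsto (fun n : ℕ => M.τ μ n * M.ζ μ n * Real.sqrt (M.J n * Real.log n / n))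
      atTop (𝓝 0)) : M.SieveRates μ := by
  have hsq : Tendsto (fun n : ℕ => M.τ μ n ^ 2 * M.ζ μ n ^ 2 * (M.J n * Real.log n / n))
      atTop (𝓝 0) := by
    have := hrate.pow 2
    rw [zero_pow two_ne_zero] at this
    refine this.congr' ?_
    filter_upwards [eventually_ge_atTop 1] with n hn
    have : 0 ≤ Real.log n := Real.log_nonneg (by exact_mod_cast hn)
    rw [mul_pow, mul_pow, Real.sq_sqrt (by positivity)]
  refine ⟨h, hT, hJ, ?_, ?_, ?_⟩
  · exact (hinstr.eventually (gt_mem_nhds (show (0 : ℝ) < 1 / 2 by norm_num))).mono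
      fun n hn => hn.le
  · obtain ⟨C, hC⟩ := h.K_isBigO.bound
    have hz : Tendsto (fun n : ℕ => |C| * (M.τ μ n ^ 2 * M.ζ μ n ^ 2 * (M.J n * Real.log n / n)))
        atTop (𝓝 0) := by simpa using hsq.const_mul |C|
    refine tendsto_of_tendsto_of_tendsto_of_le_of_le' tendsto_const_nhds hz
      (Eventually.of_forall fun n => by positivity) ?_
    have hlog : ∀ᶠ n : ℕ in atTop, 1 ≤ Real.log n :=
      (Real.tendsto_log_atTop.comp tendsto_natCast_atTop_atTop).eventually_ge_atTop 1
    filter_upwards [hC, hlog] with n hn hl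
    simp only [Real.norm_natCast] at hn
    have h1 : (M.K n : ℝ) ≤ |C| * M.J n * Real.log n := by
      calc (M.K n : ℝ) ≤ C * M.J n := hn
        _ ≤ |C| * M.J n := by gcongr; exact le_abs_self C
        _ ≤ |C| * M.J n * Real.log n := le_mul_of_one_le_right (by positivity) hl
    calc M.τ μ n ^ 2 * M.ζ μ n ^ 2 * M.K n / n
        ≤ M.τ μ n ^ 2 * M.ζ μ n ^ 2 * (|C| * M.J n * Real.log n) / n := by gcongr
      _ = _ := by ring
  · refine tendsto_of_tendsto_of_tendsto_of_le_of_le' tendsto_const_nhds hsq ?_ ?_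
    · filter_upwards [eventually_ge_atTop 1] with n hn
      have : 0 ≤ Real.log n := Real.log_nonneg (by exact_mod_cast hn)
      positivity
    · filter_upwards [eventually_ge_atTop 1, hJ] with n hn hJn
      have hl : 0 ≤ Real.log n := Real.log_nonneg (by exact_mod_cast hn)
      have h1 := one_le_τ h hT hJn
      have h2 : (1 : ℝ) ≤ M.J n := by exact_mod_cast Nat.one_le_iff_ne_zero.2 hJn
      have h3 : 1 ≤ M.τ μ n ^ 2 * M.J n := by nlinarith
      have h4 : 0 ≤ M.ζ μ n ^ 2 * Real.log n / n := by positivity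
      calc M.ζ μ n ^ 2 * Real.log n / n ≤ (M.τ μ n ^ 2 * M.J n) * (M.ζ μ n ^ 2 * Real.log n / n) :=
            le_mul_of_one_le_left h4 h3
        _ = M.τ μ n ^ 2 * M.ζ μ n ^ 2 * (M.J n * Real.log n / n) := by ring

section Consistency

variable (hR : M.SieveRates μ) (hs : M.IsRandomSample μ)
include hR hs

theorem tendsto_τ_mul_frob_Gwhat :
    Tendsto (fun x : ℕ × Ω => M.τ μ x.1 * frob (M.Gwhat μ x.1 x.2 - 1)) (probFilter μ) (𝓝 0) := by
  let Z : ℕ → Ω → ℝ := fun n ω => (M.τ μ n * frob (M.Gwhat μ n ω - 1)) ^ 2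
  suffices hZ : ∀ᶠ n in atTop, Integrable (Z n) μ ∧
      ∫ ω, Z n ω ∂μ ≤ M.τ μ n ^ 2 * M.ζ μ n ^ 2 * M.K n / n from
    tendsto_zero_of_sq (tendsto_zero_of_integral (Z := Z) (fun n ω => sq_nonneg _) hZ hR.rate)
  filter_upwards [eventually_ne_atTop 0] with n hn
  have key := integral_frob_Gwhat_sub_le hR.regular hs hn
  simp only [Z, mul_pow]
  refine ⟨key.1.const_mul _, ?_⟩
  rw [integral_const_mul]
  calc _ ≤ M.τ μ n ^ 2 * ((n : ℝ)⁻¹ * (M.ζ μ n ^ 2 * M.K n)) := by gcongr; exact key.2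
    _ = _ := by ring

theorem tendsto_τ_mul_frob_Swhat :
    Tendsto (fun x : ℕ × Ω => M.τ μ x.1 * frob (M.Swhat μ x.1 x.2 - M.Sw μ x.1))
      (probFilter μ) (𝓝 0) := by
  apply tendsto_zero_of_sq
  refine tendsto_zero_of_integral
    (Z := fun n ω => (M.τ μ n * frob (M.Swhat μ n ω - M.Sw μ n)) ^ 2)
    (c := fun n => M.τ μ n ^ 2 * M.ζ μ n ^ 2 * M.K n / n) (fun n ω => sq_nonneg _) ?_ hR.rate
  filter_upwards [eventually_ne_atTop 0] with n hn
  have key := integral_frob_Swhat_sub_le hR.regular hs hn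
  simp only [mul_pow]
  refine ⟨key.1.const_mul _, ?_⟩
  rw [integral_const_mul]
  calc _ ≤ M.τ μ n ^ 2 * ((n : ℝ)⁻¹ * (M.ζ μ n ^ 2 * M.K n)) := by gcongr; exact key.2
    _ = _ := by ring

omit hs in
theorem eventually_one_le_τ : ∀ᶠ n in atTop, 1 ≤ M.τ μ n :=
  hR.J_ne_zero.mono fun _ hn => one_le_τ hR.regular hR.injective hn

theorem tendsto_frob_Gwhat :
    Tendsto (fun x : ℕ × Ω => frob (M.Gwhat μ x.1 x.2 - 1)) (probFilter μ) (𝓝 0) := by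
  refine tendsto_of_tendsto_of_tendsto_of_le_of_le' tendsto_const_nhds
    (tendsto_τ_mul_frob_Gwhat hR hs) (Eventually.of_forall fun x => frob_nonneg _) ?_
  filter_upwards [eventually_fst (eventually_one_le_τ hR)] with x hx
  exact le_mul_of_one_le_left (frob_nonneg _) hx

/-- These are exactly the thresholds of the perturbation lemmas with s = 1/(2τ). The error of S must
be compared with 1/τ, hence the factor τ in the preceding limits. -/
theorem eventually_wellPosed : ∀ᶠ x : ℕ × Ω in probFilter μ,
    frob (M.Gwhat μ x.1 x.2 - 1) ≤ 1 / 2 ∧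
      frob (M.Swhat μ x.1 x.2 - M.Sw μ x.1) ≤ 1 / (2 * M.τ μ x.1) / 2 := by
  filter_upwards [(tendsto_frob_Gwhat hR hs).eventually
      (gt_mem_nhds (show (0 : ℝ) < 1 / 2 by norm_num)),
    (tendsto_τ_mul_frob_Swhat hR hs).eventually (gt_mem_nhds (show (0 : ℝ) < 1 / 4 by norm_num)),
    eventually_fst (eventually_one_le_τ hR)] with x h1 h2 h3
  refine ⟨h1.le, ?_⟩
  rw [div_div, le_div_iff₀ (by positivity)]
  linarith

omit hs in
-- The invertibility part of the perturbation theory, applied with no perturbation and G = 1, shows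
-- that `qpop` solves its normal equations. The bound is the lower singular value estimate at q.
theorem pop_facts : ∀ᶠ n in atTop, ∀ D : Fin (M.J n) → ℝ,
    (M.Sw μ n)ᵀ *ᵥ M.apop μ n D = M.V μ n *ᵥ D ∧
      vnorm (M.qpop μ n D) ≤ 2 * M.τ μ n * vnorm (M.apop μ n D) := by
  filter_upwards [hR.J_ne_zero, hR.informative, eventually_one_le_τ hR] with n hJ hi hτ D
  have hlow := le_vnorm_Sw_mulVec hR.regular hR.injective hJ hi
  have hs : 0 < 1 / (2 * M.τ μ n) := by positivity
  have h1 : frob ((1 : Matrix (Fin (M.K n)) (Fin (M.K n)) ℝ) - 1) ≤ 1 / 2 := by simp [frob]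
  have h2 : frob (M.Sw μ n - M.Sw μ n) ≤ 1 / (2 * M.τ μ n) / 2 := by
    simp [frob]; positivity
  have hu := isUnit_det_quad h1 hs hlow h2
  constructor
  · have e : (M.Sw μ n)ᵀ *ᵥ M.apop μ n D
        = ((M.Sw μ n)ᵀ * (1 : Matrix (Fin (M.K n)) (Fin (M.K n)) ℝ)⁻¹ * M.Sw μ n)
          *ᵥ M.qpop μ n D := by
      rw [apop, Matrix.mulVec_mulVec, inv_one, Matrix.mul_one]
    rw [e, qpop, Matrix.mulVec_mulVec, Matrix.mul_nonsing_inv _ hu, Matrix.one_mulVec]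
  · have := hlow (M.qpop μ n D)
    rw [one_div_mul_eq_div, div_le_iff₀ (by positivity)] at this
    unfold apop
    linarith

theorem eventually_isUnit : ∀ᶠ x : ℕ × Ω in probFilter μ,
    IsUnit (M.Gwhat μ x.1 x.2).det ∧
    IsUnit ((M.Swhat μ x.1 x.2)ᵀ * (M.Gwhat μ x.1 x.2)⁻¹ * M.Swhat μ x.1 x.2).det := by
  filter_upwards [eventually_wellPosed hR hs, eventually_fst hR.J_ne_zero,
    eventually_fst hR.informative, eventually_fst (eventually_one_le_τ hR)] with x ⟨h1, h2⟩ hJ hi hτ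
  exact ⟨isUnit_det_of_frob_le h1, isUnit_det_quad h1 (by positivity)
    (le_vnorm_Sw_mulVec hR.regular hR.injective hJ hi) h2⟩

/-- The perturbation bound with s = 1/(2τ), where 18/s = 36τ. The vector ξ is split into the error
of Ĝ_b at a and the error of Ŝ at q. -/
theorem eventually_vnorm_ahat_sub_le : ∀ᶠ x : ℕ × Ω in probFilter μ, ∀ D : Fin (M.J x.1) → ℝ,
    vnorm (M.ahat μ x.1 x.2 D - M.apop μ x.1 D) ≤
      36 * (M.τ μ x.1 * vnorm ((M.Swhat μ x.1 x.2 - M.Sw μ x.1)ᵀ *ᵥ M.apop μ x.1 D)) +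
      20 * vnorm (M.Gwhat μ x.1 x.2 *ᵥ M.apop μ x.1 D - M.apop μ x.1 D) +
      20 * vnorm (M.Swhat μ x.1 x.2 *ᵥ M.qpop μ x.1 D - M.Sw μ x.1 *ᵥ M.qpop μ x.1 D) := by
  filter_upwards [eventually_wellPosed hR hs, eventually_fst hR.J_ne_zero,
    eventually_fst hR.informative, eventually_fst (eventually_one_le_τ hR),
    eventually_fst (pop_facts hR)] with x ⟨h1, h2⟩ hJ hi hτ hpop D
  have key := vnorm_avec_sub_le h1 (show 0 < 1 / (2 * M.τ μ x.1) by positivity)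
    (le_vnorm_Sw_mulVec hR.regular hR.injective hJ hi) h2 (M.qpop μ x.1 D)
  have e : M.Sw μ x.1 *ᵥ M.qpop μ x.1 D = M.apop μ x.1 D := rfl
  rw [e, (hpop D).1] at key
  rw [e]
  have e2 : (18 : ℝ) / (1 / (2 * M.τ μ x.1)) = 36 * M.τ μ x.1 := by field_simp; norm_num
  rw [e2] at key
  have h3 := vnorm_sub_le (M.Gwhat μ x.1 x.2 *ᵥ M.apop μ x.1 D - M.apop μ x.1 D)
    (M.Swhat μ x.1 x.2 *ᵥ M.qpop μ x.1 D - M.apop μ x.1 D)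
  rw [sub_sub_sub_cancel_right] at h3
  have e3 : M.ahat μ x.1 x.2 D = avec (M.V μ x.1 *ᵥ D) (M.Swhat μ x.1 x.2) (M.Gwhat μ x.1 x.2) := rfl
  rw [e3]
  linarith

/-- `â` is close to its population counterpart, uniformly over directions. -/
theorem eventually_vnorm_ahat_sub_le_mul {ε : ℝ} (hε : 0 < ε) : ∀ᶠ x : ℕ × Ω in probFilter μ,
    ∀ D : Fin (M.J x.1) → ℝ,
    vnorm (M.ahat μ x.1 x.2 D - M.apop μ x.1 D) ≤ ε * vnorm (M.apop μ x.1 D) := by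
  -- The constant is 76 = 36 + 20·2: the second contribution comes from |q| ≤ 2τ|a|.
  have hlim : Tendsto (fun x : ℕ × Ω =>
      76 * (M.τ μ x.1 * frob (M.Swhat μ x.1 x.2 - M.Sw μ x.1)) +
      20 * frob (M.Gwhat μ x.1 x.2 - 1)) (probFilter μ) (𝓝 0) := by
    simpa using ((tendsto_τ_mul_frob_Swhat hR hs).const_mul 76).add
      ((tendsto_frob_Gwhat hR hs).const_mul 20)
  filter_upwards [eventually_vnorm_ahat_sub_le hR hs, hlim.eventually (gt_mem_nhds hε),
    eventually_fst (pop_facts hR), eventually_fst (eventually_one_le_τ hR)] with x h1 h2 h3 hτ D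
  refine (h1 D).trans ?_
  have ha := vnorm_nonneg (M.apop μ x.1 D)
  have i1 := vnorm_mulVec_le (M.Swhat μ x.1 x.2 - M.Sw μ x.1)ᵀ (M.apop μ x.1 D)
  rw [frob_transpose] at i1
  have i2 := vnorm_mulVec_le (M.Gwhat μ x.1 x.2 - 1) (M.apop μ x.1 D)
  rw [Matrix.sub_mulVec, Matrix.one_mulVec] at i2
  have i3 := vnorm_mulVec_le (M.Swhat μ x.1 x.2 - M.Sw μ x.1) (M.qpop μ x.1 D)
  rw [Matrix.sub_mulVec] at i3
  have i4 := mul_le_mul_of_nonneg_left (h3 D).2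
    (frob_nonneg (M.Swhat μ x.1 x.2 - M.Sw μ x.1))
  have i5 := mul_le_mul_of_nonneg_left i1 (zero_le_one.trans hτ)
  have i6 := mul_le_mul_of_nonneg_right h2.le ha
  nlinarith

/-- The rate at which `â` approaches its population counterpart in a fixed direction. -/
theorem tendsto_sqrt_K_mul_vnorm_ahat_sub {D : (n : ℕ) → Fin (M.J n) → ℝ}
    (hD : ∀ᶠ n in atTop, vnorm (M.apop μ n (D n)) ≠ 0) :
    Tendsto (fun x : ℕ × Ω => Real.sqrt (M.K x.1) *
      vnorm (M.ahat μ x.1 x.2 (D x.1) - M.apop μ x.1 (D x.1)) / vnorm (M.apop μ x.1 (D x.1)))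
      (probFilter μ) (𝓝 0) := by
  set a : (n : ℕ) → Fin (M.K n) → ℝ := fun n => M.apop μ n (D n) with ha
  set q : (n : ℕ) → Fin (M.J n) → ℝ := fun n => M.qpop μ n (D n) with hq
  have hsqK : ∀ n, Real.sqrt (M.K n) ^ 2 = M.K n := fun n => Real.sq_sqrt (by positivity)
  -- Here D is deterministic, so the three errors can be bounded in mean square along fixed vectors.
  -- The factor K then comes only from the weight √K; Frobenius bounds would cost a second factor K.
  have t1 : Tendsto (fun x : ℕ × Ω => Real.sqrt (M.K x.1) / vnorm (a x.1) *
      (M.τ μ x.1 * vnorm ((M.Swhat μ x.1 x.2 - M.Sw μ x.1)ᵀ *ᵥ a x.1))) (probFilter μ) (𝓝 0) := by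
    apply tendsto_zero_of_sq
    refine tendsto_zero_of_integral (Z := fun n ω => (Real.sqrt (M.K n) / vnorm (a n) *
      (M.τ μ n * vnorm ((M.Swhat μ n ω - M.Sw μ n)ᵀ *ᵥ a n))) ^ 2) (fun n ω => sq_nonneg _) ?_
      hR.rate
    filter_upwards [eventually_ne_atTop 0, hD] with n hn hDn
    have key := integral_Swhat_transpose_sub_sq_le hR.regular hs hn (a n)
    have hpos : 0 < vnorm (a n) := lt_of_le_of_ne (vnorm_nonneg _) (Ne.symm hDn)
    simp only [mul_pow, ← mul_assoc]
    refine ⟨key.1.const_mul _, ?_⟩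
    rw [integral_const_mul, div_pow, hsqK]
    calc _ ≤ (M.K n : ℝ) / vnorm (a n) ^ 2 * M.τ μ n ^ 2 *
            ((n : ℝ)⁻¹ * (M.ζ μ n ^ 2 * vnorm (a n) ^ 2)) := by gcongr; exact key.2
      _ = _ := by field_simp
  have t2 : Tendsto (fun x : ℕ × Ω => Real.sqrt (M.K x.1) / vnorm (a x.1) *
      vnorm (M.Gwhat μ x.1 x.2 *ᵥ a x.1 - a x.1)) (probFilter μ) (𝓝 0) := by
    apply tendsto_zero_of_sq
    refine tendsto_zero_of_integral (Z := fun n ω => (Real.sqrt (M.K n) / vnorm (a n) *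
      vnorm (M.Gwhat μ n ω *ᵥ a n - a n)) ^ 2) (fun n ω => sq_nonneg _) ?_ hR.rate
    filter_upwards [eventually_ne_atTop 0, hD, eventually_one_le_τ hR] with n hn hDn hτ
    have key := integral_Gwhat_sub_sq_le hR.regular hs hn (a n)
    have hpos : 0 < vnorm (a n) := lt_of_le_of_ne (vnorm_nonneg _) (Ne.symm hDn)
    simp only [mul_pow]
    refine ⟨key.1.const_mul _, ?_⟩
    rw [integral_const_mul, div_pow, hsqK]
    calc _ ≤ (M.K n : ℝ) / vnorm (a n) ^ 2 *
            ((n : ℝ)⁻¹ * (M.ζ μ n ^ 2 * vnorm (a n) ^ 2)) := by gcongr; exact key.2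
      _ = 1 * (M.ζ μ n ^ 2 * M.K n / n) := by field_simp
      _ ≤ M.τ μ n ^ 2 * (M.ζ μ n ^ 2 * M.K n / n) := by
        gcongr; exact one_le_pow₀ hτ
      _ = _ := by ring
  have t3 : Tendsto (fun x : ℕ × Ω => Real.sqrt (M.K x.1) / vnorm (a x.1) *
      vnorm (M.Swhat μ x.1 x.2 *ᵥ q x.1 - M.Sw μ x.1 *ᵥ q x.1)) (probFilter μ) (𝓝 0) := by
    apply tendsto_zero_of_sq
    have hr4 := hR.rate.const_mul 4
    rw [mul_zero] at hr4
    refine tendsto_zero_of_integral (Z := fun n ω => (Real.sqrt (M.K n) / vnorm (a n) *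
      vnorm (M.Swhat μ n ω *ᵥ q n - M.Sw μ n *ᵥ q n)) ^ 2) (fun n ω => sq_nonneg _) ?_ hr4
    filter_upwards [eventually_ne_atTop 0, hD, pop_facts hR] with n hn hDn hpop
    have key := integral_Swhat_sub_sq_le hR.regular hs hn (q n)
    have hpos : 0 < vnorm (a n) := lt_of_le_of_ne (vnorm_nonneg _) (Ne.symm hDn)
    have hq2 : vnorm (q n) ^ 2 ≤ (2 * M.τ μ n * vnorm (a n)) ^ 2 :=
      pow_le_pow_left₀ (vnorm_nonneg _) (hpop (D n)).2 2
    simp only [mul_pow]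
    refine ⟨key.1.const_mul _, ?_⟩
    rw [integral_const_mul, div_pow, hsqK]
    calc _ ≤ (M.K n : ℝ) / vnorm (a n) ^ 2 *
            ((n : ℝ)⁻¹ * (M.ζ μ n ^ 2 * (2 * M.τ μ n * vnorm (a n)) ^ 2)) := by
          gcongr; exact key.2.trans (by gcongr)
      _ = _ := by field_simp; ring
  have hsum := ((t1.const_mul 36).add (t2.const_mul 20)).add (t3.const_mul 20)
  simp only [mul_zero, add_zero] at hsum
  refine tendsto_of_tendsto_of_tendsto_of_le_of_le' tendsto_const_nhds hsum
    (Eventually.of_forall fun x => div_nonneg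
      (mul_nonneg (Real.sqrt_nonneg _) (vnorm_nonneg _)) (vnorm_nonneg _)) ?_
  filter_upwards [eventually_vnorm_ahat_sub_le hR hs] with x hx
  have h1 := mul_le_mul_of_nonneg_left (hx (D x.1))
    (show 0 ≤ Real.sqrt (M.K x.1) / vnorm (a x.1) from
      div_nonneg (Real.sqrt_nonneg _) (vnorm_nonneg _))
  rw [mul_div_right_comm]
  refine h1.trans (le_of_eq ?_)
  ring

end Consistency

end Model

end NPIV

/-! ### The sieve variance and the score. -/

namespace NPIV

theorem dotProduct_integral_mulVec {Ω : Type*} [MeasurableSpace Ω] {μ : Measure Ω} {m : ℕ}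
    {x : Ω → Fin m → ℝ} {w : Ω → ℝ}
    (hi : ∀ k l, Integrable (fun ω => w ω * (x ω k * x ω l)) μ) (v : Fin m → ℝ) :
    v ⬝ᵥ ((Matrix.of fun k l => ∫ ω, w ω * (x ω k * x ω l) ∂μ) *ᵥ v)
      = ∫ ω, w ω * (v ⬝ᵥ x ω) ^ 2 ∂μ := by
  have e : ∀ ω, w ω * (v ⬝ᵥ x ω) ^ 2
      = ∑ k, ∑ l, v k * v l * (w ω * (x ω k * x ω l)) := by
    intro ω
    rw [sq, dotProduct, Finset.sum_mul_sum, Finset.mul_sum]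
    refine Finset.sum_congr rfl fun k _ => ?_
    rw [Finset.mul_sum]
    exact Finset.sum_congr rfl fun l _ => by ring
  simp only [e]
  rw [integral_finsetSum _ fun k _ => integrable_finsetSum _ fun l _ => (hi k l).const_mul _]
  refine Finset.sum_congr rfl fun k _ => ?_
  rw [integral_finsetSum _ fun l _ => (hi k l).const_mul _, Matrix.mulVec, dotProduct,
    Finset.mul_sum]
  refine Finset.sum_congr rfl fun l _ => ?_
  rw [integral_const_mul, Matrix.of_apply]
  ring

namespace Model

variable {Ω 𝒳 𝒲 : Type*} [MeasurableSpace Ω] [MeasurableSpace 𝒳] [MeasurableSpace 𝒲]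
  {M : Model Ω 𝒳 𝒲} {μ : Measure Ω} [IsProbabilityMeasure μ]

/-- The whitened coefficient of the sieve Riesz representer `v_n^*`. -/
noncomputable def astar (M : Model Ω 𝒳 𝒲) (μ : Measure Ω) (f : Linf 𝒳 → ℝ) (n : ℕ) :
    Fin (M.K n) → ℝ := M.apop μ n (M.Dψ f n M.h₀)

section Variance

theorem ident_obs (hs : M.IsRandomSample μ) (i : ℕ) : IdentDistrib (M.obs i) (M.obs 0) μ μ :=
  hs.ident i

theorem iIndepFun_obs (hs : M.IsRandomSample μ) : iIndepFun M.obs μ := hs.indep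

theorem dotProduct_bw_mem_Linf (n : ℕ) (v : Fin (M.K n) → ℝ) :
    (fun w => v ⬝ᵥ M.bw μ n w) ∈ Linf 𝒲 := dotProduct_mem_Linf v (M.bw_mem_Linf μ n)

theorem dotProduct_bw_sq_mem_Linf (n : ℕ) (v : Fin (M.K n) → ℝ) :
    (fun w => (v ⬝ᵥ M.bw μ n w) ^ 2) ∈ Linf 𝒲 := sq_mem_Linf (dotProduct_bw_mem_Linf n v)

theorem abs_dotProduct_bw_le (n : ℕ) (v : Fin (M.K n) → ℝ) (w : 𝒲) :
    |v ⬝ᵥ M.bw μ n w| ≤ vnorm v * M.ζ μ n :=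
  (abs_dotProduct_le _ _).trans
    (mul_le_mul_of_nonneg_left (M.vnorm_bw_le μ n w) (vnorm_nonneg _))

variable (h : M.IsRegularSieve μ) (hvar : M.CondVarBounded μ)
include hvar

theorem integrable_u_sq_mul {g : 𝒲 → ℝ} (hg : g ∈ Linf 𝒲) :
    Integrable (fun ω => M.u 0 ω ^ 2 * g (M.W 0 ω)) μ :=
  (integral_mul_condExp hvar.1.integrable_sq hg).1

theorem memLp_u_mul {g : 𝒲 → ℝ} (hg : g ∈ Linf 𝒲) :
    MemLp (fun ω => M.u 0 ω * g (M.W 0 ω)) 2 μ := by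
  rw [memLp_two_iff_integrable_sq]
  · simp only [mul_pow]
    exact integrable_u_sq_mul hvar (sq_mem_Linf hg)
  · exact ((M.measurable_u 0).mul (hg.1.comp (M.measurable_W 0))).aestronglyMeasurable

include h

theorem sandwich_pop (n : ℕ) (D : Fin (M.J n) → ℝ) :
    sandwich D (M.S μ n) (M.Gb μ n) (M.Om μ n)
      = ∫ ω, M.u 0 ω ^ 2 * (M.apop μ n D ⬝ᵥ M.bw μ n (M.W 0 ω)) ^ 2 ∂μ := by
  rw [sandwich_eq D _ (Gb_transpose h n), avec_pop h, Om, dotProduct_integral_mulVec]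
  · simp only [U_mulVec_dotProduct]
  · exact fun k l => integrable_u_sq_mul hvar
      (mul_mem_Linf (M.bvec_mem_Linf n k) (M.bvec_mem_Linf n l))

theorem sd_sq (f : Linf 𝒳 → ℝ) (n : ℕ) : M.sd μ f n ^ 2
    = ∫ ω, M.u 0 ω ^ 2 * (M.astar μ f n ⬝ᵥ M.bw μ n (M.W 0 ω)) ^ 2 ∂μ := by
  rw [sd, sandwich_pop h hvar, Real.sq_sqrt (integral_nonneg fun ω => by positivity), astar]

/-- Since E[(v'b)²] = |v|², the bound on the conditional variance bounds the whitened matrix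
E[u²bb'] uniformly in the dimension. -/
theorem exists_integral_u_sq_le : ∃ C : ℝ, 0 ≤ C ∧ ∀ n (v : Fin (M.K n) → ℝ),
    ∫ ω, M.u 0 ω ^ 2 * (v ⬝ᵥ M.bw μ n (M.W 0 ω)) ^ 2 ∂μ ≤ C * vnorm v ^ 2 := by
  obtain ⟨C, hC⟩ := hvar.2
  refine ⟨|C|, abs_nonneg C, fun n v => ?_⟩
  have := integral_mul_le_of_condExp_le hvar.1.integrable_sq
    (hC.mono fun ω hω => hω.trans (le_abs_self C)) (dotProduct_bw_sq_mem_Linf (μ := μ) n v)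
    fun w => sq_nonneg _
  rwa [integral_dotProduct_bw_sq h, ← vnorm_sq] at this

theorem exists_le_integral_u_sq (hlow : M.CondVarBddBelow μ) : ∃ c : ℝ, 0 < c ∧
    ∀ n (v : Fin (M.K n) → ℝ),
      c ^ 2 * vnorm v ^ 2 ≤ ∫ ω, M.u 0 ω ^ 2 * (v ⬝ᵥ M.bw μ n (M.W 0 ω)) ^ 2 ∂μ := by
  obtain ⟨c, hc, hc'⟩ := hlow
  refine ⟨Real.sqrt c, Real.sqrt_pos.2 hc, fun n v => ?_⟩
  have := le_integral_mul_of_le_condExp hvar.1.integrable_sq hc'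
    (dotProduct_bw_sq_mem_Linf (μ := μ) n v)
    fun w => sq_nonneg _
  rwa [integral_dotProduct_bw_sq h, ← vnorm_sq, ← Real.sq_sqrt hc.le] at this

/-- Allows errors normalised by the weak norm |a| to be renormalised by the standard deviation. -/
theorem exists_mul_vnorm_astar_le_sd (hlow : M.CondVarBddBelow μ) (f : Linf 𝒳 → ℝ) :
    ∃ c : ℝ, 0 < c ∧ ∀ n, c * vnorm (M.astar μ f n) ≤ M.sd μ f n := by
  obtain ⟨c, hc, hle⟩ := exists_le_integral_u_sq h hvar hlow
  refine ⟨c, hc, fun n => ?_⟩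
  have := hle n (M.astar μ f n)
  rw [← sd_sq h hvar, ← mul_pow] at this
  exact (sq_le_sq₀ (mul_nonneg hc.le (vnorm_nonneg _)) (Real.sqrt_nonneg _)).1 this

end Variance

section Score

/-- The normalised whitened score `n^{-1/2} ∑ u_i G_b^{-1/2} b^K(W_i)`. -/
noncomputable def score (M : Model Ω 𝒳 𝒲) (μ : Measure Ω) (n : ℕ) (ω : Ω) : Fin (M.K n) → ℝ :=
  fun k => Real.sqrt n * empMean M.obs n (fun z => M.res z * M.bw μ n z.2.2 k) ω

theorem dotProduct_score (n : ℕ) (ω : Ω) (v : Fin (M.K n) → ℝ) :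
    v ⬝ᵥ M.score μ n ω
      = Real.sqrt n * empMean M.obs n (fun z => M.res z * (v ⬝ᵥ M.bw μ n z.2.2)) ω := by
  have : ∀ z, M.res z * (v ⬝ᵥ M.bw μ n z.2.2) = ∑ k, (M.res z * M.bw μ n z.2.2 k) * v k := by
    intro z
    rw [dotProduct, Finset.mul_sum]
    exact Finset.sum_congr rfl fun k _ => by ring
  simp only [this]
  rw [← empMean_sum_mul, Finset.mul_sum, dotProduct]
  exact Finset.sum_congr rfl fun k _ => by simp only [score]; ring

/-- Each of the K coordinates is centred with variance at most C. -/
theorem exists_integral_score_sq_le (h : M.IsRegularSieve μ) (hs : M.IsRandomSample μ)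
    (hvar : M.CondVarBounded μ) : ∃ C : ℝ, 0 ≤ C ∧ ∀ n, n ≠ 0 →
      Integrable (fun ω => vnorm (M.score μ n ω) ^ 2) μ ∧
      ∫ ω, vnorm (M.score μ n ω) ^ 2 ∂μ ≤ C * M.K n := by
  obtain ⟨C, hC0, hC⟩ := exists_integral_u_sq_le h hvar
  refine ⟨C, hC0, fun n hn => ?_⟩
  have hbw := M.bw_mem_Linf μ n
  have hb : ∫ ω, ∑ k, (M.u 0 ω * M.bw μ n (M.W 0 ω) k) ^ 2 ∂μ ≤ C * M.K n := by
    have hk : ∀ k, ∫ ω, (M.u 0 ω * M.bw μ n (M.W 0 ω) k) ^ 2 ∂μ ≤ C := by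
      intro k
      have := hC n (Pi.single k 1)
      simpa [vnorm_single, mul_pow] using this
    rw [integral_finsetSum _ fun k _ => (memLp_u_mul hvar (hbw k)).integrable_sq]
    refine (Finset.sum_le_sum fun k _ => hk k).trans ?_
    simp [mul_comm]
  have key := integral_sum_empMean_sub_sq_le (ident_obs hs) (iIndepFun_obs hs) hn
    (g := fun k z => M.res z * M.bw μ n z.2.2 k)
    (fun k => M.measurable_res.mul ((hbw k).1.comp (measurable_snd.comp measurable_snd)))
    (fun k => memLp_u_mul hvar (hbw k)) hb
  have h0 : ∀ k, ∫ ω, M.u 0 ω * M.bw μ n (M.W 0 ω) k ∂μ = 0 :=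
    fun k => integral_u_mul hs (hbw k)
  simp only [show ∀ k, ∫ ω, M.res (M.obs 0 ω) * M.bw μ n (M.obs 0 ω).2.2 k ∂μ = 0 from h0,
    sub_zero] at key
  have e : ∀ ω, vnorm (M.score μ n ω) ^ 2
      = n * ∑ k, (empMean M.obs n (fun z => M.res z * M.bw μ n z.2.2 k) ω) ^ 2 := by
    intro ω
    simp only [vnorm_sq', score, mul_pow, Real.sq_sqrt (Nat.cast_nonneg (α := ℝ) n),
      Finset.mul_sum]
  simp only [e]
  refine ⟨key.1.const_mul _, ?_⟩
  rw [integral_const_mul]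
  have hn' : (n : ℝ) ≠ 0 := Nat.cast_ne_zero.2 hn
  calc _ ≤ (n : ℝ) * ((n : ℝ)⁻¹ * (C * M.K n)) := by gcongr; exact key.2
    _ = _ := by field_simp

end Score

end Model

end NPIV

/-! ### Linearisation and asymptotic normality with the population variance. -/

namespace NPIV

namespace Model

variable {Ω 𝒳 𝒲 : Type*} [MeasurableSpace Ω] [MeasurableSpace 𝒳] [MeasurableSpace 𝒲]
  {M : Model Ω 𝒳 𝒲} {μ : Measure Ω} [IsProbabilityMeasure μ] {f : Linf 𝒳 → ℝ}

theorem lin_sub (n : ℕ) (c c' : Fin (M.J n) → ℝ) : M.lin n c - M.lin n c' = M.lin n (c - c') := by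
  rw [lin, lin, lin, ← Finset.sum_sub_distrib]
  exact Finset.sum_congr rfl fun j _ => (sub_smul _ _ _).symm

theorem tsls_sub (n : ℕ) (ω : Ω) (y y' : Fin n → ℝ) :
    M.tsls n ω y - M.tsls n ω y' = M.tsls n ω (y - y') := by
  simp only [tsls, Matrix.mulVec_sub]

theorem hhat_sub_htilde (n : ℕ) (ω : Ω) :
    M.hhat n ω - M.htilde n ω = M.lin n (M.tsls n ω fun i => M.res (M.obs i ω)) := by
  rw [hhat, htilde, lin_sub, tsls_sub]
  rfl

theorem dirDeriv_of_isLinearMap (hf : IsLinearMap ℝ f) (h g : Linf 𝒳) : dirDeriv f h g = f g := by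
  refine HasDirDeriv.dirDeriv_eq (tendsto_const_nhds.congr' ?_)
  filter_upwards [self_mem_nhdsWithin] with δ (hδ : 0 < δ)
  rw [hf.map_add, hf.map_smul, add_sub_cancel_left, smul_eq_mul, mul_div_cancel_left₀ _ hδ.ne']

/-- Both cases of the theorem reduce to the linear functional `∂f(h₀)/∂h`. -/
theorem exists_linear_approx (h : M.IsRegularSieve μ)
    (hlin : M.LinearCase μ f ∨ M.LinearizableCase μ f) :
    ∃ L : Linf 𝒳 →ₗ[ℝ] ℝ, (∀ g, dirDeriv f M.h₀ g = L g) ∧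
      Tendsto (fun x : ℕ × Ω =>
        Real.sqrt x.1 * (f (M.hhat x.1 x.2) - f M.h₀) / vnorm (M.astar μ f x.1) -
        Real.sqrt x.1 * L (M.hhat x.1 x.2 - M.htilde x.1 x.2) / vnorm (M.astar μ f x.1))
        (probFilter μ) (𝓝 0) := by
  rcases hlin with ⟨hf, ht⟩ | ⟨⟨L, hL⟩, ht⟩
  · refine ⟨hf.mk' f, fun g => dirDeriv_of_isLinearMap hf _ g, ?_⟩
    refine (tendstoInMeasure_iff_probFilter.1 ht).congr fun x => ?_
    rw [weakNorm_vstar h, IsLinearMap.mk'_apply, hf.map_sub, astar]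
    ring
  · refine ⟨L, fun g => (hL g).dirDeriv_eq, ?_⟩
    refine (tendstoInMeasure_iff_probFilter.1 ht).congr fun x => ?_
    rw [weakNorm_vstar h, (hL _).dirDeriv_eq, astar]

theorem linear_lin {L : Linf 𝒳 →ₗ[ℝ] ℝ} (hL : ∀ g, dirDeriv f M.h₀ g = L g) (n : ℕ)
    (c : Fin (M.J n) → ℝ) : L (M.lin n c) = M.Dψ f n M.h₀ ⬝ᵥ c := by
  simp only [lin, map_sum, map_smul, Dψ, hL, dotProduct, smul_eq_mul]
  exact Finset.sum_congr rfl fun j _ => mul_comm _ _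

theorem J_ne_zero_of_vnorm_ne_zero {n : ℕ} (D : Fin (M.J n) → ℝ)
    (hv : vnorm (M.apop μ n D) ≠ 0) : M.J n ≠ 0 := by
  intro hJ
  apply hv
  have : IsEmpty (Fin (M.J n)) := by rw [hJ]; infer_instance
  rw [vnorm_eq_zero, apop, Subsingleton.elim (M.qpop μ n D) 0, Matrix.mulVec_zero]

variable (hR : M.SieveRates μ) (hs : M.IsRandomSample μ) (hvar : M.CondVarBounded μ)
  (hlow : M.CondVarBddBelow μ) (hv : ∀ᶠ n in atTop, vnorm (M.astar μ f n) ≠ 0)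

include hR hs in
-- The difference ĥ - h̃ is the two-stage estimator applied to the residuals, so its image under L
-- is the sample coefficient vector paired with the score whenever the sample matrices are
-- invertible.
theorem eventually_linear_eq {L : Linf 𝒳 →ₗ[ℝ] ℝ} (hL : ∀ g, dirDeriv f M.h₀ g = L g) :
    ∀ᶠ x : ℕ × Ω in probFilter μ,
      Real.sqrt x.1 * L (M.hhat x.1 x.2 - M.htilde x.1 x.2)
        = M.ahat μ x.1 x.2 (M.Dψ f x.1 M.h₀) ⬝ᵥ M.score μ x.1 x.2 := by
  filter_upwards [eventually_isUnit hR hs, eventually_fst (eventually_ne_atTop 0)] with x hx hn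
  rw [hhat_sub_htilde, linear_lin hL, dotProduct_tsls_eq_empMean hR.regular hn hx.1 hx.2,
    dotProduct_score]

include hR in
theorem K_pos_of_ne {n : ℕ} (hJ : M.J n ≠ 0) : (1 : ℝ) ≤ M.K n := by
  exact_mod_cast (Nat.one_le_iff_ne_zero.2 hJ).trans (hR.regular.J_le_K n)

include hR hs hvar hv in
-- By Cauchy–Schwarz the term is at most √K|â - a|/|a|, which vanishes in probability, times
-- |score|/√K, which is bounded in mean square.
theorem tendsto_ahat_sub_dotProduct_score :
    Tendsto (fun x : ℕ × Ω => (M.ahat μ x.1 x.2 (M.Dψ f x.1 M.h₀) - M.astar μ f x.1) ⬝ᵥ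
      M.score μ x.1 x.2 / vnorm (M.astar μ f x.1)) (probFilter μ) (𝓝 0) := by
  obtain ⟨C, hC0, hC⟩ := exists_integral_score_sq_le hR.regular hs hvar
  have hX := tendsto_sqrt_K_mul_vnorm_ahat_sub hR hs (D := fun n => M.Dψ f n M.h₀) hv
  have key := tendsto_mul_of_integral_le (C := 1 + C)
    (X := fun n ω => Real.sqrt (M.K n) * vnorm (M.ahat μ n ω (M.Dψ f n M.h₀) -
      M.apop μ n (M.Dψ f n M.h₀)) / vnorm (M.apop μ n (M.Dψ f n M.h₀)))
    -- Since t ≤ 1 + t², this dominates |score|/√K while having a mean that is directly computable.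
    (Y := fun n ω => 1 + vnorm (M.score μ n ω) ^ 2 / M.K n) hX (fun n ω => by positivity) ?_
  · refine squeeze_zero_norm' ?_ key
    filter_upwards [eventually_fst hR.J_ne_zero] with x hJ
    have hK : 0 < (M.K x.1 : ℝ) := one_pos.trans_le (K_pos_of_ne hR hJ)
    have hsK := Real.sqrt_pos.2 hK
    have h1 : vnorm (M.score μ x.1 x.2)
        ≤ Real.sqrt (M.K x.1) * (1 + vnorm (M.score μ x.1 x.2) ^ 2 / M.K x.1) := by
      set e := vnorm (M.score μ x.1 x.2)
      have : vnorm (M.score μ x.1 x.2) ^ 2 / M.K x.1 = (e / Real.sqrt (M.K x.1)) ^ 2 := by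
        rw [div_pow, Real.sq_sqrt hK.le]
      rw [← div_le_iff₀' hsK, this]
      nlinarith [sq_nonneg (e / Real.sqrt (M.K x.1) - 1)]
    rw [Real.norm_eq_abs, abs_div, abs_of_nonneg (vnorm_nonneg _)]
    calc _ ≤ vnorm (M.ahat μ x.1 x.2 (M.Dψ f x.1 M.h₀) - M.astar μ f x.1) *
          (Real.sqrt (M.K x.1) * (1 + vnorm (M.score μ x.1 x.2) ^ 2 / M.K x.1)) /
            vnorm (M.astar μ f x.1) := by
          refine div_le_div_of_nonneg_right ((abs_dotProduct_le _ _).trans ?_) (vnorm_nonneg _)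
          exact mul_le_mul_of_nonneg_left h1 (vnorm_nonneg _)
      _ = _ := by unfold astar; ring
  · filter_upwards [eventually_ne_atTop 0, hR.J_ne_zero] with n hn hJ
    have hK : 0 < (M.K n : ℝ) := one_pos.trans_le (K_pos_of_ne hR hJ)
    obtain ⟨hi, hle⟩ := hC n hn
    refine ⟨(integrable_const _).add (hi.div_const _), ?_⟩
    rw [integral_add (integrable_const _) (hi.div_const _), integral_div]
    simp only [integral_const, probReal_univ, smul_eq_mul, mul_one]
    gcongr
    rwa [div_le_iff₀ hK]

/-- The summands of the leading term of the `t`-statistic. -/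
noncomputable def lead (M : Model Ω 𝒳 𝒲) (μ : Measure Ω) (f : Linf 𝒳 → ℝ) (n : ℕ)
    (z : ℝ × 𝒳 × 𝒲) : ℝ := M.res z * (M.astar μ f n ⬝ᵥ M.bw μ n z.2.2) / M.sd μ f n

theorem measurable_lead (n : ℕ) : Measurable (M.lead μ f n) :=
  (M.measurable_res.mul ((dotProduct_bw_mem_Linf n _).1.comp
    (measurable_snd.comp measurable_snd))).div_const _

theorem sum_lead (n : ℕ) (ω : Ω) :
    (Real.sqrt n)⁻¹ * ∑ i ∈ Finset.range n, M.lead μ f n (M.obs i ω)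
      = M.astar μ f n ⬝ᵥ M.score μ n ω / M.sd μ f n := by
  rw [dotProduct_score, empMean, ← mul_assoc, mul_div_assoc, Finset.sum_div]
  congr 1
  rcases Nat.eq_zero_or_pos n with rfl | hn
  · simp
  · have : 0 < (n : ℝ) := Nat.cast_pos.2 hn
    rw [← Real.sqrt_div_self, div_eq_mul_inv]

theorem tendsto_sq_div_of_rate (hR : M.SieveRates μ) :
    Tendsto (fun n : ℕ => M.ζ μ n ^ 2 / n) atTop (𝓝 0) := by
  refine squeeze_zero' (Eventually.of_forall fun n => by positivity) ?_ hR.rate_log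
  have hlog : ∀ᶠ n : ℕ in atTop, 1 ≤ Real.log n :=
    (Real.tendsto_log_atTop.comp tendsto_natCast_atTop_atTop).eventually_ge_atTop 1
  filter_upwards [hlog] with n hl
  rw [mul_div_right_comm]
  exact le_mul_of_one_le_right (by positivity) hl

include hR hs hvar hlow hv in
-- Lindeberg's theorem. As |a'b| ≤ |a|ζ and sd ≥ c|a|, a summand can exceed ε√n only if |u| exceeds
-- a multiple of √n/ζ, which tends to infinity; conditional uniform integrability then makes the
-- tail small.
theorem tendsto_lead (hui : M.CondUnifIntegrable μ) : TendstoStdNormal μ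
    (fun n ω => (Real.sqrt n)⁻¹ * ∑ i ∈ Finset.range n, M.lead μ f n (M.obs i ω)) := by
  obtain ⟨c, hc, hsd⟩ := exists_mul_vnorm_astar_le_sd hR.regular hvar hlow f
  have hpos : ∀ᶠ n in atTop, 0 < vnorm (M.astar μ f n) ∧ 0 < M.sd μ f n := by
    filter_upwards [hv] with n hn
    have := lt_of_le_of_ne (vnorm_nonneg _) (Ne.symm hn)
    exact ⟨this, (mul_pos hc this).trans_le (hsd n)⟩
  refine tendsto_stdNormal_of_lindeberg (ident_obs hs) (iIndepFun_obs hs) measurable_lead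
    M.measurable_obs ?_ ?_ ?_ ?_
  · refine Eventually.of_forall fun n => ?_
    have := MemLp.mul_const
      (memLp_u_mul hvar (dotProduct_bw_mem_Linf (μ := μ) n (M.astar μ f n))) (M.sd μ f n)⁻¹
    simp only [← div_eq_mul_inv] at this
    exact this
  · refine Eventually.of_forall fun n => ?_
    have : ∀ ω, M.lead μ f n (M.obs 0 ω)
        = M.u 0 ω * (M.astar μ f n ⬝ᵥ M.bw μ n (M.W 0 ω)) / M.sd μ f n := fun ω => rfl
    simp only [this]
    rw [integral_div, integral_u_mul hs (dotProduct_bw_mem_Linf n (M.astar μ f n)), zero_div]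
  · filter_upwards [hpos] with n hn
    have : ∀ ω, M.lead μ f n (M.obs 0 ω) ^ 2
        = M.u 0 ω ^ 2 * (M.astar μ f n ⬝ᵥ M.bw μ n (M.W 0 ω)) ^ 2 / M.sd μ f n ^ 2 := by
      intro ω
      rw [← mul_pow, ← div_pow]; rfl
    simp only [this]
    rw [integral_div, ← sd_sq hR.regular hvar, div_self (pow_pos hn.2 2).ne']
  · intro ε hε
    rw [Metric.tendsto_nhds]
    intro η hη
    -- The factor c² compensates for dividing by sd² ≥ c²|a|² at the end, leaving η/2.
    obtain ⟨L, hL0, hL⟩ := integral_tail_le hvar hui (show 0 < c ^ 2 * η / 2 by positivity)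
    have hζ : ∀ᶠ n : ℕ in atTop, M.ζ μ n ^ 2 / n < (ε * c / L) ^ 2 :=
      (tendsto_sq_div_of_rate hR).eventually (gt_mem_nhds (by positivity))
    filter_upwards [hpos, hζ, eventually_gt_atTop 0] with n hn hζn hn0
    have hn0' : 0 < (n : ℝ) := Nat.cast_pos.2 hn0
    have hζ' : L * M.ζ μ n ≤ ε * c * Real.sqrt n := by
      rw [div_lt_iff₀ hn0', ← Real.sq_sqrt hn0'.le, ← mul_pow] at hζn
      have := lt_of_pow_lt_pow_left₀ 2 (by positivity) hζn
      have h2 := mul_le_mul_of_nonneg_left this.le hL0.le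
      calc _ ≤ _ := h2
        _ = _ := by field_simp
    set a := M.astar μ f n
    set s := M.sd μ f n
    have hpt : ∀ ω, {ω | ε * Real.sqrt n < |M.lead μ f n (M.obs 0 ω)|}.indicator
          (fun ω => M.lead μ f n (M.obs 0 ω) ^ 2) ω
        ≤ {ω | L < |M.u 0 ω|}.indicator (fun ω => M.u 0 ω ^ 2) ω *
          (a ⬝ᵥ M.bw μ n (M.W 0 ω)) ^ 2 / s ^ 2 := by
      intro ω
      have e : M.lead μ f n (M.obs 0 ω) = M.u 0 ω * (a ⬝ᵥ M.bw μ n (M.W 0 ω)) / s := rfl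
      by_cases hω : ε * Real.sqrt n < |M.lead μ f n (M.obs 0 ω)|
      · have hu : L < |M.u 0 ω| := by
          by_contra hcon
          push Not at hcon
          have h1 : |M.lead μ f n (M.obs 0 ω)| ≤ ε * Real.sqrt n := by
            rw [e, abs_div, abs_mul, abs_of_pos hn.2, div_le_iff₀ hn.2]
            calc _ ≤ L * (vnorm a * M.ζ μ n) := by
                  gcongr; exact abs_dotProduct_bw_le n a _
              _ = (L * M.ζ μ n) * vnorm a := by ring
              _ ≤ (ε * c * Real.sqrt n) * vnorm a := by
                  gcongr; exact vnorm_nonneg _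
              _ = ε * Real.sqrt n * (c * vnorm a) := by ring
              _ ≤ _ := by gcongr; exact hsd n
          linarith
        rw [Set.indicator_of_mem (show ω ∈ {ω | ε * Real.sqrt n < |M.lead μ f n (M.obs 0 ω)|}
            from hω), Set.indicator_of_mem (show ω ∈ {ω | L < |M.u 0 ω|} from hu), e, div_pow,
          mul_pow]
      · rw [Set.indicator_of_notMem (show ω ∉ {ω | ε * Real.sqrt n < |M.lead μ f n (M.obs 0 ω)|}
          from hω)]
        have : 0 ≤ {ω | L < |M.u 0 ω|}.indicator (fun ω => M.u 0 ω ^ 2) ω :=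
          Set.indicator_nonneg (fun ω _ => sq_nonneg _) _
        positivity
    have hint : Integrable (fun ω => {ω | L < |M.u 0 ω|}.indicator (fun ω => M.u 0 ω ^ 2) ω *
          (a ⬝ᵥ M.bw μ n (M.W 0 ω)) ^ 2) μ :=
      (integral_mul_condExp (hvar.1.integrable_sq.indicator
        (measurableSet_lt measurable_const (M.measurable_u 0).abs))
        (dotProduct_bw_sq_mem_Linf n a)).1
    have hnn : ∀ ω, 0 ≤ {ω | ε * Real.sqrt n < |M.lead μ f n (M.obs 0 ω)|}.indicator
          (fun ω => M.lead μ f n (M.obs 0 ω) ^ 2) ω :=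
      fun ω => Set.indicator_nonneg (fun ω _ => sq_nonneg _) _
    rw [Real.dist_0_eq_abs, abs_of_nonneg (integral_nonneg hnn)]
    have hb := hL L le_rfl _ (dotProduct_bw_sq_mem_Linf (μ := μ) n a) fun w => sq_nonneg _
    rw [integral_dotProduct_bw_sq hR.regular, ← vnorm_sq] at hb
    calc _ ≤ ∫ ω, {ω | L < |M.u 0 ω|}.indicator (fun ω => M.u 0 ω ^ 2) ω *
          (a ⬝ᵥ M.bw μ n (M.W 0 ω)) ^ 2 / s ^ 2 ∂μ :=
          integral_mono_of_nonneg (Eventually.of_forall hnn) (hint.div_const _)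
            (Eventually.of_forall hpt)
      _ = (∫ ω, {ω | L < |M.u 0 ω|}.indicator (fun ω => M.u 0 ω ^ 2) ω *
          (a ⬝ᵥ M.bw μ n (M.W 0 ω)) ^ 2 ∂μ) / s ^ 2 := integral_div _ _
      _ ≤ (c ^ 2 * η / 2 * vnorm a ^ 2) / s ^ 2 := by gcongr
      _ ≤ η / 2 := by
          rw [div_le_iff₀ (pow_pos hn.2 2)]
          have := pow_le_pow_left₀ (mul_nonneg hc.le (vnorm_nonneg _)) (hsd n) 2
          nlinarith
      _ < η := half_lt_self hη

include hR hs hvar hlow hv in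
/-- Asymptotic normality with the population sieve variance. -/
theorem tendsto_stdNormal_sd (hui : M.CondUnifIntegrable μ)
    (hlin : M.LinearCase μ f ∨ M.LinearizableCase μ f)
    (hf : ∀ n, AEMeasurable (fun ω => f (M.hhat n ω)) μ) :
    TendstoStdNormal μ
      (fun n ω => Real.sqrt n * (f (M.hhat n ω) - f M.h₀) / M.sd μ f n) := by
  obtain ⟨c, hc, hsd⟩ := exists_mul_vnorm_astar_le_sd hR.regular hvar hlow f
  obtain ⟨L, hL, happ⟩ := exists_linear_approx hR.regular hlin
  refine tendstoInDistribution_of_tendstoInMeasure_sub _ _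
    (tendsto_lead hR hs hvar hlow hv hui) ?_
    fun n => (((hf n).sub_const _).const_mul _).div_const _
  refine tendstoInMeasure_iff_probFilter.2 ?_
  have hsum := (happ.add (tendsto_ahat_sub_dotProduct_score hR hs hvar hv)).abs.const_mul c⁻¹
  simp only [add_zero, abs_zero, mul_zero] at hsum
  refine squeeze_zero_norm' ?_ hsum
  filter_upwards [eventually_linear_eq hR hs hL, eventually_fst hv] with x hx hvx
  have hpos : 0 < vnorm (M.astar μ f x.1) := lt_of_le_of_ne (vnorm_nonneg _) (Ne.symm hvx)
  have hsdx := hsd x.1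
  have hsdpos : 0 < M.sd μ f x.1 := (mul_pos hc hpos).trans_le hsdx
  simp only [Pi.sub_apply]
  rw [sum_lead, hx, sub_dotProduct, Real.norm_eq_abs]
  set A := Real.sqrt x.1 * (f (M.hhat x.1 x.2) - f M.h₀)
  set B := M.ahat μ x.1 x.2 (M.Dψ f x.1 M.h₀) ⬝ᵥ M.score μ x.1 x.2
  set E := M.astar μ f x.1 ⬝ᵥ M.score μ x.1 x.2
  set v := vnorm (M.astar μ f x.1)
  -- The linearisation error and the error of â are both normalised by |a|; the ratio |a|/sd is at
  -- most 1/c.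
  have e1 : A / M.sd μ f x.1 - E / M.sd μ f x.1
      = v / M.sd μ f x.1 * (A / v - B / v + (B - E) / v) := by
    field_simp; ring
  rw [e1, abs_mul, abs_of_pos (div_pos hpos hsdpos)]
  gcongr
  rw [div_le_iff₀ hsdpos, inv_mul_eq_div, le_div_iff₀ hc]
  linarith

end Model

end NPIV

/-! ### Truncated residuals, a weak law, and the largest eigenvalue. -/

namespace NPIV

/-- Used with z = ζ and r = ζ^{(2+δ)/δ} √(log n / n). The level t = z^{2/δ}/√r balances two demands:
t²z² equals rn/log n, small enough for the matrix bound, and z²t^{-δ} = r^{δ/2} makes the tail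
vanish. -/
theorem truncation_level {z r δ : ℝ} (hz : 1 ≤ z) (hδ : 0 < δ) (hr : 0 < r) :
    0 < z ^ (2 / δ) * (Real.sqrt r)⁻¹ ∧
    (z ^ (2 / δ) * (Real.sqrt r)⁻¹) ^ 2 * z ^ 2 = (z ^ ((2 + δ) / δ)) ^ 2 / r ∧
    z ^ 2 * (z ^ (2 / δ) * (Real.sqrt r)⁻¹) ^ (-δ) = r ^ (δ / 2) := by
  have hz0 : 0 < z := one_pos.trans_le hz
  have hs := Real.sqrt_pos.2 hr
  refine ⟨by positivity, ?_, ?_⟩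
  · rw [show (2 + δ) / δ = 2 / δ + 1 by field_simp, Real.rpow_add hz0, Real.rpow_one, mul_pow,
      inv_pow, Real.sq_sqrt hr.le, mul_pow]
    ring
  · rw [Real.mul_rpow (by positivity) (by positivity), ← Real.rpow_mul hz0.le,
      show 2 / δ * -δ = -2 by field_simp, Real.inv_rpow hs.le, Real.rpow_neg hs.le, inv_inv,
      Real.sqrt_eq_rpow, ← Real.rpow_mul hr.le, show 1 / 2 * δ = δ / 2 by ring, ← mul_assoc,
      Real.rpow_neg hz0.le, Real.rpow_two, mul_inv_cancel₀ (by positivity), one_mul]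

/-- The extra factor (|u|/t)^δ is at least 1 beyond the level t. -/
theorem sq_le_rpow_mul {u t δ : ℝ} (ht : 0 < t) (hδ : 0 < δ) (htu : t ≤ |u|) :
    u ^ 2 ≤ |u| ^ (2 + δ) * t ^ (-δ) := by
  have hu : 0 < |u| := ht.trans_le htu
  rw [Real.rpow_add hu, Real.rpow_two, sq_abs, Real.rpow_neg ht.le, mul_assoc]
  refine le_mul_of_one_le_right (sq_nonneg u) ?_
  rw [← div_eq_mul_inv, one_le_div (Real.rpow_pos_of_pos ht δ)]
  exact Real.rpow_le_rpow ht.le htu hδ.le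

namespace Model

variable {Ω 𝒳 𝒲 : Type*} [MeasurableSpace Ω] [MeasurableSpace 𝒳] [MeasurableSpace 𝒲]
  {M : Model Ω 𝒳 𝒲} {μ : Measure Ω} [IsProbabilityMeasure μ] {f : Linf 𝒳 → ℝ}

/-- The part of the residual that exceeds the level `t`. -/
noncomputable def tailRes (M : Model Ω 𝒳 𝒲) (t : ℝ) : ℝ × 𝒳 × 𝒲 → ℝ :=
  {z | t < |M.res z|}.indicator M.res

/-- The residual truncated at the level `t`. -/
noncomputable def truncRes (M : Model Ω 𝒳 𝒲) (t : ℝ) : ℝ × 𝒳 × 𝒲 → ℝ :=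
  {z | t < |M.res z|}ᶜ.indicator M.res

theorem measurableSet_tail (t : ℝ) : MeasurableSet {z | t < |M.res z|} :=
  measurableSet_lt measurable_const M.measurable_res.abs

theorem measurable_tailRes (t : ℝ) : Measurable (M.tailRes t) :=
  M.measurable_res.indicator (measurableSet_tail t)

theorem measurable_truncRes (t : ℝ) : Measurable (M.truncRes t) :=
  M.measurable_res.indicator (measurableSet_tail t).compl

theorem abs_truncRes_le {t : ℝ} (ht : 0 ≤ t) (z : ℝ × 𝒳 × 𝒲) : |M.truncRes t z| ≤ t := by
  by_cases hz : t < |M.res z|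
  · simpa [truncRes, hz] using ht
  · simpa [truncRes, hz] using le_of_not_gt hz

theorem truncRes_sq_le (t : ℝ) (z : ℝ × 𝒳 × 𝒲) : M.truncRes t z ^ 2 ≤ M.res z ^ 2 := by
  by_cases hz : t < |M.res z|
  · simp [truncRes, hz, sq_nonneg]
  · simp [truncRes, hz]

theorem res_sq_eq (t : ℝ) (z : ℝ × 𝒳 × 𝒲) :
    M.res z ^ 2 = M.truncRes t z ^ 2 + M.tailRes t z ^ 2 := by
  by_cases hz : t < |M.res z|
  · simp [truncRes, tailRes, hz]
  · simp [truncRes, tailRes, hz]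

theorem truncRes_mem_Linf {t : ℝ} (ht : 0 ≤ t) : M.truncRes t ∈ Linf (ℝ × 𝒳 × 𝒲) :=
  ⟨measurable_truncRes t, t, abs_truncRes_le ht⟩

theorem tailRes_obs_sq (t : ℝ) (ω : Ω) : M.tailRes t (M.obs 0 ω) ^ 2
    = {ω | t < |M.u 0 ω|}.indicator (fun ω => M.u 0 ω ^ 2) ω := by
  by_cases hz : t < |M.u 0 ω|
  · rw [tailRes, Set.indicator_of_mem (show M.obs 0 ω ∈ {z | t < |M.res z|} from hz),
      Set.indicator_of_mem (show ω ∈ {ω | t < |M.u 0 ω|} from hz), res_obs]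
  · rw [tailRes, Set.indicator_of_notMem (show M.obs 0 ω ∉ {z | t < |M.res z|} from hz),
      Set.indicator_of_notMem (show ω ∉ {ω | t < |M.u 0 ω|} from hz)]
    norm_num

variable (hR : M.SieveRates μ) (hs : M.IsRandomSample μ) (hvar : M.CondVarBounded μ)

include hvar in
theorem integrable_tailRes_sq_mul (t : ℝ) {g : 𝒲 → ℝ} (hg : g ∈ Linf 𝒲) :
    Integrable (fun ω => M.tailRes t (M.obs 0 ω) ^ 2 * g (M.W 0 ω)) μ := by
  simp only [tailRes_obs_sq]
  exact (integral_mul_condExp (hvar.1.integrable_sq.indicator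
        (measurableSet_lt measurable_const (M.measurable_u 0).abs)) hg).1

include hR in
theorem eventually_one_le_ζ : ∀ᶠ n in atTop, 1 ≤ M.ζ μ n := by
  filter_upwards [hR.J_ne_zero] with n hJ
  have := (K_pos_of_ne hR hJ).trans (K_le_ζ_sq hR.regular n)
  exact (one_le_sq_iff₀ (ζ_nonneg n)).1 this

section LawOfLargeNumbers

variable {a : (n : ℕ) → Fin (M.K n) → ℝ} (ha : ∀ᶠ n in atTop, vnorm (a n) ≠ 0)

include hR hs hvar ha in
/-- Law of large numbers for `u² (a' b)²`, along normalised coefficient vectors `a`. -/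
theorem tendsto_empMean_res_sq_mul (hui : M.CondUnifIntegrable μ) :
    Tendsto (fun x : ℕ × Ω =>
      empMean M.obs x.1 (fun z => M.res z ^ 2 *
        ((a x.1 ⬝ᵥ M.bw μ x.1 z.2.2) ^ 2 / vnorm (a x.1) ^ 2)) x.2 -
      ∫ ω, M.u 0 ω ^ 2 * ((a x.1 ⬝ᵥ M.bw μ x.1 (M.W 0 ω)) ^ 2 / vnorm (a x.1) ^ 2) ∂μ)
      (probFilter μ) (𝓝 0) := by
  obtain ⟨C, hC0, hC⟩ := exists_integral_u_sq_le hR.regular hvar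
  -- Any level tending to infinity removes the tail. With √(log n) the truncated second moment over
  -- n is at most C ζ² log n / n, which is `rate_log`.
  let t : ℕ → ℝ := fun n => Real.sqrt (Real.log n)
  have ht : Tendsto t atTop atTop := Real.tendsto_sqrt_atTop.comp
    (Real.tendsto_log_atTop.comp tendsto_natCast_atTop_atTop)
  let w : (n : ℕ) → 𝒲 → ℝ := fun n y => (a n ⬝ᵥ M.bw μ n y) ^ 2 / vnorm (a n) ^ 2
  have hw : ∀ n, w n ∈ Linf 𝒲 := fun n => by
    have := mul_mem_Linf (dotProduct_bw_sq_mem_Linf (μ := μ) n (a n))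
      (const_mem_Linf (vnorm (a n) ^ 2)⁻¹)
    simpa only [← div_eq_mul_inv] using this
  have hw0 : ∀ n y, 0 ≤ w n y := fun n y => by positivity
  have hw1 : ∀ᶠ n in atTop, ∫ ω, w n (M.W 0 ω) ∂μ = 1 := by
    filter_upwards [ha] with n hn
    simp only [w]
    rw [integral_div, integral_dotProduct_bw_sq hR.regular, ← vnorm_sq, div_self (pow_ne_zero 2 hn)]
  have hmz : ∀ n, Measurable fun z : ℝ × 𝒳 × 𝒲 => w n z.2.2 :=
    fun n => (hw n).1.comp (measurable_snd.comp measurable_snd)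
  refine tendsto_empMean_sub (ident_obs hs) (iIndepFun_obs hs)
    (g := fun n z => M.res z ^ 2 * w n z.2.2)
    (g' := fun n z => M.truncRes (t n) z ^ 2 * w n z.2.2)
    (g'' := fun n z => M.tailRes (t n) z ^ 2 * w n z.2.2)
    (c := fun n => C * (M.ζ μ n ^ 2 * Real.log n / n))
    (c' := fun n => ∫ ω, M.tailRes (t n) (M.obs 0 ω) ^ 2 * w n (M.W 0 ω) ∂μ)
    (fun n z => by rw [res_sq_eq (t n)]; ring)
    (fun n => ((measurable_truncRes _).pow_const 2).mul (hmz n))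
    (fun n => ((measurable_tailRes _).pow_const 2).mul (hmz n))
    (fun n z => mul_nonneg (sq_nonneg _) (hw0 n _)) ?_ (by simpa using hR.rate_log.const_mul C)
    (Eventually.of_forall fun n => ⟨integrable_tailRes_sq_mul hvar (t n) (hw n), le_rfl⟩) ?_
  · filter_upwards [eventually_ge_atTop 1, ha] with n hn han
    have hlog : 0 ≤ Real.log n := Real.log_nonneg (by exact_mod_cast hn)
    have hpos : 0 < vnorm (a n) := lt_of_le_of_ne (vnorm_nonneg _) (Ne.symm han)
    have hmem : (fun ω => M.truncRes (t n) (M.obs 0 ω) ^ 2 * w n (M.W 0 ω)) ∈ Linf Ω :=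
      mul_mem_Linf (sq_mem_Linf (comp_mem_Linf (truncRes_mem_Linf (Real.sqrt_nonneg _))
        (M.measurable_obs 0))) (comp_mem_Linf (hw n) (M.measurable_W 0))
    refine ⟨memLp_of_mem_Linf hmem, ?_⟩
    have hwle : ∀ y, w n y ≤ M.ζ μ n ^ 2 := fun y => by
      rw [div_le_iff₀ (by positivity), ← mul_pow, ← sq_abs, mul_comm]
      exact pow_le_pow_left₀ (abs_nonneg _) (abs_dotProduct_bw_le n (a n) y) 2
    have hpt : ∀ ω, (M.truncRes (t n) (M.obs 0 ω) ^ 2 * w n (M.W 0 ω)) ^ 2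
        ≤ Real.log n * M.ζ μ n ^ 2 * (M.u 0 ω ^ 2 * w n (M.W 0 ω)) := by
      intro ω
      have h1 : M.truncRes (t n) (M.obs 0 ω) ^ 2 ≤ Real.log n := by
        rw [← Real.sq_sqrt hlog, ← sq_abs]
        exact pow_le_pow_left₀ (abs_nonneg _) (abs_truncRes_le (Real.sqrt_nonneg _) _) 2
      have h2 : M.truncRes (t n) (M.obs 0 ω) ^ 2 ≤ M.u 0 ω ^ 2 := truncRes_sq_le _ _
      calc _ = (M.truncRes (t n) (M.obs 0 ω) ^ 2 * w n (M.W 0 ω)) *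
            (M.truncRes (t n) (M.obs 0 ω) ^ 2 * w n (M.W 0 ω)) := sq _
        _ ≤ (Real.log n * M.ζ μ n ^ 2) * (M.u 0 ω ^ 2 * w n (M.W 0 ω)) :=
            mul_le_mul (mul_le_mul h1 (hwle _) (hw0 _ _) hlog)
              (mul_le_mul_of_nonneg_right h2 (hw0 _ _))
              (mul_nonneg (sq_nonneg _) (hw0 _ _)) (by positivity)
    have hCn : ∫ ω, M.u 0 ω ^ 2 * w n (M.W 0 ω) ∂μ ≤ C := by
      have := hC n (a n)
      rw [← div_le_iff₀ (by positivity), ← integral_div] at this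
      simpa only [w, mul_div_assoc] using this
    calc (n : ℝ)⁻¹ * ∫ ω, (M.truncRes (t n) (M.obs 0 ω) ^ 2 * w n (M.W 0 ω)) ^ 2 ∂μ
        ≤ (n : ℝ)⁻¹ * ∫ ω, Real.log n * M.ζ μ n ^ 2 * (M.u 0 ω ^ 2 * w n (M.W 0 ω)) ∂μ := by
          refine mul_le_mul_of_nonneg_left (integral_mono (integrable_of_mem_Linf
            (sq_mem_Linf hmem)) ((integrable_u_sq_mul hvar (hw n)).const_mul _) hpt) (by positivity)
      _ ≤ (n : ℝ)⁻¹ * (Real.log n * M.ζ μ n ^ 2 * C) := by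
          rw [integral_const_mul]; gcongr
      _ = _ := by ring
  · rw [Metric.tendsto_nhds]
    intro ε hε
    obtain ⟨L, hL0, hL⟩ := integral_tail_le hvar hui (half_pos hε)
    filter_upwards [ht.eventually_ge_atTop L, hw1] with n hn hwn
    have h0 : 0 ≤ ∫ ω, M.tailRes (t n) (M.obs 0 ω) ^ 2 * w n (M.W 0 ω) ∂μ :=
      integral_nonneg fun ω => mul_nonneg (sq_nonneg _) (hw0 _ _)
    rw [Real.dist_0_eq_abs, abs_of_nonneg h0]
    have := hL (t n) hn (w n) (hw n) (hw0 n)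
    rw [hwn, mul_one] at this
    simp only [tailRes_obs_sq]
    exact this.trans_lt (half_lt_self hε)

end LawOfLargeNumbers

section LargestEigenvalue

variable {δ : ℝ} (hδ : 0 < δ) (hmom : Integrable (fun ω => |M.u 0 ω| ^ (2 + δ)) μ)
  (hrate : Tendsto (fun n : ℕ => M.ζ μ n ^ ((2 + δ) / δ) * Real.sqrt (Real.log n / n))
    atTop (𝓝 0))

/-- The level at which the residuals are truncated. -/
noncomputable def level (M : Model Ω 𝒳 𝒲) (μ : Measure Ω) (δ : ℝ) (n : ℕ) : ℝ :=
  M.ζ μ n ^ (2 / δ) *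
    (Real.sqrt (M.ζ μ n ^ ((2 + δ) / δ) * Real.sqrt (Real.log n / n)))⁻¹

include hR in
theorem eventually_rate_pos : ∀ᶠ n : ℕ in atTop, 1 ≤ M.ζ μ n ∧ 1 ≤ Real.log n ∧ 0 < (n : ℝ) ∧
    0 < M.ζ μ n ^ ((2 + δ) / δ) * Real.sqrt (Real.log n / n) := by
  have hlog : ∀ᶠ n : ℕ in atTop, 1 ≤ Real.log n :=
    (Real.tendsto_log_atTop.comp tendsto_natCast_atTop_atTop).eventually_ge_atTop 1
  filter_upwards [eventually_one_le_ζ hR, hlog, eventually_gt_atTop 0] with n h1 h2 h3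
  have h3' : 0 < (n : ℝ) := Nat.cast_pos.2 h3
  exact ⟨h1, h2, h3', by positivity⟩

include hR hs hδ hmom hrate in
-- In mean the quantity is at most ζ² t^{-δ} E|u|^{2+δ} = r^{δ/2} E|u|^{2+δ}. The weight ζ² is the
-- crude bound for (v'b)²/|v|², so the tail part is negligible uniformly in v.
theorem tendsto_ζ_sq_mul_empMean_tailRes :
    Tendsto (fun x : ℕ × Ω => M.ζ μ x.1 ^ 2 *
      empMean M.obs x.1 (fun z => M.tailRes (M.level μ δ x.1) z ^ 2) x.2)
      (probFilter μ) (𝓝 0) := by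
  set r : ℕ → ℝ := fun n => M.ζ μ n ^ ((2 + δ) / δ) * Real.sqrt (Real.log n / n) with hr
  have hc : Tendsto (fun n => r n ^ (δ / 2) * ∫ ω, |M.u 0 ω| ^ (2 + δ) ∂μ) atTop (𝓝 0) := by
    have h1 : Tendsto (fun n => r n ^ (δ / 2)) atTop (𝓝 (0 ^ (δ / 2))) :=
      hrate.rpow_const (Or.inr (by positivity))
    rw [Real.zero_rpow (by positivity)] at h1
    simpa using h1.mul_const (∫ ω, |M.u 0 ω| ^ (2 + δ) ∂μ)
  refine tendsto_zero_of_integral (Z := fun n ω => M.ζ μ n ^ 2 *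
      empMean M.obs n (fun z => M.tailRes (M.level μ δ n) z ^ 2) ω)
    (fun n ω => mul_nonneg (sq_nonneg _) (empMean_nonneg n ω fun z => sq_nonneg _)) ?_ hc
  filter_upwards [eventually_rate_pos hR (δ := δ)] with n hn
  obtain ⟨hζ, hlog, hn0, hrn⟩ := hn
  obtain ⟨ht, -, ht2⟩ := truncation_level hζ hδ hrn
  change 0 < M.level μ δ n at ht
  change _ * M.level μ δ n ^ (-δ) = r n ^ (δ / 2) at ht2
  have hpt : ∀ ω, M.tailRes (M.level μ δ n) (M.obs 0 ω) ^ 2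
      ≤ |M.u 0 ω| ^ (2 + δ) * M.level μ δ n ^ (-δ) := by
    intro ω
    rw [tailRes_obs_sq]
    by_cases hω : M.level μ δ n < |M.u 0 ω|
    · rw [Set.indicator_of_mem (show ω ∈ {ω | M.level μ δ n < |M.u 0 ω|} from hω)]
      exact sq_le_rpow_mul ht hδ hω.le
    · rw [Set.indicator_of_notMem (show ω ∉ {ω | M.level μ δ n < |M.u 0 ω|} from hω)]
      positivity
  have hmt : Measurable fun z => M.tailRes (M.level μ δ n) z ^ 2 :=
    (measurable_tailRes _).pow_const 2
  have hint : Integrable (fun ω => M.tailRes (M.level μ δ n) (M.obs 0 ω) ^ 2) μ := by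
    refine (hmom.mul_const (M.level μ δ n ^ (-δ))).mono'
      (hmt.comp (M.measurable_obs 0)).aestronglyMeasurable (Eventually.of_forall fun ω => ?_)
    rw [Real.norm_eq_abs, abs_of_nonneg (sq_nonneg _)]
    exact hpt ω
  have hn1 : n ≠ 0 := by rintro rfl; simp at hn0
  refine ⟨(integrable_empMean (ident_obs hs) n hmt hint).const_mul _, ?_⟩
  rw [integral_const_mul, integral_empMean (ident_obs hs) hn1 hmt hint, ← ht2]
  calc _ ≤ M.ζ μ n ^ 2 * ∫ ω, |M.u 0 ω| ^ (2 + δ) * M.level μ δ n ^ (-δ) ∂μ := by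
        refine mul_le_mul_of_nonneg_left ?_ (sq_nonneg _)
        exact integral_mono hint (hmom.mul_const _) hpt
    _ = _ := by rw [integral_mul_const]; ring

include hR hs hvar hδ hrate in
-- The matrix Chernoff bound for the bounded vectors u_t b, with |u_t b|² ≤ t²ζ² and second moment
-- matrix bounded by C.
theorem exists_empMean_truncRes_le : ∃ C : ℝ, 0 ≤ C ∧ ∀ᶠ x : ℕ × Ω in probFilter μ,
    ∀ v : Fin (M.K x.1) → ℝ, empMean M.obs x.1
      (fun z => M.truncRes (M.level μ δ x.1) z ^ 2 * (v ⬝ᵥ M.bw μ x.1 z.2.2) ^ 2) x.2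
        ≤ C * vnorm v ^ 2 := by
  obtain ⟨C, hC0, hC⟩ := exists_integral_u_sq_le hR.regular hvar
  refine ⟨Real.exp (C * Real.exp 1 + 1), (Real.exp_pos _).le, ?_⟩
  rw [eventually_probFilter]
  have hlim : Tendsto (fun n : ℕ => ENNReal.ofReal ((n : ℝ)⁻¹)) atTop (𝓝 0) := by
    have := ENNReal.tendsto_ofReal (tendsto_inv_atTop_nhds_zero_nat (𝕜 := ℝ))
    simpa using this
  refine tendsto_of_tendsto_of_tendsto_of_le_of_le' tendsto_const_nhds hlim
    (Eventually.of_forall fun n => zero_le) ?_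
  have hsmall : ∀ᶠ n : ℕ in atTop,
      M.ζ μ n ^ ((2 + δ) / δ) * Real.sqrt (Real.log n / n) < 1 / 3 :=
    hrate.eventually (gt_mem_nhds (by norm_num))
  have hKn : ∀ᶠ n : ℕ in atTop, M.ζ μ n ^ 2 / n < 1 :=
    (tendsto_sq_div_of_rate hR).eventually (gt_mem_nhds one_pos)
  filter_upwards [eventually_rate_pos hR (δ := δ), hsmall, hKn] with n hn hsm hK
  obtain ⟨hζ, hlog, hn0, hrn⟩ := hn
  obtain ⟨ht, hR2, -⟩ := truncation_level hζ hδ hrn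
  change 0 < M.level μ δ n at ht
  change M.level μ δ n ^ 2 * M.ζ μ n ^ 2 = _ at hR2
  have hn1 : n ≠ 0 := by rintro rfl; simp at hn0
  set t := M.level μ δ n
  set r := M.ζ μ n ^ ((2 + δ) / δ) * Real.sqrt (Real.log n / n) with hr
  have hRlog : t ^ 2 * M.ζ μ n ^ 2 * Real.log n = r * n := by
    have e : r ^ 2 * n = (M.ζ μ n ^ ((2 + δ) / δ)) ^ 2 * Real.log n := by
      rw [hr, mul_pow, Real.sq_sqrt (by positivity)]
      field_simp
    rw [hR2, div_mul_eq_mul_div, ← e]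
    field_simp
  -- With p ≥ 2 log n the failure probability K e^{-p} is at most n · n⁻², using K ≤ ζ² ≤ n.
  set p := ⌈2 * Real.log n⌉₊
  have hp1 : 2 * Real.log n ≤ p := Nat.le_ceil _
  have hp2 : (p : ℝ) ≤ 3 * Real.log n := by
    have := (Nat.ceil_lt_add_one (show 0 ≤ 2 * Real.log n by positivity)).le
    linarith
  have hp0 : p ≠ 0 := by
    intro h0
    rw [h0, Nat.cast_zero] at hp1
    linarith
  let φ : ℝ × 𝒳 × 𝒲 → Fin (M.K n) → ℝ := fun z k => M.truncRes t z * M.bw μ n z.2.2 k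
  have hvφ : ∀ (v : Fin (M.K n) → ℝ) z, v ⬝ᵥ φ z = M.truncRes t z * (v ⬝ᵥ M.bw μ n z.2.2) := by
    intro v z
    rw [← smul_eq_mul, ← dotProduct_smul]
    rfl
  have hφ : ∀ k, (fun z => φ z k) ∈ Linf (ℝ × 𝒳 × 𝒲) :=
    fun k => mul_mem_Linf (truncRes_mem_Linf ht.le) (obs_bw_mem_Linf n k)
  have hRφ : ∀ z, φ z ⬝ᵥ φ z ≤ t ^ 2 * M.ζ μ n ^ 2 := by
    intro z
    have e : φ z = M.truncRes t z • M.bw μ n z.2.2 := rfl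
    rw [← vnorm_sq, e, vnorm_smul, mul_pow]
    exact mul_le_mul (pow_le_pow_left₀ (abs_nonneg _) (abs_truncRes_le ht.le z) 2)
      (pow_le_pow_left₀ (vnorm_nonneg _) (M.vnorm_bw_le μ n _) 2) (sq_nonneg _) (sq_nonneg _)
  have hcφ : ∀ v : Fin (M.K n) → ℝ, ∫ ω, (v ⬝ᵥ φ (M.obs 0 ω)) ^ 2 ∂μ ≤ C * (v ⬝ᵥ v) := by
    intro v
    rw [← vnorm_sq]
    refine le_trans ?_ (hC n v)
    refine integral_mono_of_nonneg (Eventually.of_forall fun ω => sq_nonneg _)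
      (integrable_u_sq_mul hvar (dotProduct_bw_sq_mem_Linf n v)) (Eventually.of_forall fun ω => ?_)
    simp only [hvφ, mul_pow]
    exact mul_le_mul_of_nonneg_right (truncRes_sq_le _ _) (sq_nonneg _)
  -- Here p ≤ 3 log n and t²ζ² log n = rn, so r < 1/3 is what the bound requires.
  have hpR : (p : ℝ) * (t ^ 2 * M.ζ μ n ^ 2) ≤ n := by
    calc (p : ℝ) * (t ^ 2 * M.ζ μ n ^ 2) ≤ 3 * Real.log n * (t ^ 2 * M.ζ μ n ^ 2) := by gcongr
      _ = 3 * r * n := by rw [mul_assoc, mul_comm (Real.log n), hRlog]; ring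
      _ ≤ 1 * n := by gcongr; linarith
      _ = n := one_mul _
  have key := measure_exists_lt_empMean_sq_le hφ (ident_obs hs) (iIndepFun_obs hs) M.measurable_obs
    hn1 hp0 hC0 hpR hRφ hcφ
  simp only [hvφ, mul_pow] at key
  refine key.trans (ENNReal.ofReal_le_ofReal ?_)
  have hKn' : (M.K n : ℝ) ≤ n := by
    rw [div_lt_one hn0] at hK
    exact (K_le_ζ_sq hR.regular n).trans hK.le
  have hexp : Real.exp (-(p : ℝ)) ≤ ((n : ℝ) ^ 2)⁻¹ := by
    rw [Real.exp_neg]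
    gcongr
    calc (n : ℝ) ^ 2 = Real.exp (2 * Real.log n) := by
          rw [two_mul, Real.exp_add, Real.exp_log hn0, sq]
      _ ≤ _ := Real.exp_le_exp.2 hp1
  calc (M.K n : ℝ) * Real.exp (-p) ≤ n * ((n : ℝ) ^ 2)⁻¹ := by gcongr
    _ = (n : ℝ)⁻¹ := by field_simp

include hR hs hvar hδ hmom hrate in
/-- The largest eigenvalue of the whitened matrix `n⁻¹ ∑ u_i² b(W_i) b(W_i)'` is `O_p(1)`. -/
theorem exists_empMean_res_sq_le : ∃ C : ℝ, 0 ≤ C ∧ ∀ᶠ x : ℕ × Ω in probFilter μ,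
    ∀ v : Fin (M.K x.1) → ℝ, empMean M.obs x.1
      (fun z => M.res z ^ 2 * (v ⬝ᵥ M.bw μ x.1 z.2.2) ^ 2) x.2 ≤ C * vnorm v ^ 2 := by
  obtain ⟨C, hC0, hC⟩ := exists_empMean_truncRes_le hR hs hvar hδ hrate
  refine ⟨C + 1, by linarith, ?_⟩
  filter_upwards [hC, (tendsto_ζ_sq_mul_empMean_tailRes hR hs hδ hmom hrate).eventually
    (gt_mem_nhds one_pos)] with x h1 h2 v
  set t := M.level μ δ x.1
  have e : ∀ z, M.res z ^ 2 * (v ⬝ᵥ M.bw μ x.1 z.2.2) ^ 2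
      ≤ M.truncRes t z ^ 2 * (v ⬝ᵥ M.bw μ x.1 z.2.2) ^ 2
        + M.tailRes t z ^ 2 * (vnorm v * M.ζ μ x.1) ^ 2 := by
    intro z
    rw [res_sq_eq t, add_mul]
    refine add_le_add le_rfl (mul_le_mul_of_nonneg_left ?_ (sq_nonneg _))
    exact (sq_abs _).symm.le.trans
      (pow_le_pow_left₀ (abs_nonneg _) (abs_dotProduct_bw_le (M := M) (μ := μ) x.1 v z.2.2) 2)
  refine (empMean_mono _ _ e).trans ?_
  rw [empMean_add]
  have h3 : empMean M.obs x.1 (fun z => M.tailRes t z ^ 2 * (vnorm v * M.ζ μ x.1) ^ 2) x.2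
      = (M.ζ μ x.1 ^ 2 * empMean M.obs x.1 (fun z => M.tailRes t z ^ 2) x.2) * vnorm v ^ 2 := by
    simp only [empMean, ← Finset.sum_mul]
    ring
  rw [h3, add_mul]
  exact add_le_add (h1 v) (mul_le_mul_of_nonneg_right h2.le (sq_nonneg _))

end LargestEigenvalue

end Model

end NPIV

/-! ### Consistency of the sieve variance estimator. -/

namespace NPIV

/-- The empirical `L²` norm of the first `n` entries. -/
noncomputable def empNorm (n : ℕ) (y : ℕ → ℝ) : ℝ :=
  Real.sqrt ((n : ℝ)⁻¹ * ∑ i ∈ Finset.range n, y i ^ 2)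

theorem empNorm_eq (n : ℕ) (y : ℕ → ℝ) :
    empNorm n y = Real.sqrt (n : ℝ)⁻¹ * vnorm (fun i : Fin n => y i) := by
  rw [empNorm, Real.sqrt_mul (by positivity), vnorm_eq_sqrt, dotProduct,
    Finset.sum_range (fun i => y i ^ 2)]
  simp only [sq]

theorem empNorm_add_le (n : ℕ) (y z : ℕ → ℝ) :
    empNorm n (fun i => y i + z i) ≤ empNorm n y + empNorm n z := by
  simp only [empNorm_eq, ← mul_add]
  exact mul_le_mul_of_nonneg_left (vnorm_add_le (fun i : Fin n => y i) fun i : Fin n => z i)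
    (Real.sqrt_nonneg _)

theorem empNorm_neg (n : ℕ) (y : ℕ → ℝ) : empNorm n (fun i => -y i) = empNorm n y := by
  simp only [empNorm, neg_sq]

theorem abs_empNorm_sub_le (n : ℕ) (y z : ℕ → ℝ) :
    |empNorm n y - empNorm n z| ≤ empNorm n fun i => y i - z i := by
  have h1 := empNorm_add_le n z fun i => y i - z i
  have h2 := empNorm_add_le n y fun i => -(y i - z i)
  rw [empNorm_neg] at h2
  simp only [add_sub_cancel, neg_sub] at h1 h2
  rw [abs_le]
  constructor <;> linarith

theorem empNorm_mono {n : ℕ} {y z : ℕ → ℝ} (h : ∀ i, |y i| ≤ |z i|) :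
    empNorm n y ≤ empNorm n z := by
  unfold empNorm
  gcongr Real.sqrt (_ * ∑ i ∈ _, ?_)
  exact sq_le_sq.2 (h _)

theorem empNorm_const_mul (n : ℕ) (c : ℝ) (y : ℕ → ℝ) :
    empNorm n (fun i => c * y i) = |c| * empNorm n y := by
  simp only [empNorm, mul_pow, ← Finset.mul_sum]
  rw [mul_left_comm, Real.sqrt_mul (sq_nonneg c), Real.sqrt_sq_eq_abs]

theorem abs_le_supNorm {𝒳 : Type*} [MeasurableSpace 𝒳] (h : Linf 𝒳) (x : 𝒳) :
    |(h : 𝒳 → ℝ) x| ≤ supNorm h := by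
  obtain ⟨-, C, hC⟩ := h.2
  exact le_ciSup (f := fun x => |(h : 𝒳 → ℝ) x|) ⟨C, by rintro _ ⟨y, rfl⟩; exact hC y⟩ x

theorem abs_sqrt_sub_sqrt_le {x y : ℝ} (hx : 0 ≤ x) (hy : 0 ≤ y) :
    |Real.sqrt x - Real.sqrt y| ≤ Real.sqrt |x - y| := by
  refine Real.le_sqrt_of_sq_le ?_
  have h1 := Real.sq_sqrt hx
  have h2 := Real.sq_sqrt hy
  have h3 := Real.sqrt_nonneg x
  have h4 := Real.sqrt_nonneg y
  have e : x - y = (Real.sqrt x - Real.sqrt y) * (Real.sqrt x + Real.sqrt y) := by nlinarith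
  rw [sq_abs, e, abs_mul, abs_of_nonneg (add_nonneg h3 h4), ← sq_abs, sq]
  refine mul_le_mul_of_nonneg_left ?_ (abs_nonneg _)
  rw [abs_le]
  constructor <;> linarith

namespace Model

variable {Ω 𝒳 𝒲 : Type*} [MeasurableSpace Ω] [MeasurableSpace 𝒳] [MeasurableSpace 𝒲]
  {M : Model Ω 𝒳 𝒲} {μ : Measure Ω} {f : Linf 𝒳 → ℝ}

theorem dotProduct_Gwhat_mulVec (n : ℕ) (ω : Ω) (v : Fin (M.K n) → ℝ) :
    v ⬝ᵥ (M.Gwhat μ n ω *ᵥ v) = empMean M.obs n (fun z => (v ⬝ᵥ M.bw μ n z.2.2) ^ 2) ω := by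
  have e : ∀ z : ℝ × 𝒳 × 𝒲, (v ⬝ᵥ M.bw μ n z.2.2) ^ 2
      = ∑ k, (M.bw μ n z.2.2 k * (v ⬝ᵥ M.bw μ n z.2.2)) * v k := by
    intro z
    rw [sq]
    nth_rw 1 [dotProduct]
    rw [Finset.sum_mul]
    exact Finset.sum_congr rfl fun k _ => by ring
  simp only [e]
  rw [← empMean_sum_mul, dotProduct]
  exact Finset.sum_congr rfl fun k _ => by rw [Gwhat_mulVec, mul_comm]

/-- The square is v'Ĝv ≤ (3/2)|v|² for the whitened Ĝ, which is within 1/2 of the identity; the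
constant 2 is generous. -/
theorem empNorm_dotProduct_bw_le {n : ℕ} {ω : Ω} (hG : frob (M.Gwhat μ n ω - 1) ≤ 1 / 2)
    (v : Fin (M.K n) → ℝ) :
    empNorm n (fun i => v ⬝ᵥ M.bw μ n (M.W i ω)) ≤ 2 * vnorm v := by
  refine Real.sqrt_le_iff.2 ⟨mul_nonneg two_pos.le (vnorm_nonneg _), ?_⟩
  change empMean M.obs n (fun z => (v ⬝ᵥ M.bw μ n z.2.2) ^ 2) ω ≤ _
  rw [← dotProduct_Gwhat_mulVec]
  have h1 := vnorm_mulVec_sub_le_half hG v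
  have h2 := vnorm_add_le (M.Gwhat μ n ω *ᵥ v - v) v
  rw [sub_add_cancel] at h2
  have h3 := dotProduct_le v (M.Gwhat μ n ω *ᵥ v)
  have h4 := vnorm_nonneg v
  nlinarith

theorem sdhat_eq (h : M.IsRegularSieve μ) (n : ℕ) (ω : Ω) :
    M.sdhat f n ω = empNorm n fun i =>
      M.uhat n ω i * (M.ahat μ n ω (M.Dψ f n (M.hhat n ω)) ⬝ᵥ M.bw μ n (M.W i ω)) := by
  rw [sdhat, sandwich_hat h, empNorm]

/-- The reverse triangle inequality for empirical norms. The error û - u = -(ĥ - h₀)(X) is taken out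
in sup norm, and the error α - a is weighted by the empirical form of u²bb', bounded by C. -/
theorem abs_sdhat_sub_le (h : M.IsRegularSieve μ) {n : ℕ} {ω : Ω} {C : ℝ} (hC0 : 0 ≤ C)
    (hG : frob (M.Gwhat μ n ω - 1) ≤ 1 / 2)
    (hC : ∀ v : Fin (M.K n) → ℝ, empMean M.obs n
      (fun z => M.res z ^ 2 * (v ⬝ᵥ M.bw μ n z.2.2) ^ 2) ω ≤ C * vnorm v ^ 2)
    (a : Fin (M.K n) → ℝ) :
    |M.sdhat f n ω - empNorm n fun i => M.u i ω * (a ⬝ᵥ M.bw μ n (M.W i ω))| ≤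
      supNorm (M.hhat n ω - M.h₀) * (2 * vnorm (M.ahat μ n ω (M.Dψ f n (M.hhat n ω)))) +
        Real.sqrt C * vnorm (M.ahat μ n ω (M.Dψ f n (M.hhat n ω)) - a) := by
  rw [sdhat_eq h]
  set α := M.ahat μ n ω (M.Dψ f n (M.hhat n ω))
  refine (abs_empNorm_sub_le _ _ _).trans ?_
  have e : ∀ i, M.uhat n ω i * (α ⬝ᵥ M.bw μ n (M.W i ω)) - M.u i ω * (a ⬝ᵥ M.bw μ n (M.W i ω))
      = -(((M.hhat n ω - M.h₀ : Linf 𝒳) : 𝒳 → ℝ) (M.X i ω) * (α ⬝ᵥ M.bw μ n (M.W i ω))) +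
        M.u i ω * ((α - a) ⬝ᵥ M.bw μ n (M.W i ω)) := by
    intro i
    rw [sub_dotProduct, uhat, u, Submodule.coe_sub, Pi.sub_apply]
    ring
  simp only [e]
  refine (empNorm_add_le _ _ _).trans (add_le_add ?_ ?_)
  · rw [empNorm_neg]
    have hs0 : 0 ≤ supNorm (M.hhat n ω - M.h₀) := Real.iSup_nonneg fun x => abs_nonneg _
    calc _ ≤ empNorm n (fun i => supNorm (M.hhat n ω - M.h₀) * (α ⬝ᵥ M.bw μ n (M.W i ω))) := by
          refine empNorm_mono fun i => ?_
          rw [abs_mul, abs_mul, abs_of_nonneg hs0]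
          exact mul_le_mul_of_nonneg_right (abs_le_supNorm _ _) (abs_nonneg _)
      _ ≤ _ := by
          rw [empNorm_const_mul, abs_of_nonneg hs0]
          exact mul_le_mul_of_nonneg_left (empNorm_dotProduct_bw_le hG α) hs0
  · have h1 := hC (α - a)
    rw [← Real.sqrt_sq (vnorm_nonneg (α - a)), ← Real.sqrt_mul hC0]
    refine Real.sqrt_le_sqrt ?_
    simp only [mul_pow]
    exact h1

variable [IsProbabilityMeasure μ]
  (hR : M.SieveRates μ) (hs : M.IsRandomSample μ) (hvar : M.CondVarBounded μ)
  (hv : ∀ᶠ n in atTop, vnorm (M.astar μ f n) ≠ 0)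

include hR hs hv in
-- The derivative at ĥ depends on the sample, so the passage from `ahat` to `apop` uses the bound
-- uniform over directions; the passage from `apop` to `astar` is the consistency of the
-- representer.
theorem tendsto_vnorm_ahat_sub_astar
    (hrep : Tendsto (fun x : ℕ × Ω =>
      vnorm (M.apop μ x.1 (M.Dψ f x.1 (M.hhat x.1 x.2)) - M.astar μ f x.1) /
        vnorm (M.astar μ f x.1)) (probFilter μ) (𝓝 0)) :
    Tendsto (fun x : ℕ × Ω =>
      vnorm (M.ahat μ x.1 x.2 (M.Dψ f x.1 (M.hhat x.1 x.2)) - M.astar μ f x.1) /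
        vnorm (M.astar μ f x.1)) (probFilter μ) (𝓝 0) := by
  rw [Metric.tendsto_nhds]
  intro ε hε
  have hε' : 0 < min (ε / 4) 1 := lt_min (by positivity) one_pos
  filter_upwards [eventually_vnorm_ahat_sub_le_mul hR hs hε',
    hrep.eventually (gt_mem_nhds hε'), eventually_fst hv] with x h1 h2 hvx
  have hpos : 0 < vnorm (M.astar μ f x.1) := lt_of_le_of_ne (vnorm_nonneg _) (Ne.symm hvx)
  rw [Real.dist_0_eq_abs, abs_of_nonneg (div_nonneg (vnorm_nonneg _) hpos.le), div_lt_iff₀ hpos]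
  rw [div_lt_iff₀ hpos] at h2
  have h1' := h1 (M.Dψ f x.1 (M.hhat x.1 x.2))
  set α := M.ahat μ x.1 x.2 (M.Dψ f x.1 (M.hhat x.1 x.2))
  set β := M.apop μ x.1 (M.Dψ f x.1 (M.hhat x.1 x.2))
  set a := M.astar μ f x.1
  set e := min (ε / 4) 1
  have h3 := vnorm_add_le (α - β) (β - a)
  have h4 := vnorm_add_le (β - a) a
  rw [sub_add_sub_cancel] at h3
  rw [sub_add_cancel] at h4
  have he1 : e ≤ ε / 4 := min_le_left _ _
  have he2 : e ≤ 1 := min_le_right _ _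
  have h5 : vnorm β ≤ 2 * vnorm a := by nlinarith
  have h6 : e * vnorm β ≤ e * (2 * vnorm a) := mul_le_mul_of_nonneg_left h5 hε'.le
  nlinarith

include hR hs hvar hv in
-- After division by |a| both terms are square roots of quantities whose difference vanishes by the
-- weak law, and |√x - √y| ≤ √|x - y|.
theorem tendsto_empNorm_sub_sd (hui : M.CondUnifIntegrable μ) :
    Tendsto (fun x : ℕ × Ω =>
      ((empNorm x.1 fun i => M.u i x.2 * (M.astar μ f x.1 ⬝ᵥ M.bw μ x.1 (M.W i x.2)))
        - M.sd μ f x.1) / vnorm (M.astar μ f x.1)) (probFilter μ) (𝓝 0) := by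
  have key := (tendsto_empMean_res_sq_mul hR hs hvar hv hui).abs.sqrt
  rw [abs_zero, Real.sqrt_zero] at key
  refine squeeze_zero_norm' ?_ key
  filter_upwards [eventually_fst hv] with x hvx
  have hpos : 0 < vnorm (M.astar μ f x.1) := lt_of_le_of_ne (vnorm_nonneg _) (Ne.symm hvx)
  set a := M.astar μ f x.1
  have e1 : (empNorm x.1 fun i => M.u i x.2 * (a ⬝ᵥ M.bw μ x.1 (M.W i x.2))) / vnorm a
      = Real.sqrt (empMean M.obs x.1 (fun z => M.res z ^ 2 *
        ((a ⬝ᵥ M.bw μ x.1 z.2.2) ^ 2 / vnorm a ^ 2)) x.2) := by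
    rw [eq_comm, ← Real.sqrt_sq hpos.le, empNorm, ← Real.sqrt_div' _ (sq_nonneg _),
      Real.sqrt_sq hpos.le]
    congr 1
    simp only [empMean, mul_pow, ← mul_div_assoc, ← Finset.sum_div]
    rfl
  have e2 : M.sd μ f x.1 / vnorm a = Real.sqrt (∫ ω, M.u 0 ω ^ 2 *
      ((a ⬝ᵥ M.bw μ x.1 (M.W 0 ω)) ^ 2 / vnorm a ^ 2) ∂μ) := by
    rw [← Real.sqrt_sq (div_nonneg (Real.sqrt_nonneg _) hpos.le : 0 ≤ M.sd μ f x.1 / vnorm a),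
      div_pow, sd_sq hR.regular hvar, ← integral_div]
    simp only [mul_div_assoc]
    rfl
  rw [sub_div, e1, e2]
  refine abs_sqrt_sub_sqrt_le (empMean_nonneg _ _ fun z => by positivity)
    (integral_nonneg fun ω => by positivity)

include hR hs hvar hv in
/-- Consistency of the sieve variance estimator. -/
theorem tendsto_sdhat_div_sd (hlow : M.CondVarBddBelow μ) (hui : M.CondUnifIntegrable μ)
    {δ : ℝ} (hδ : 0 < δ) (hmom : Integrable (fun ω => |M.u 0 ω| ^ (2 + δ)) μ)
    (hrate : Tendsto (fun n : ℕ => M.ζ μ n ^ ((2 + δ) / δ) * Real.sqrt (Real.log n / n))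
      atTop (𝓝 0))
    (hsup : Tendsto (fun x : ℕ × Ω => supNorm (M.hhat x.1 x.2 - M.h₀)) (probFilter μ) (𝓝 0))
    (hrep : Tendsto (fun x : ℕ × Ω =>
      vnorm (M.apop μ x.1 (M.Dψ f x.1 (M.hhat x.1 x.2)) - M.astar μ f x.1) /
        vnorm (M.astar μ f x.1)) (probFilter μ) (𝓝 0)) :
    Tendsto (fun x : ℕ × Ω => M.sdhat f x.1 x.2 / M.sd μ f x.1) (probFilter μ) (𝓝 1) := by
  obtain ⟨c, hc, hsd⟩ := exists_mul_vnorm_astar_le_sd hR.regular hvar hlow f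
  obtain ⟨C, hC0, hC⟩ := exists_empMean_res_sq_le hR hs hvar hδ hmom hrate
  have hη := tendsto_vnorm_ahat_sub_astar hR hs hv hrep
  have hN := (tendsto_empNorm_sub_sd hR hs hvar hv hui).abs
  have hsum := ((hsup.mul ((hη.add_const 1).const_mul 2)).add (hη.const_mul (Real.sqrt C))).add hN
  have hsum' := hsum.const_mul c⁻¹
  simp only [abs_zero, zero_mul, mul_zero, add_zero] at hsum'
  rw [← tendsto_sub_nhds_zero_iff]
  refine squeeze_zero_norm' ?_ hsum'
  filter_upwards [hC, eventually_wellPosed hR hs, eventually_fst hv] with x hCx hG hvx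
  have hpos : 0 < vnorm (M.astar μ f x.1) := lt_of_le_of_ne (vnorm_nonneg _) (Ne.symm hvx)
  have hsdx := hsd x.1
  have hsdpos : 0 < M.sd μ f x.1 := (mul_pos hc hpos).trans_le hsdx
  have h1 := abs_sdhat_sub_le (f := f) hR.regular hC0 hG.1 hCx (M.astar μ f x.1)
  have h2 := vnorm_add_le
    (M.ahat μ x.1 x.2 (M.Dψ f x.1 (M.hhat x.1 x.2)) - M.astar μ f x.1) (M.astar μ f x.1)
  rw [sub_add_cancel] at h2
  set α := M.ahat μ x.1 x.2 (M.Dψ f x.1 (M.hhat x.1 x.2))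
  set a := M.astar μ f x.1
  set N := empNorm x.1 fun i => M.u i x.2 * (a ⬝ᵥ M.bw μ x.1 (M.W i x.2))
  set s := supNorm (M.hhat x.1 x.2 - M.h₀)
  have hs0 : 0 ≤ s := Real.iSup_nonneg fun x => abs_nonneg _
  have h3 : |M.sdhat f x.1 x.2 - M.sd μ f x.1|
      ≤ s * (2 * (vnorm (α - a) + vnorm a)) + Real.sqrt C * vnorm (α - a)
        + |N - M.sd μ f x.1| := by
    refine (abs_sub_le _ N _).trans (add_le_add (h1.trans ?_) le_rfl)
    gcongr
  have e : M.sdhat f x.1 x.2 / M.sd μ f x.1 - 1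
      = (M.sdhat f x.1 x.2 - M.sd μ f x.1) / M.sd μ f x.1 := by
    rw [sub_div, div_self hsdpos.ne']
  rw [Real.norm_eq_abs, e, abs_div, abs_of_pos hsdpos, div_le_iff₀ hsdpos]
  have h4 : c⁻¹ * (s * (2 * (vnorm (α - a) / vnorm a + 1)) + Real.sqrt C * (vnorm (α - a) / vnorm a)
      + |(N - M.sd μ f x.1) / vnorm a|) * (c * vnorm a)
      = s * (2 * (vnorm (α - a) + vnorm a)) + Real.sqrt C * vnorm (α - a)
        + |N - M.sd μ f x.1| := by
    rw [abs_div, abs_of_pos hpos]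
    field_simp
  rw [← h4] at h3
  refine h3.trans (mul_le_mul_of_nonneg_left hsdx ?_)
  have := Real.sqrt_nonneg C
  have := vnorm_nonneg (α - a)
  positivity

end Model

end NPIV

/-! ### Measurability of the estimators, and Slutsky's lemma. -/

namespace NPIV

section MeasurableMatrix

variable {Ω : Type*} [MeasurableSpace Ω]

/-- A random matrix all of whose entries are measurable. -/
def MatrixMeasurable {k m : ℕ} (A : Ω → Matrix (Fin k) (Fin m) ℝ) : Prop :=
  ∀ i j, Measurable fun ω => A ω i j

theorem matrixMeasurable_const {k m : ℕ} (A : Matrix (Fin k) (Fin m) ℝ) :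
    MatrixMeasurable fun _ : Ω => A := fun _ _ => measurable_const

theorem MatrixMeasurable.mul {k l m : ℕ} {A : Ω → Matrix (Fin k) (Fin l) ℝ}
    {B : Ω → Matrix (Fin l) (Fin m) ℝ} (hA : MatrixMeasurable A) (hB : MatrixMeasurable B) :
    MatrixMeasurable fun ω => A ω * B ω := fun i j => by
  simp only [Matrix.mul_apply]
  exact Finset.measurable_fun_sum _ fun l _ => (hA i l).mul (hB l j)

theorem MatrixMeasurable.add {k m : ℕ} {A B : Ω → Matrix (Fin k) (Fin m) ℝ}
    (hA : MatrixMeasurable A) (hB : MatrixMeasurable B) :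
    MatrixMeasurable fun ω => A ω + B ω := fun i j => (hA i j).add (hB i j)

theorem MatrixMeasurable.transpose {k m : ℕ} {A : Ω → Matrix (Fin k) (Fin m) ℝ}
    (hA : MatrixMeasurable A) : MatrixMeasurable fun ω => (A ω)ᵀ := fun i j => hA j i

theorem MatrixMeasurable.const_smul {k m : ℕ} {A : Ω → Matrix (Fin k) (Fin m) ℝ}
    (hA : MatrixMeasurable A) (c : ℝ) : MatrixMeasurable fun ω => c • A ω :=
  fun i j => (hA i j).const_mul c

theorem MatrixMeasurable.mulVec {k m : ℕ} {A : Ω → Matrix (Fin k) (Fin m) ℝ}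
    (hA : MatrixMeasurable A) {v : Ω → Fin m → ℝ} (hv : ∀ j, Measurable fun ω => v ω j)
    (i : Fin k) : Measurable fun ω => (A ω *ᵥ v ω) i := by
  simp only [Matrix.mulVec, dotProduct]
  exact Finset.measurable_fun_sum _ fun j _ => (hA i j).mul (hv j)

theorem MatrixMeasurable.det {m : ℕ} {A : Ω → Matrix (Fin m) (Fin m) ℝ}
    (hA : MatrixMeasurable A) : Measurable fun ω => (A ω).det := by
  simp only [Matrix.det_apply']
  exact Finset.measurable_fun_sum _ fun σ _ =>
    (Finset.measurable_fun_prod _ fun i _ => hA _ _).const_mul _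

/-- Cramer's rule; the convention 0⁻¹ = 0 keeps the formula valid for singular matrices. -/
theorem MatrixMeasurable.inv {m : ℕ} {A : Ω → Matrix (Fin m) (Fin m) ℝ}
    (hA : MatrixMeasurable A) : MatrixMeasurable fun ω => (A ω)⁻¹ := fun i j => by
  simp only [Matrix.inv_def, Matrix.smul_apply, Ring.inverse_eq_inv', smul_eq_mul,
    Matrix.adjugate_apply]
  refine hA.det.inv.mul (MatrixMeasurable.det fun k l => ?_)
  simp only [Matrix.updateRow_apply]
  split_ifs
  · exact measurable_const
  · exact hA k l

/-- A regularised pseudo-inverse involving only a genuine inverse, hence measurable in the entries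
of A. -/
theorem cfc_resolvent {m : ℕ} {A : Matrix (Fin m) (Fin m) ℝ} (hA : A.IsHermitian) {ε : ℝ}
    (hε : 0 < ε) : cfc (fun t : ℝ => (t * t + ε)⁻¹ * t) A = (A * A + ε • 1)⁻¹ * A := by
  have hA' : IsSelfAdjoint A := hA
  have hc : ∀ g : ℝ → ℝ, ContinuousOn g (spectrum ℝ A) :=
    fun g => (Matrix.finite_real_spectrum (A := A)).continuousOn g
  have h1 : cfc (fun t : ℝ => t * t + ε) A = A * A + ε • 1 := by
    rw [cfc_add A (fun t : ℝ => t * t) (fun _ => ε) (hc _) (hc _),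
      cfc_mul (fun t : ℝ => t) (fun t : ℝ => t) A (hc _) (hc _), cfc_id' ℝ A, cfc_const ε A,
      Algebra.algebraMap_eq_smul_one]
  have h2 : (A * A + ε • 1) * cfc (fun t : ℝ => (t * t + ε)⁻¹) A = 1 := by
    rw [← h1, ← cfc_mul _ _ A (hc _) (hc _), ← cfc_const_one ℝ A]
    refine cfc_congr fun t _ => mul_inv_cancel₀ ?_
    have := mul_self_nonneg t
    positivity
  rw [cfc_mul (fun t : ℝ => (t * t + ε)⁻¹) (fun t : ℝ => t) A (hc _) (hc _), cfc_id' ℝ A,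
    Matrix.inv_eq_right_inv h2]

theorem tendsto_cfc_apply {m : ℕ} {A : Matrix (Fin m) (Fin m) ℝ} (hA : A.IsHermitian)
    {g : ℕ → ℝ → ℝ} {g' : ℝ → ℝ} (hg : ∀ t, Tendsto (fun k => g k t) atTop (𝓝 (g' t)))
    (i j : Fin m) : Tendsto (fun k => cfc (g k) A i j) atTop (𝓝 (cfc g' A i j)) := by
  simp only [hA.cfc_eq, Matrix.IsHermitian.cfc, Unitary.conjStarAlgAut_apply, Matrix.mul_apply,
    Matrix.diagonal_apply]
  refine tendsto_finsetSum _ fun l _ => (tendsto_finsetSum _ fun l' _ => ?_).mul_const _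
  refine Tendsto.const_mul _ ?_
  split_ifs
  · exact hg _
  · exact tendsto_const_nhds

theorem tendsto_resolvent_inv (t : ℝ) :
    Tendsto (fun k : ℕ => (t * t + 1 / ((k : ℝ) + 1))⁻¹ * t) atTop (𝓝 t⁻¹) := by
  rcases eq_or_ne t 0 with rfl | ht
  · simp
  · have h1 : Tendsto (fun k : ℕ => t * t + 1 / ((k : ℝ) + 1)) atTop (𝓝 (t * t + 0)) :=
      tendsto_one_div_add_atTop_nhds_zero_nat.const_add _
    rw [add_zero] at h1
    have h2 := (h1.inv₀ (mul_ne_zero ht ht)).mul_const t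
    rwa [mul_inv, mul_assoc, inv_mul_cancel₀ ht, mul_one] at h2

/-- The pseudo-inverse is discontinuous where the rank changes, but it is the pointwise limit of (A²
+ ε)⁻¹A as ε ↓ 0, including at zero eigenvalues. -/
theorem MatrixMeasurable.pinv {m : ℕ} {A : Ω → Matrix (Fin m) (Fin m) ℝ}
    (hA : MatrixMeasurable A) (hs : ∀ ω, (A ω).IsHermitian) :
    MatrixMeasurable fun ω => pinv (A ω) := fun i j => by
  refine measurable_of_tendsto_metrizable
    (f := fun (k : ℕ) ω => cfc (fun t : ℝ => (t * t + 1 / ((k : ℝ) + 1))⁻¹ * t) (A ω) i j)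
    (fun k => ?_) (tendsto_pi_nhds.2 fun ω => tendsto_cfc_apply (hs ω) tendsto_resolvent_inv i j)
  have e : ∀ ω, cfc (fun t : ℝ => (t * t + 1 / ((k : ℝ) + 1))⁻¹ * t) (A ω)
      = (A ω * A ω + (1 / ((k : ℝ) + 1)) • 1)⁻¹ * A ω :=
    fun ω => cfc_resolvent (hs ω) Nat.one_div_pos_of_nat
  simp only [e]
  exact (((hA.mul hA).add (matrixMeasurable_const _)).inv.mul hA) i j

end MeasurableMatrix

theorem pinv_isHermitian {m : ℕ} (A : Matrix (Fin m) (Fin m) ℝ) : (pinv A).IsHermitian :=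
  cfc_predicate (R := ℝ) _ A

namespace Model

variable {Ω 𝒳 𝒲 : Type*} [MeasurableSpace Ω] [MeasurableSpace 𝒳] [MeasurableSpace 𝒲]
  {M : Model Ω 𝒳 𝒲} {μ : Measure Ω} {f : Linf 𝒳 → ℝ}

theorem matrixMeasurable_Ψmat (n : ℕ) : MatrixMeasurable (M.Ψmat n) :=
  fun i j => (M.ψvec_mem_Linf n j).1.comp (M.measurable_X i)

theorem matrixMeasurable_Bmat (n : ℕ) : MatrixMeasurable (M.Bmat n) :=
  fun i k => (M.bvec_mem_Linf n k).1.comp (M.measurable_W i)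

theorem matrixMeasurable_Gbhat (n : ℕ) : MatrixMeasurable (M.Gbhat n) :=
  ((matrixMeasurable_Bmat n).transpose.mul (matrixMeasurable_Bmat n)).const_smul _

theorem matrixMeasurable_Shat (n : ℕ) : MatrixMeasurable (M.Shat n) :=
  ((matrixMeasurable_Bmat n).transpose.mul (matrixMeasurable_Ψmat n)).const_smul _

theorem measurable_tsls (n : ℕ) {y : Ω → Fin n → ℝ} (hy : ∀ i, Measurable fun ω => y ω i)
    (j : Fin (M.J n)) : Measurable fun ω => M.tsls n ω (y ω) j := by
  have hΨ := matrixMeasurable_Ψmat (M := M) n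
  have hB := matrixMeasurable_Bmat (M := M) n
  have hP := (hB.transpose.mul hB).pinv fun ω =>
    Matrix.isHermitian_conjTranspose_mul_self (M.Bmat n ω)
  have hL := ((hΨ.transpose.mul hB).mul hP).mul hB.transpose
  refine MatrixMeasurable.mulVec ((hL.mul hΨ).pinv fun ω => ?_) (hL.mulVec hy) j
  rw [Matrix.IsHermitian, Matrix.conjTranspose_eq_transpose_of_trivial]
  have hsym : (pinv ((M.Bmat n ω)ᵀ * M.Bmat n ω))ᵀ = pinv ((M.Bmat n ω)ᵀ * M.Bmat n ω) :=
    pinv_isHermitian _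
  simp only [Matrix.transpose_mul, Matrix.transpose_transpose, hsym, Matrix.mul_assoc]

theorem measurable_uhat (n i : ℕ) : Measurable fun ω => M.uhat n ω i := by
  simp only [uhat, hhat, lin_apply, dotProduct]
  exact (M.measurable_Y i).sub (Finset.measurable_fun_sum _ fun j _ =>
    (measurable_tsls n (fun i => M.measurable_Y i) j).mul
      ((M.ψvec_mem_Linf n j).1.comp (M.measurable_X i)))

theorem matrixMeasurable_Omhat (n : ℕ) : MatrixMeasurable (M.Omhat n) := fun k l => by
  simp only [Omhat, Matrix.smul_apply, Matrix.sum_apply, Matrix.vecMulVec_apply, smul_eq_mul]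
  have hb : ∀ (i : ℕ) k, Measurable fun ω => M.bvec n (M.W i ω) k :=
    fun i k => (M.bvec_mem_Linf n k).1.comp (M.measurable_W i)
  have hsum : Measurable fun ω => ∑ i : Fin n,
      M.uhat n ω i ^ 2 * (M.bvec n (M.W i ω) k * M.bvec n (M.W i ω) l) :=
    Finset.measurable_fun_sum _ fun (i : Fin n) _ =>
      ((measurable_uhat n i).pow_const 2).mul ((hb i k).mul (hb i l))
  exact hsum.const_mul _

/-- Needed for convergence in distribution of the studentised statistic; the sample matrices are
measurable outright, the derivatives at ĥ by hypothesis. -/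
theorem aemeasurable_sdhat (n : ℕ)
    (hD : ∀ j, AEMeasurable (fun ω => M.Dψ f n (M.hhat n ω) j) μ) :
    AEMeasurable (M.sdhat f n) μ := by
  have hS := matrixMeasurable_Shat (M := M) n
  have hG := (matrixMeasurable_Gbhat (M := M) n).inv
  have hQ := ((hS.transpose.mul hG).mul hS).inv
  have hA := ((((((hQ.mul hS.transpose).mul hG).mul (matrixMeasurable_Omhat n)).mul hG).mul
    hS).mul hQ)
  refine Measurable.comp_aemeasurable Real.continuous_sqrt.measurable ?_
  simp only [sandwich, dotProduct, Matrix.mulVec]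
  refine Finset.aemeasurable_fun_sum _ fun i _ => (hD i).mul ?_
  exact Finset.aemeasurable_fun_sum _ fun j _ => ((hA i j).aemeasurable).mul (hD j)

variable [IsProbabilityMeasure μ]

/-- With `f` linear or with consistent derivatives, the estimated representer is consistent and
the derivatives at `ĥ` are random variables. -/
theorem representer_facts (h : M.IsRegularSieve μ)
    (hrep : ¬ IsLinearMap ℝ f → M.RepresenterConsistent μ f) :
    (∀ n j, AEMeasurable (fun ω => M.Dψ f n (M.hhat n ω) j) μ) ∧
    Tendsto (fun x : ℕ × Ω =>
      vnorm (M.apop μ x.1 (M.Dψ f x.1 (M.hhat x.1 x.2)) - M.astar μ f x.1) /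
        vnorm (M.astar μ f x.1)) (probFilter μ) (𝓝 0) := by
  by_cases hf : IsLinearMap ℝ f
  · have e : ∀ n g, M.Dψ f n g = M.Dψ f n M.h₀ := fun n g => by
      funext j
      simp only [Dψ, dirDeriv_of_isLinearMap hf]
    refine ⟨fun n j => ?_, tendsto_const_nhds.congr fun x => ?_⟩
    · simp only [e n (M.hhat n _)]
      exact aemeasurable_const
    · rw [e, astar, sub_self, vnorm_eq_zero.2 rfl, zero_div]
  · obtain ⟨h1, -, h3⟩ := hrep hf
    refine ⟨h1, (tendstoInMeasure_iff_probFilter.1 h3).congr fun x => ?_⟩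
    rw [weakNorm_vhatstar_sub h, weakNorm_vstar h, astar]

/-- Slutsky: t/s = (t/σ)(s/σ)⁻¹ as soon as σ ≠ 0. This holds even where s = 0, since both sides are
then 0. -/
theorem tendsto_stdNormal_of_ratio {t s : ℕ → Ω → ℝ} {σ : ℕ → ℝ} (hσ : ∀ᶠ n in atTop, σ n ≠ 0)
    (ht : TendstoStdNormal μ fun n ω => t n ω / σ n)
    (hs : Tendsto (fun x : ℕ × Ω => s x.1 x.2 / σ x.1) (probFilter μ) (𝓝 1))
    (hsm : ∀ n, AEMeasurable (s n) μ) (htm : ∀ n, AEMeasurable (t n) μ) :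
    TendstoStdNormal μ fun n ω => t n ω / s n ω := by
  have hinv : Tendsto (fun x : ℕ × Ω => (s x.1 x.2 / σ x.1)⁻¹) (probFilter μ) (𝓝 1) := by
    simpa using hs.inv₀ one_ne_zero
  have hprod := ht.continuous_comp_prodMk_of_tendstoInMeasure_const
    (g := fun x : ℝ × ℝ => x.1 * x.2) (by fun_prop)
    (Y := fun n ω => (s n ω / σ n)⁻¹) (tendstoInMeasure_iff_probFilter.2 hinv)
    fun n => ((hsm n).div_const _).inv
  simp only [id, mul_one] at hprod
  refine tendstoInDistribution_of_tendstoInMeasure_sub _ _ hprod ?_ fun n => (htm n).div (hsm n)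
  refine tendstoInMeasure_iff_probFilter.2 (tendsto_const_nhds.congr' ?_)
  filter_upwards [eventually_fst hσ] with x hx
  simp only [Pi.sub_apply]
  rw [inv_div, div_mul_div_cancel₀ hx, sub_self]; rfl

end Model

end NPIV

/-! ### Assembly of the two parts of the theorem. -/

namespace NPIV

/-- The theorem for regressors and instruments with values in arbitrary measurable spaces. -/
theorem asymptotic_normality {Ω 𝒳 𝒲 : Type*} [MeasurableSpace Ω] [MeasurableSpace 𝒳]
    [MeasurableSpace 𝒲] (μ : Measure Ω) [IsProbabilityMeasure μ] (M : Model Ω 𝒳 𝒲)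
    (f : Linf 𝒳 → ℝ)
    (hsample : M.IsRandomSample μ) (hsieve : M.IsRegularSieve μ)
    (hf_meas : ∀ n, AEMeasurable (fun ω => f (M.hhat n ω)) μ)
    (hv : ∀ᶠ n in atTop, M.weakNorm μ n (M.vstar μ f n) ≠ 0)
    (hT : Function.Injective (M.T μ))
    (hvar : M.CondVarBounded μ) (hvar_low : M.CondVarBddBelow μ) (hui : M.CondUnifIntegrable μ)
    (hinstr : Tendsto (fun n => M.τ μ n * M.instrErr μ n) atTop (𝓝 0))
    (hlin : M.LinearCase μ f ∨ M.LinearizableCase μ f)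
    (hrate : Tendsto (fun n : ℕ => M.τ μ n * M.ζ μ n * Real.sqrt (M.J n * Real.log n / n))
      atTop (𝓝 0)) :
    TendstoStdNormal μ (fun n ω => Real.sqrt n * (f (M.hhat n ω) - f M.h₀) / M.sd μ f n) ∧
    (TendstoInMeasure μ (fun n ω => supNorm (M.hhat n ω - M.h₀)) atTop (fun _ => 0) →
      (∃ δ : ℝ, 0 < δ ∧ Integrable (fun ω => |M.u 0 ω| ^ (2 + δ)) μ ∧
        Tendsto (fun n : ℕ => M.ζ μ n ^ ((2 + δ) / δ) * Real.sqrt (Real.log n / n))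
          atTop (𝓝 0)) →
      (¬ IsLinearMap ℝ f → M.RepresenterConsistent μ f) →
      TendstoInMeasure μ (fun n ω => |M.sdhat f n ω / M.sd μ f n - 1|) atTop (fun _ => 0) ∧
      TendstoStdNormal μ
        (fun n ω => Real.sqrt n * (f (M.hhat n ω) - f M.h₀) / M.sdhat f n ω)) := by
  have hv' : ∀ᶠ n in atTop, vnorm (M.astar μ f n) ≠ 0 := by
    filter_upwards [hv] with n hn
    rwa [Model.weakNorm_vstar hsieve] at hn
  -- A nonzero representer forces J ≠ 0 eventually, so the unit sphere of the sieve space is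
  -- nonempty and τ ≥ 1.
  have hR : M.SieveRates μ := Model.sieveRates_of_rate hsieve hT
    (hv'.mono fun n hn => Model.J_ne_zero_of_vnorm_ne_zero _ hn) hinstr hrate
  have hnormal := Model.tendsto_stdNormal_sd hR hsample hvar hvar_low hv' hui hlin hf_meas
  refine ⟨hnormal, fun hsup hmom hrep => ?_⟩
  obtain ⟨δ, hδ, hint, hrate'⟩ := hmom
  obtain ⟨hDm, hD⟩ := Model.representer_facts hsieve hrep
  have hsup' : Tendsto (fun x : ℕ × Ω => supNorm (M.hhat x.1 x.2 - M.h₀)) (probFilter μ) (𝓝 0) :=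
    (tendstoInMeasure_iff_probFilter (Z := fun n ω => supNorm (M.hhat n ω - M.h₀))).1 hsup
  have hratio : Tendsto (fun x : ℕ × Ω => M.sdhat f x.1 x.2 / M.sd μ f x.1) (probFilter μ)
      (𝓝 1) := Model.tendsto_sdhat_div_sd hR hsample hvar hv' hvar_low hui hδ hint hrate'
    hsup' hD
  obtain ⟨c, hc, hsd⟩ := Model.exists_mul_vnorm_astar_le_sd hsieve hvar hvar_low f
  have hsd0 : ∀ᶠ n in atTop, M.sd μ f n ≠ 0 := by
    filter_upwards [hv'] with n hn
    have hpos : 0 < vnorm (M.astar μ f n) := lt_of_le_of_ne (vnorm_nonneg _) (Ne.symm hn)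
    exact ((mul_pos hc hpos).trans_le (hsd n)).ne'
  constructor
  · refine tendstoInMeasure_iff_probFilter.2 ?_
    simpa using (hratio.sub_const 1).abs
  · exact Model.tendsto_stdNormal_of_ratio hsd0 hnormal hratio
      (fun n => Model.aemeasurable_sdhat n (hDm n))
      fun n => ((hf_meas n).sub_const _).const_mul _

end NPIV
theorem theoremA1 {d d' : ℕ} {𝒳 : Set (EuclideanSpace ℝ (Fin d))}
    {𝒲 : Set (EuclideanSpace ℝ (Fin d'))} {Ω : Type*} [MeasurableSpace Ω]
    (μ : Measure Ω) [IsProbabilityMeasure μ] (M : Model Ω 𝒳 𝒲) (f : Linf 𝒳 → ℝ)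
    (hsample : M.IsRandomSample μ) (hsieve : M.IsRegularSieve μ)
    (hf_meas : ∀ n, AEMeasurable (fun ω => f (M.hhat n ω)) μ)
    (hv : ∀ᶠ n in atTop, M.weakNorm μ n (M.vstar μ f n) ≠ 0)
    (hT : Function.Injective (M.T μ))
    (hvar : M.CondVarBounded μ) (hvar_low : M.CondVarBddBelow μ) (hui : M.CondUnifIntegrable μ)
    (hinstr : Tendsto (fun n => M.τ μ n * M.instrErr μ n) atTop (𝓝 0))
    (hlin : M.LinearCase μ f ∨ M.LinearizableCase μ f)
    (hrate : Tendsto (fun n : ℕ => M.τ μ n * M.ζ μ n * Real.sqrt (M.J n * Real.log n / n))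
      atTop (𝓝 0)) :
    TendstoStdNormal μ (fun n ω => Real.sqrt n * (f (M.hhat n ω) - f M.h₀) / M.sd μ f n) ∧
    (TendstoInMeasure μ (fun n ω => supNorm (M.hhat n ω - M.h₀)) atTop (fun _ => 0) →
      (∃ δ : ℝ, 0 < δ ∧ Integrable (fun ω => |M.u 0 ω| ^ (2 + δ)) μ ∧
        Tendsto (fun n : ℕ => M.ζ μ n ^ ((2 + δ) / δ) * Real.sqrt (Real.log n / n))
          atTop (𝓝 0)) →
      (¬ IsLinearMap ℝ f → M.RepresenterConsistent μ f) →
      TendstoInMeasure μ (fun n ω => |M.sdhat f n ω / M.sd μ f n - 1|) atTop (fun _ => 0) ∧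
      TendstoStdNormal μ
        (fun n ω => Real.sqrt n * (f (M.hhat n ω) - f M.h₀) / M.sdhat f n ω)) := by
  exact asymptotic_normality μ M f hsample hsieve hf_meas hv hT hvar hvar_low hui hinstr hlin hrate
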